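/- Let $\mathcal H$ be a complex Hilbert space and let $H$ be a (possibly unbounded) self-adjoint operator in $\mathcal H$ (the Hamiltonian of a closed quantum system). Then there are a unique projection-valued measure $E$ on the Borel sets of $\mathbb R$ with $H=\int\lambda\,dE(\lambda)$, a unique strongly continuous unitary group $U(t)=e^{-itH}$ with infinitesimal generator $-iH$, and, for every $z\in\mathbb C\setminus\mathbb R$, a unique bounded inverse $R(z)=(H-z)^{-1}$. Write $P(\lambda)=E(\{\lambda\})$, $E(\lambda)=E((-\infty,\lambda])$; let $\mathcal H_p$ be the closed linear hull of $\bigcup_{\lambda}P(\lambda)\mathcal H$, $\mathcal H_c$ the set of $\psi$ for which $\lambda\mapsto E(\lambda)\psi$ is continuous, and $\mathcal H_{ac}$ the set of $\psi$ for which $B\mapsto\langle\psi,E(B)\psi\rangle$ is absolutely continuous with respect to Lebesgue measure. For $\psi$ in the domain of $H$, $\psi(t)=e^{-itH}\psi$ stays in the domain and satisfies $\frac1i\frac{d\psi}{dt}(t)+H\psi(t)=0$. The time-dependent analysis (through $e^{-itH}$) and the stationary analysis (through $E$ and $R(z)$) determine each other as follows. 1. (Point spectrum.) For every $\lambda\in\mathbb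 R$, $P(\lambda)\mathcal H=\{\psi\in D(H): H\psi=\lambda\psi\}$. For $\psi\in\mathcal H_p$ and $t\in\mathbb R$, $e^{-itH}\psi=\sum_{\lambda\in\mathbb R}e^{-it\lambda}P(\lambda)\psi$ (unconditionally convergent). Conversely, for every $\lambda\in\mathbb R$ and $\psi\in\mathcal H$, $$P(\lambda)\psi=\lim_{t_2-t_1\to\infty}\frac1{t_2-t_1}\int_{t_1}^{t_2}e^{-it\lambda}e^{itH}\psi\,dt .$$ 2. (Fourier transform of the spectral measure.) For all $\psi\in\mathcal H$, $t\in\mathbb R$: $\langle\psi,e^{-itH}\psi\rangle=\int_{\mathbb R}e^{-it\lambda}\,d\langle\psi,E(\lambda)\psi\rangle$. If $\psi\in\mathcal H_{ac}$ and $\varphi\in\mathcal H$, then for almost every $\lambda\in\mathbb R$ the derivative $\frac{d}{d\lambda}\langle\varphi,E(\lambda)\psi\rangle$ and the boundary values $\langle\varphi,R(\lambda\pm i0)\psi\rangle=\lim_{\epsilon\downarrow0}\langle\varphi,R(\lambda\pm i\epsilon)\psi\rangle$ exist, and $$\frac{d}{d\lambda}\langle\varphi,E(\lambda)\psi\rangle=\frac1{2\pi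 i}\bigl(\langle\varphi,R(\lambda+i0)\psi\rangle-\langle\varphi,R(\lambda-i0)\psi\rangle\bigr);$$ this derivative is Lebesgue integrable, $\langle\varphi,E(B)\psi\rangle=\int_B\frac{d}{d\lambda}\langle\varphi,E(\lambda)\psi\rangle\,d\lambda$ for all Borel sets $B$, and for all $t\in\mathbb R$ $$\langle\varphi,e^{-itH}\psi\rangle=\int_{\mathbb R}e^{-it\lambda}\frac{d}{d\lambda}\langle\varphi,E(\lambda)\psi\rangle\,d\lambda=\frac1{2\pi i}\int_{\mathbb R}e^{-it\lambda}\bigl(\langle\varphi,R(\lambda+i0)\psi\rangle-\langle\varphi,R(\lambda-i0)\psi\rangle\bigr)d\lambda .$$ 3. (Fourier–Laplace transform.) For all $\psi\in\mathcal H$, with absolutely convergent integrals, $$R(z)\psi=i\int_0^{\infty}e^{itz}e^{-itH}\psi\,dt\quad(\operatorname{Im}z>0),\qquad R(z)\psi=-i\int_{-\infty}^{0}e^{itz}e^{-itH}\psi\,dt\quad(\operatorname{Im}z<0).$$ 4. If $\mathcal H_c=\mathcal H_{ac}$ (no singular continuous spectrum), these cases cover the whole space: every $\psi\in\mathcal H$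 is a sum $\psi=\psi_p+\psi_{ac}$ of orthogonal vectors $\psi_p\in\mathcal H_p$, $\psi_{ac}\in\mathcal H_{ac}$. -/

import Mathlib

open MeasureTheory Filter Topology
open scoped InnerProductSpace

noncomputable section

/-- A projection-valued measure on the Borel sets of the real line: a map from Borel sets to
orthogonal projections of a Hilbert space that is countably additive in the strong operator
topology and takes the value `1` on the whole line. As for Mathlib's vector measures, the value
at a set that is not Borel is `0` by convention. -/
structure ProjectionValuedMeasure (𝓗 : Type*) [NormedAddCommGroup 𝓗] [InnerProductSpace ℂ 𝓗]
    [CompleteSpace 𝓗] where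
  toFun : Set ℝ → 𝓗 →L[ℂ] 𝓗
  isStarProjection : ∀ B, MeasurableSet B → IsStarProjection (toFun B)
  univ_eq_one : toFun Set.univ = 1
  hasSum_iUnion : ∀ B : ℕ → Set ℝ, (∀ i, MeasurableSet (B i)) →
    Pairwise (fun i j => Disjoint (B i) (B j)) →
    ∀ ψ : 𝓗, HasSum (fun i => toFun (B i) ψ) (toFun (⋃ i, B i) ψ)
  not_measurable : ∀ B, ¬ MeasurableSet B → toFun B = 0

/-- A strongly continuous one-parameter group of unitary operators. -/
structure UnitaryGroup (𝓗 : Type*) [NormedAddCommGroup 𝓗] [InnerProductSpace ℂ 𝓗]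
    [CompleteSpace 𝓗] where
  toFun : ℝ → 𝓗 →L[ℂ] 𝓗
  mem_unitary : ∀ t, toFun t ∈ unitary (𝓗 →L[ℂ] 𝓗)
  map_zero : toFun 0 = 1
  map_add : ∀ s t, toFun (s + t) = toFun s * toFun t
  continuous_apply : ∀ ψ : 𝓗, Continuous (fun t => toFun t ψ)

section

variable {𝓗 : Type*} [NormedAddCommGroup 𝓗] [InnerProductSpace ℂ 𝓗] [CompleteSpace 𝓗]

namespace ProjectionValuedMeasure

instance : CoeFun (ProjectionValuedMeasure 𝓗) (fun _ => Set ℝ → 𝓗 →L[ℂ] 𝓗) := ⟨toFun⟩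

variable (E : ProjectionValuedMeasure 𝓗)

theorem empty_apply (ψ : 𝓗) : E ∅ ψ = 0 := by
  have h := E.hasSum_iUnion (fun _ => ∅) (fun _ => MeasurableSet.empty)
    (fun _ _ _ => disjoint_bot_left) ψ
  exact tendsto_nhds_unique tendsto_const_nhds h.summable.tendsto_atTop_zero

theorem norm_sq_eq {B : Set ℝ} (hB : MeasurableSet B) (ψ : 𝓗) :
    ‖E B ψ‖ ^ 2 = RCLike.re ⟪ψ, E B ψ⟫_ℂ := by
  have hP := E.isStarProjection B hB
  have hsymm := hP.isSelfAdjoint.isSymmetric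
  have hid : E B (E B ψ) = E B ψ := by
    have := congrArg (fun T : 𝓗 →L[ℂ] 𝓗 => T ψ) hP.isIdempotentElem
    simpa using this
  rw [← @inner_self_eq_norm_sq ℂ]
  have := hsymm ψ (E B ψ)
  simp only [ContinuousLinearMap.coe_coe] at this
  rw [this, hid]

/-- The scalar spectral measure `B ↦ ⟪ψ, E(B) ψ⟫ = ‖E(B) ψ‖ ^ 2` of a vector `ψ`. -/
def scalarMeasure (ψ : 𝓗) : Measure ℝ :=
  Measure.ofMeasurable (fun B _ => ENNReal.ofReal (‖E B ψ‖ ^ 2))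
    (by simp [E.empty_apply])
    (by
      intro B hB hd
      have h := E.hasSum_iUnion B hB hd ψ
      have h1 : HasSum (fun i => ‖E (B i) ψ‖ ^ 2) (‖E (⋃ i, B i) ψ‖ ^ 2) := by
        have h2 : HasSum (fun i => RCLike.re ⟪ψ, E (B i) ψ⟫_ℂ)
            (RCLike.re ⟪ψ, E (⋃ i, B i) ψ⟫_ℂ) :=
          (RCLike.hasSum_re ℂ (h.mapL (innerSL ℂ ψ)))
        rw [E.norm_sq_eq (MeasurableSet.iUnion hB)]
        simpa only [E.norm_sq_eq (hB _)] using h2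
      rw [← h1.tsum_eq]
      exact ENNReal.ofReal_tsum_of_nonneg (fun _ => sq_nonneg _) h1.summable)

/-- `E` is the spectral measure of the (unbounded) operator `H`, that is, `H = ∫ x dE(x)`: the
domain of `H` consists of the vectors `ψ` with `∫ x ^ 2 d⟪ψ, E(x) ψ⟫ < ∞`, and
`⟪ψ, H ψ⟫ = ∫ x d⟪ψ, E(x) ψ⟫` for such `ψ`. -/
structure IsSpectralMeasureOf (H : 𝓗 →ₗ.[ℂ] 𝓗) : Prop where
  mem_domain_iff : ∀ ψ : 𝓗, ψ ∈ H.domain ↔ Integrable (fun x : ℝ => x ^ 2) (E.scalarMeasure ψ)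
  inner_apply : ∀ ψ : H.domain,
    ⟪(ψ : 𝓗), H ψ⟫_ℂ = ((∫ x : ℝ, x ∂(E.scalarMeasure (ψ : 𝓗)) : ℝ) : ℂ)

/-- The pure point spectral subspace: the closed linear hull of the ranges of the projections
`P(l) = E({l})`. -/
def pointSubspace : Submodule ℂ 𝓗 :=
  (⨆ l : ℝ, (E {l}).range).topologicalClosure

/-- The continuous spectral subspace: the vectors `ψ` for which the map `l ↦ E((-∞, l]) ψ` is
continuous. -/
def continuousSubspace : Set 𝓗 :=
  {ψ | Continuous fun l : ℝ => E (Set.Iic l) ψ}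

/-- The absolutely continuous spectral subspace: the vectors `ψ` whose scalar spectral measure
is absolutely continuous with respect to Lebesgue measure. -/
def acSubspace : Set 𝓗 :=
  {ψ | E.scalarMeasure ψ ≪ volume}

end ProjectionValuedMeasure

namespace UnitaryGroup

instance : CoeFun (UnitaryGroup 𝓗) (fun _ => ℝ → 𝓗 →L[ℂ] 𝓗) := ⟨toFun⟩

/-- `U` is the unitary group `t ↦ exp (-i t H)`: the infinitesimal generator of `U`, with its
exact domain, is `-i H`. -/
def IsGeneratedBy (U : UnitaryGroup 𝓗) (H : 𝓗 →ₗ.[ℂ] 𝓗) : Prop :=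
  ∀ ψ χ : 𝓗, HasDerivAt (fun t : ℝ => U t ψ) χ 0 ↔
    ∃ h : ψ ∈ H.domain, χ = -(Complex.I • H ⟨ψ, h⟩)

end UnitaryGroup

/-- `R` is the resolvent `(H - z)⁻¹` of `H` at `z`: a bounded everywhere defined two-sided
inverse of `H - z`. -/
structure IsResolventAt (H : 𝓗 →ₗ.[ℂ] 𝓗) (z : ℂ) (R : 𝓗 →L[ℂ] 𝓗) : Prop where
  right_inv : ∀ ψ : 𝓗, ∃ h : R ψ ∈ H.domain, H ⟨R ψ, h⟩ - z • R ψ = ψ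
  left_inv : ∀ ψ : H.domain, R (H ψ - z • (ψ : 𝓗)) = (ψ : 𝓗)

end

end

/-!
The proof goes from the resolvent to the spectral measure, from the spectral measure to the unitary
group, and reads all the formulas off the bounded Borel functional calculus `f ↦ ∫ f dE`
(`ProjectionValuedMeasure.bcalc`), for which dominated convergence holds in the strong operator
topology (`tendsto_bcalc`).

*Existence and uniqueness.* For self-adjoint `H` and non-real `z` the operator `H - z` is bounded
below with closed and dense range, so it has a bounded inverse. The inverse `A = (H + i)⁻¹` is normal
with spectrum in the image of the real line under `x ↦ (x + i)⁻¹`, up to the point `0`, which carries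
no mass because `A` is injective. The continuous functional calculus of `A` and the
Riesz–Markov–Kakutani theorem give scalar measures, these give projections, and transport to the line
gives a projection-valued measure with `∫ (x + i)⁻¹ dE = A`
(`exists_projectionValuedMeasure_of_isResolventAt`), which implies `H = ∫ x dE`. The operators
`∫ exp (-i t x) dE` form a unitary group whose derivative on the domain is `-i H`; its generator is not
larger because `H` is its own adjoint (`IsSpectralMeasureOf.isGeneratedBy`). A unitary group is
determined by its generator, since the difference of two orbits with the same initial value has
constant norm, and a spectral measure is determined by the group, since the matrix elements of the
group are the characteristic functions of the scalar measures.

*Point spectrum and Laplace transforms.* Each of these formulas integrates a scalar identity for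
`exp (-i t x)` against `dE` (`mem_range_singleton_iff`, `hasSum_unitaryGroup`,
`tendsto_average_unitaryGroup`, `bcalc_cauchyKernel_eq_integral_Ioi`). A vector orthogonal to all
eigenvectors is killed by every `E {l}`, hence belongs to the continuous subspace.

*Boundary values.* For `ψ` in the absolutely continuous subspace the complex measure `⟪φ, E(·) ψ⟫` has
an integrable density `g`, so that `⟪φ, R(z) ψ⟫` is the Cauchy transform of `g`. It remains to see that
Cauchy transforms of integrable functions have boundary values almost everywhere with jump `2 π i g`
(`hasCauchyJump_of_integrable`), and by linearity `g ≥ 0` may be assumed. Then the Cauchy transform `F`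
has an imaginary part that is `π` times the Poisson integral of `g`, which tends to `π g` at the
Lebesgue points (`ae_tendsto_integral_upperPoisson`). The real part is controlled through the bounded
holomorphic function `exp (i F)`: by Fatou's theorem (`ae_exists_tendsto_of_bounded`) it has boundary
values, they do not vanish because `Im F` stays finite, and hence `F` itself converges
(`exists_tendsto_of_tendsto_exp`). The boundary values from below are the complex conjugates.
-/


/-! ### Operators and their quadratic forms -/

section QuadraticForms

variable {𝓗 : Type*} [NormedAddCommGroup 𝓗] [InnerProductSpace ℂ 𝓗]

theorem ContinuousLinearMap.ext_of_inner_self {S T : 𝓗 →L[ℂ] 𝓗}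
    (h : ∀ ψ, ⟪ψ, S ψ⟫_ℂ = ⟪ψ, T ψ⟫_ℂ) : S = T := by
  have := (ext_inner_map (S : 𝓗 →ₗ[ℂ] 𝓗) (T : 𝓗 →ₗ[ℂ] 𝓗)).1 fun ψ => by
    have := congrArg (starRingEnd ℂ) (h ψ)
    rwa [inner_conj_symm, inner_conj_symm] at this
  ext ψ
  exact LinearMap.congr_fun this ψ

variable [CompleteSpace 𝓗]

theorem ContinuousLinearMap.inner_star_apply (T : 𝓗 →L[ℂ] 𝓗) (ψ χ : 𝓗) :
    ⟪ψ, star T χ⟫_ℂ = ⟪T ψ, χ⟫_ℂ := by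
  rw [ContinuousLinearMap.star_eq_adjoint, ContinuousLinearMap.adjoint_inner_right]

theorem IsStarProjection.apply_apply {P : 𝓗 →L[ℂ] 𝓗} (hP : IsStarProjection P) (ψ : 𝓗) :
    P (P ψ) = P ψ := by
  simpa using congrArg (fun T : 𝓗 →L[ℂ] 𝓗 => T ψ) hP.isIdempotentElem

theorem IsStarProjection.inner_apply_left {P : 𝓗 →L[ℂ] 𝓗} (hP : IsStarProjection P) (ψ χ : 𝓗) :
    ⟪P ψ, χ⟫_ℂ = ⟪ψ, P χ⟫_ℂ := by
  rw [← ContinuousLinearMap.inner_star_apply, hP.isSelfAdjoint.star_eq]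

theorem IsStarProjection.inner_self_apply {P : 𝓗 →L[ℂ] 𝓗} (hP : IsStarProjection P) (ψ : 𝓗) :
    ⟪ψ, P ψ⟫_ℂ = ((‖P ψ‖ ^ 2 : ℝ) : ℂ) := by
  rw [← hP.apply_apply, ← hP.inner_apply_left, hP.apply_apply, inner_self_eq_norm_sq_to_K]
  simp

/-- A symmetric operator is a projection as soon as its quadratic form is `ψ ↦ ‖P ψ‖ ^ 2`. -/
theorem isStarProjection_of_inner_self {P : 𝓗 →L[ℂ] 𝓗}
    (h : ∀ ψ, ⟪ψ, P ψ⟫_ℂ = ((‖P ψ‖ ^ 2 : ℝ) : ℂ)) : IsStarProjection P := by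
  have hs : star P = P := ContinuousLinearMap.ext_of_inner_self fun ψ => by
    rw [ContinuousLinearMap.inner_star_apply, ← inner_conj_symm, h, Complex.conj_ofReal]
  refine ⟨ContinuousLinearMap.ext_of_inner_self fun ψ => ?_, hs⟩
  rw [h, mul_apply_eq_comp]
  conv_lhs => rw [← hs]
  rw [ContinuousLinearMap.inner_star_apply, hs, inner_self_eq_norm_sq_to_K]
  simp

/-- Projections with `P + Q ≤ 1` are orthogonal to each other. -/
theorem IsStarProjection.mul_eq_zero_of_norm_sq_add_le {P Q : 𝓗 →L[ℂ] 𝓗}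
    (hP : IsStarProjection P) (h : ∀ ψ, ‖P ψ‖ ^ 2 + ‖Q ψ‖ ^ 2 ≤ ‖ψ‖ ^ 2) : Q * P = 0 := by
  ext ψ
  have := h (P ψ)
  rw [hP.apply_apply] at this
  have h0 : ‖Q (P ψ)‖ ^ 2 = 0 := le_antisymm (by linarith) (sq_nonneg _)
  simpa using h0

/-- **Strong limits of functions of an operator.** If the operators `T n` have quadratic forms
`ψ ↦ ∫ f n dν_ψ` and depend isometrically on `f n` in `L²(ν_ψ)`, and if the `f n` converge boundedly
and pointwise, then the `T n` converge strongly, and the quadratic form of the limit is given by the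
limit function. -/
theorem exists_strong_limit {X : Type*} [MeasurableSpace X] (ν : 𝓗 → Measure X)
    [∀ ψ, IsFiniteMeasure (ν ψ)] {f : ℕ → X → ℂ} {g : X → ℂ} {T : ℕ → 𝓗 →L[ℂ] 𝓗} {C : ℝ}
    (hf : ∀ n, Measurable (f n)) (hC : ∀ n x, ‖f n x‖ ≤ C)
    (hlim : ∀ x, Tendsto (fun n => f n x) atTop (𝓝 (g x)))
    (hform : ∀ n ψ, ⟪ψ, T n ψ⟫_ℂ = ∫ x, f n x ∂(ν ψ))
    (hnorm : ∀ n m ψ, ‖T n ψ - T m ψ‖ ^ 2 = ∫ x, ‖f n x - f m x‖ ^ 2 ∂(ν ψ)) :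
    ∃ S : 𝓗 →L[ℂ] 𝓗, (∀ ψ, Tendsto (fun n => T n ψ) atTop (𝓝 (S ψ))) ∧
      ∀ ψ, ⟪ψ, S ψ⟫_ℂ = ∫ x, g x ∂(ν ψ) := by
  have hcauchy : ∀ ψ, CauchySeq fun n => T n ψ := by
    intro ψ
    rw [cauchySeq_iff_tendsto_dist_atTop_0]
    have h1 : Tendsto (fun p : ℕ × ℕ => ∫ x, ‖f p.1 x - f p.2 x‖ ^ 2 ∂(ν ψ)) atTop
        (𝓝 (∫ x, (0 : ℝ) ∂(ν ψ))) := by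
      refine tendsto_integral_filter_of_dominated_convergence (fun _ => (C + C) ^ 2)
        (.of_forall fun p => ?_) (.of_forall fun p => .of_forall fun x => ?_)
        (integrable_const _) (.of_forall fun x => ?_)
      · have := hf p.1
        have := hf p.2
        exact Measurable.aestronglyMeasurable (by fun_prop)
      · rw [Real.norm_of_nonneg (sq_nonneg _)]
        gcongr
        exact (norm_sub_le _ _).trans (add_le_add (hC _ _) (hC _ _))
      · rw [← prod_atTop_atTop_eq]
        have h2 := ((hlim x).comp (tendsto_fst (f := atTop) (g := (atTop : Filter ℕ)))).sub
          ((hlim x).comp (tendsto_snd (f := (atTop : Filter ℕ)) (g := atTop)))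
        simpa using h2.norm.pow 2
    have h2 := h1.sqrt
    simp only [integral_zero, Real.sqrt_zero] at h2
    refine h2.congr fun p => ?_
    rw [dist_eq_norm, ← hnorm, Real.sqrt_sq (norm_nonneg _)]
  choose S hS using fun ψ => cauchySeq_tendsto_of_complete (hcauchy ψ)
  refine ⟨continuousLinearMapOfTendsto T (tendsto_pi_nhds.2 hS), hS, fun ψ => ?_⟩
  have h1 : Tendsto (fun n => ⟪ψ, T n ψ⟫_ℂ) atTop (𝓝 ⟪ψ, S ψ⟫_ℂ) :=
    tendsto_const_nhds.inner (hS ψ)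
  refine tendsto_nhds_unique h1 ?_
  simp only [hform]
  exact tendsto_integral_of_dominated_convergence (fun _ => C)
    (fun n => (hf n).aestronglyMeasurable) (integrable_const _)
    (fun n => .of_forall (hC n)) (.of_forall hlim)

end QuadraticForms

noncomputable section

namespace ProjectionValuedMeasure

variable {𝓗 : Type*} [NormedAddCommGroup 𝓗] [InnerProductSpace ℂ 𝓗] [CompleteSpace 𝓗]
  (E : ProjectionValuedMeasure 𝓗)

/-! ### Projection-valued measures and their scalar measures -/

theorem scalarMeasure_apply {B : Set ℝ} (hB : MeasurableSet B) (ψ : 𝓗) :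
    E.scalarMeasure ψ B = ENNReal.ofReal (‖E B ψ‖ ^ 2) :=
  Measure.ofMeasurable_apply B hB

theorem scalarMeasure_univ (ψ : 𝓗) :
    E.scalarMeasure ψ Set.univ = ENNReal.ofReal (‖ψ‖ ^ 2) := by
  rw [E.scalarMeasure_apply .univ, E.univ_eq_one, one_apply_eq_self]

instance (ψ : 𝓗) : IsFiniteMeasure (E.scalarMeasure ψ) :=
  ⟨by rw [E.scalarMeasure_univ]; exact ENNReal.ofReal_lt_top⟩

theorem scalarMeasure_real {B : Set ℝ} (hB : MeasurableSet B) (ψ : 𝓗) :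
    (E.scalarMeasure ψ).real B = ‖E B ψ‖ ^ 2 := by
  rw [measureReal_def, E.scalarMeasure_apply hB, ENNReal.toReal_ofReal (sq_nonneg _)]

theorem inner_apply_self {B : Set ℝ} (hB : MeasurableSet B) (ψ : 𝓗) :
    ⟪ψ, E B ψ⟫_ℂ = ((E.scalarMeasure ψ).real B : ℂ) := by
  rw [(E.isStarProjection B hB).inner_self_apply, E.scalarMeasure_real hB]

theorem ext_of_scalarMeasure {E F : ProjectionValuedMeasure 𝓗}
    (h : ∀ ψ, E.scalarMeasure ψ = F.scalarMeasure ψ) : E = F := by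
  have : E.toFun = F.toFun := by
    funext B
    by_cases hB : MeasurableSet B
    · exact ContinuousLinearMap.ext_of_inner_self fun ψ => by
        rw [E.inner_apply_self hB, F.inner_apply_self hB, h]
    · rw [E.not_measurable B hB, F.not_measurable B hB]
  cases E
  cases F
  congr

theorem union_of_disjoint {B C : Set ℝ} (hB : MeasurableSet B) (hC : MeasurableSet C)
    (h : Disjoint B C) : E (B ∪ C) = E B + E C :=
  ContinuousLinearMap.ext_of_inner_self fun ψ => by
    rw [E.inner_apply_self (hB.union hC), add_apply, inner_add_right,
      E.inner_apply_self hB, E.inner_apply_self hC, measureReal_union h hC]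
    push_cast
    rfl

theorem mul_of_disjoint {B C : Set ℝ} (hB : MeasurableSet B) (hC : MeasurableSet C)
    (h : Disjoint B C) : E B * E C = 0 := by
  refine (E.isStarProjection C hC).mul_eq_zero_of_norm_sq_add_le fun ψ => ?_
  rw [← E.scalarMeasure_real hC, ← E.scalarMeasure_real hB, ← measureReal_union h.symm hB]
  refine (measureReal_mono (Set.subset_univ _)).trans_eq ?_
  rw [E.scalarMeasure_real .univ, E.univ_eq_one, one_apply_eq_self]

theorem mul_eq_inter {B C : Set ℝ} (hB : MeasurableSet B) (hC : MeasurableSet C) :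
    E B * E C = E (B ∩ C) := by
  have h1 : E B = E (B ∩ C) + E (B \ C) := by
    rw [← E.union_of_disjoint (hB.inter hC) (hB.diff hC) Set.disjoint_sdiff_inter.symm,
      Set.inter_union_sdiff]
  have h2 : E C = E (B ∩ C) + E (C \ B) := by
    rw [Set.inter_comm, ← E.union_of_disjoint (hC.inter hB) (hC.diff hB)
      Set.disjoint_sdiff_inter.symm, Set.inter_union_sdiff]
  have h3 : E (B \ C) * E C = 0 := E.mul_of_disjoint (hB.diff hC) hC Set.disjoint_sdiff_left
  have h4 : E (B ∩ C) * E (C \ B) = 0 := E.mul_of_disjoint (hB.inter hC) (hC.diff hB)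
    (Set.disjoint_left.2 fun x hx hx' => hx'.2 hx.1)
  rw [h1, add_mul, h3, add_zero, h2, mul_add, h4, add_zero,
    (E.isStarProjection _ (hB.inter hC)).isIdempotentElem.eq]

/-! ### The bounded Borel functional calculus of a projection-valued measure -/

/-- Bounded Borel functions on the real line. -/
def _root_.IsBoundedBorel (f : ℝ → ℂ) : Prop := Measurable f ∧ ∃ C, ∀ x, ‖f x‖ ≤ C

/-- `E.Represents f T` says that `T = ∫ f dE`, in the sense of quadratic forms. -/
def Represents (f : ℝ → ℂ) (T : 𝓗 →L[ℂ] 𝓗) : Prop :=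
  ∀ ψ, ⟪ψ, T ψ⟫_ℂ = ∫ x, f x ∂(E.scalarMeasure ψ)

open Classical in
/-- The operator `∫ f dE`, for a bounded Borel function `f`; it is `0` by convention if no
bounded operator represents `f`. -/
def bcalc (f : ℝ → ℂ) : 𝓗 →L[ℂ] 𝓗 :=
  if h : ∃ T, E.Represents f T then h.choose else 0

variable {E} {f g : ℝ → ℂ} {S T : 𝓗 →L[ℂ] 𝓗}

theorem Represents.eq (hS : E.Represents f S) (hT : E.Represents f T) : S = T :=
  ContinuousLinearMap.ext_of_inner_self fun ψ => (hS ψ).trans (hT ψ).symm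

theorem Represents.bcalc_eq (h : E.Represents f T) : E.bcalc f = T := by
  have h' : ∃ T, E.Represents f T := ⟨T, h⟩
  rw [bcalc, dif_pos h']
  exact h'.choose_spec.eq h

theorem Represents.add (hf : IsBoundedBorel f) (hg : IsBoundedBorel g) (hS : E.Represents f S)
    (hT : E.Represents g T) : E.Represents (fun x => f x + g x) (S + T) := fun ψ => by
  obtain ⟨hf, C, hC⟩ := hf
  obtain ⟨hg, D, hD⟩ := hg
  rw [add_apply, inner_add_right, hS, hT, integral_add]
  · exact .of_bound hf.aestronglyMeasurable C (.of_forall hC)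
  · exact .of_bound hg.aestronglyMeasurable D (.of_forall hD)

theorem Represents.const_mul (c : ℂ) (hS : E.Represents f S) :
    E.Represents (fun x => c * f x) (c • S) := fun ψ => by
  rw [smul_apply, inner_smul_right, hS, integral_const_mul]

theorem Represents.star (hS : E.Represents f S) :
    E.Represents (fun x => starRingEnd ℂ (f x)) (star S) := fun ψ => by
  rw [ContinuousLinearMap.inner_star_apply, ← inner_conj_symm, hS, integral_conj]

theorem represents_indicator {B : Set ℝ} (hB : MeasurableSet B) (c : ℂ) :
    E.Represents (B.indicator fun _ => c) (c • E B) := fun ψ => by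
  rw [smul_apply, inner_smul_right, E.inner_apply_self hB,
    integral_indicator_const _ hB, Complex.real_smul, mul_comm]

end ProjectionValuedMeasure

theorem MeasureTheory.SimpleFunc.isBoundedBorel (f : SimpleFunc ℝ ℂ) : IsBoundedBorel f :=
  ⟨f.measurable, f.exists_forall_norm_le⟩

namespace IsBoundedBorel

variable {f g : ℝ → ℂ}

theorem measurable (hf : IsBoundedBorel f) : Measurable f := hf.1

theorem integrable (hf : IsBoundedBorel f) (μ : Measure ℝ) [IsFiniteMeasure μ] :
    Integrable f μ := by
  obtain ⟨hm, C, hC⟩ := hf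
  exact .of_bound hm.aestronglyMeasurable C (.of_forall hC)

theorem const (c : ℂ) : IsBoundedBorel fun _ => c := ⟨measurable_const, ‖c‖, fun _ => le_rfl⟩

theorem add (hf : IsBoundedBorel f) (hg : IsBoundedBorel g) :
    IsBoundedBorel fun x => f x + g x := by
  obtain ⟨hf, C, hC⟩ := hf
  obtain ⟨hg, D, hD⟩ := hg
  exact ⟨hf.add hg, C + D, fun x => (norm_add_le _ _).trans (add_le_add (hC x) (hD x))⟩

theorem mul (hf : IsBoundedBorel f) (hg : IsBoundedBorel g) :
    IsBoundedBorel fun x => f x * g x := by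
  obtain ⟨hf, C, hC⟩ := hf
  obtain ⟨hg, D, hD⟩ := hg
  refine ⟨hf.mul hg, C * D, fun x => ?_⟩
  rw [norm_mul]
  exact mul_le_mul (hC x) (hD x) (norm_nonneg _) ((norm_nonneg _).trans (hC x))

theorem const_mul (hf : IsBoundedBorel f) (c : ℂ) : IsBoundedBorel fun x => c * f x :=
  (const c).mul hf

theorem sub (hf : IsBoundedBorel f) (hg : IsBoundedBorel g) :
    IsBoundedBorel fun x => f x - g x := by
  simpa [sub_eq_add_neg] using hf.add (hg.const_mul (-1))

theorem conj (hf : IsBoundedBorel f) : IsBoundedBorel fun x => starRingEnd ℂ (f x) := by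
  obtain ⟨hf, C, hC⟩ := hf
  exact ⟨Complex.continuous_conj.measurable.comp hf, C, fun x => by simpa using hC x⟩

theorem integrable_norm_sq (hf : IsBoundedBorel f) (μ : Measure ℝ) [IsFiniteMeasure μ] :
    Integrable (fun x => ‖f x‖ ^ 2) μ := by
  obtain ⟨hm, C, hC⟩ := hf
  refine .of_bound (C := C ^ 2) (hm.norm.pow_const 2).aestronglyMeasurable (.of_forall fun x => ?_)
  rw [Real.norm_of_nonneg (sq_nonneg _)]
  exact pow_le_pow_left₀ (norm_nonneg _) (hC x) 2

theorem indicator (hf : IsBoundedBorel f) {B : Set ℝ} (hB : MeasurableSet B) :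
    IsBoundedBorel (B.indicator f) := by
  obtain ⟨hf, C, hC⟩ := hf
  exact ⟨hf.indicator hB, C, fun x => (norm_indicator_le_norm_self f x).trans (hC x)⟩

end IsBoundedBorel

namespace ProjectionValuedMeasure

variable {𝓗 : Type*} [NormedAddCommGroup 𝓗] [InnerProductSpace ℂ 𝓗] [CompleteSpace 𝓗]
  {E : ProjectionValuedMeasure 𝓗} {f g : ℝ → ℂ} {S T : 𝓗 →L[ℂ] 𝓗}

/-- The calculus is multiplicative on simple functions, because `E (B ∩ C) = E B * E C`. -/
theorem exists_represents_simpleFunc_mul (f g : SimpleFunc ℝ ℂ) :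
    ∃ S T, E.Represents f S ∧ E.Represents g T ∧ E.Represents (fun x => f x * g x) (S * T) := by
  classical
  induction f using SimpleFunc.induction with
  | const c hB =>
    induction g using SimpleFunc.induction with
    | const d hC =>
      refine ⟨_, _, by simpa using! represents_indicator hB c,
        by simpa using! represents_indicator hC d, ?_⟩
      rw [smul_mul_smul_comm, E.mul_eq_inter hB hC]
      convert represents_indicator (E := E) (hB.inter hC) (c * d) using 2 with x
      simp only [SimpleFunc.coe_piecewise, SimpleFunc.coe_const, Set.piecewise, Set.indicator,
        Set.mem_inter_iff, Function.const_apply]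
      split_ifs <;> simp_all
    | @add g₁ g₂ _ h₁ h₂ =>
      obtain ⟨S₁, T₁, hS₁, hT₁, hm₁⟩ := h₁
      obtain ⟨S₂, T₂, hS₂, hT₂, hm₂⟩ := h₂
      obtain rfl := hS₁.eq hS₂
      refine ⟨S₁, T₁ + T₂, hS₁, hT₁.add g₁.isBoundedBorel g₂.isBoundedBorel hT₂, ?_⟩
      rw [mul_add]
      convert hm₁.add (.mul (SimpleFunc.isBoundedBorel _) g₁.isBoundedBorel)
        (.mul (SimpleFunc.isBoundedBorel _) g₂.isBoundedBorel) hm₂ using 2 with x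
      simp [mul_add]
  | @add f₁ f₂ _ h₁ h₂ =>
    obtain ⟨S₁, T₁, hS₁, hT₁, hm₁⟩ := h₁
    obtain ⟨S₂, T₂, hS₂, hT₂, hm₂⟩ := h₂
    obtain rfl := hT₁.eq hT₂
    refine ⟨S₁ + S₂, T₁, hS₁.add f₁.isBoundedBorel f₂.isBoundedBorel hS₂, hT₁, ?_⟩
    rw [add_mul]
    convert hm₁.add (f₁.isBoundedBorel.mul g.isBoundedBorel)
      (f₂.isBoundedBorel.mul g.isBoundedBorel) hm₂ using 2 with x
    simp [add_mul]

theorem represents_bcalc_simpleFunc (f : SimpleFunc ℝ ℂ) : E.Represents f (E.bcalc f) := by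
  obtain ⟨S, T, hS, -⟩ := E.exists_represents_simpleFunc_mul f f
  rwa [hS.bcalc_eq]

theorem Represents.mul_simpleFunc {f g : SimpleFunc ℝ ℂ} (hS : E.Represents f S)
    (hT : E.Represents g T) : E.Represents (fun x => f x * g x) (S * T) := by
  obtain ⟨S', T', hS', hT', hm⟩ := E.exists_represents_simpleFunc_mul f g
  rwa [hS.eq hS', hT.eq hT']

theorem norm_sq_of_represents_star_mul
    (h : E.Represents (fun x => starRingEnd ℂ (f x) * f x) (Star.star S * S)) (ψ : 𝓗) :
    ‖S ψ‖ ^ 2 = ∫ x, ‖f x‖ ^ 2 ∂(E.scalarMeasure ψ) := by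
  have h1 := h ψ
  rw [mul_apply_eq_comp, ContinuousLinearMap.inner_star_apply,
    inner_self_eq_norm_sq_to_K] at h1
  have h2 : ∀ x, starRingEnd ℂ (f x) * f x = ((‖f x‖ ^ 2 : ℝ) : ℂ) := fun x => by
    rw [mul_comm, Complex.mul_conj, Complex.normSq_eq_norm_sq]
  simp only [h2, integral_complex_ofReal] at h1
  exact Complex.ofReal_injective (by simpa using h1)

theorem norm_sq_bcalc_simpleFunc_sub (f g : SimpleFunc ℝ ℂ) (ψ : 𝓗) :
    ‖E.bcalc f ψ - E.bcalc g ψ‖ ^ 2 = ∫ x, ‖f x - g x‖ ^ 2 ∂(E.scalarMeasure ψ) := by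
  have h : E.Represents (f - g : SimpleFunc ℝ ℂ) (E.bcalc f - E.bcalc g) := by
    have := (represents_bcalc_simpleFunc f).add f.isBoundedBorel (g.isBoundedBorel.const_mul (-1))
      ((represents_bcalc_simpleFunc (E := E) g).const_mul (-1))
    convert this using 1
    · funext x; simp [sub_eq_add_neg]
    · simp [sub_eq_add_neg]
  have hs : E.Represents ((f - g : SimpleFunc ℝ ℂ).map (starRingEnd ℂ))
      (star (E.bcalc f - E.bcalc g)) := h.star
  simpa using norm_sq_of_represents_star_mul (hs.mul_simpleFunc h) ψ

theorem exists_simpleFunc_tendsto (hf : IsBoundedBorel f) :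
    ∃ (F : ℕ → SimpleFunc ℝ ℂ) (C : ℝ), (∀ n x, ‖F n x‖ ≤ C) ∧
      ∀ x, Tendsto (fun n => F n x) atTop (𝓝 (f x)) := by
  obtain ⟨hf, C, hC⟩ := hf
  refine ⟨SimpleFunc.approxOn f hf Set.univ 0 (Set.mem_univ _), C + C, fun n x => ?_, fun x => ?_⟩
  · exact (SimpleFunc.norm_approxOn_zero_le hf (Set.mem_univ _) x n).trans
      (add_le_add (hC x) (hC x))
  · exact SimpleFunc.tendsto_approxOn hf (Set.mem_univ _) (by simp)

/-- Every bounded Borel function is represented by an operator: along bounded simple functions that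
converge to it, the calculus converges strongly. -/
theorem represents_bcalc (hf : IsBoundedBorel f) : E.Represents f (E.bcalc f) := by
  obtain ⟨F, C, hC, hF⟩ := exists_simpleFunc_tendsto hf
  obtain ⟨S, -, hS⟩ := exists_strong_limit E.scalarMeasure (fun n => (F n).measurable) hC hF
    (fun n ψ => represents_bcalc_simpleFunc (F n) ψ)
    fun n m ψ => norm_sq_bcalc_simpleFunc_sub (F n) (F m) ψ
  have hS : E.Represents f S := hS
  rwa [hS.bcalc_eq]

theorem inner_bcalc (hf : IsBoundedBorel f) (ψ : 𝓗) :
    ⟪ψ, E.bcalc f ψ⟫_ℂ = ∫ x, f x ∂(E.scalarMeasure ψ) := represents_bcalc hf ψ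

theorem bcalc_add (hf : IsBoundedBorel f) (hg : IsBoundedBorel g) :
    E.bcalc (fun x => f x + g x) = E.bcalc f + E.bcalc g :=
  ((represents_bcalc hf).add hf hg (represents_bcalc hg)).bcalc_eq

theorem bcalc_const_mul (c : ℂ) (hf : IsBoundedBorel f) :
    E.bcalc (fun x => c * f x) = c • E.bcalc f :=
  ((represents_bcalc hf).const_mul c).bcalc_eq

theorem bcalc_sub (hf : IsBoundedBorel f) (hg : IsBoundedBorel g) :
    E.bcalc (fun x => f x - g x) = E.bcalc f - E.bcalc g := by
  have := bcalc_add (E := E) hf (hg.const_mul (-1))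
  rw [bcalc_const_mul _ hg] at this
  simpa [sub_eq_add_neg] using this

theorem bcalc_conj (hf : IsBoundedBorel f) :
    E.bcalc (fun x => starRingEnd ℂ (f x)) = star (E.bcalc f) :=
  (represents_bcalc hf).star.bcalc_eq

theorem bcalc_indicator {B : Set ℝ} (hB : MeasurableSet B) (c : ℂ) :
    E.bcalc (B.indicator fun _ => c) = c • E B :=
  (represents_indicator hB c).bcalc_eq

theorem bcalc_const (c : ℂ) : E.bcalc (fun _ => c) = c • 1 := by
  have := bcalc_indicator (E := E) .univ c
  rwa [Set.indicator_univ, E.univ_eq_one] at this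

/-- Weak continuity of the calculus under bounded pointwise convergence. -/
theorem tendsto_inner_bcalc {F : ℕ → ℝ → ℂ} {C : ℝ} (hF : ∀ n, Measurable (F n))
    (hC : ∀ n x, ‖F n x‖ ≤ C) (hlim : ∀ x, Tendsto (fun n => F n x) atTop (𝓝 (f x)))
    (hf : IsBoundedBorel f) (φ ψ : 𝓗) :
    Tendsto (fun n => ⟪E.bcalc (F n) φ, ψ⟫_ℂ) atTop (𝓝 ⟪E.bcalc f φ, ψ⟫_ℂ) := by
  have key : ∀ χ : 𝓗, Tendsto (fun n => ⟪E.bcalc (F n) χ, χ⟫_ℂ) atTop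
      (𝓝 ⟪E.bcalc f χ, χ⟫_ℂ) := by
    intro χ
    have h1 : Tendsto (fun n => ⟪χ, E.bcalc (F n) χ⟫_ℂ) atTop (𝓝 ⟪χ, E.bcalc f χ⟫_ℂ) := by
      simp only [fun n => inner_bcalc (E := E) ⟨hF n, C, hC n⟩ χ, inner_bcalc hf]
      exact tendsto_integral_of_dominated_convergence (fun _ => C)
        (fun n => (hF n).aestronglyMeasurable) (integrable_const _)
        (fun n => .of_forall (hC n)) (.of_forall hlim)
    have h2 := (Complex.continuous_conj.tendsto _).comp h1
    simpa only [Function.comp_def, inner_conj_symm] using h2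
  have hpol := fun T : 𝓗 →L[ℂ] 𝓗 => inner_map_polarization (T : 𝓗 →ₗ[ℂ] 𝓗) ψ φ
  simp only [ContinuousLinearMap.coe_coe] at hpol
  simp only [hpol]
  exact ((((key _).sub (key _)).add ((key _).const_mul _)).sub ((key _).const_mul _)).div_const _

theorem bcalc_mul (hf : IsBoundedBorel f) (hg : IsBoundedBorel g) :
    E.bcalc (fun x => f x * g x) = E.bcalc f * E.bcalc g := by
  have step : ∀ {f : ℝ → ℂ}, IsBoundedBorel f → ∀ g : SimpleFunc ℝ ℂ,
      E.bcalc (fun x => f x * g x) = E.bcalc f * E.bcalc g := by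
    intro f hf g
    obtain ⟨F, C, hC, hF⟩ := exists_simpleFunc_tendsto hf
    obtain ⟨D, hD⟩ := g.exists_forall_norm_le
    refine ContinuousLinearMap.ext fun φ => ext_inner_right ℂ fun ψ => ?_
    have h1 := tendsto_inner_bcalc (E := E) (fun n => (F n).measurable) hC hF hf (E.bcalc g φ) ψ
    have h2 := tendsto_inner_bcalc (E := E) (F := fun n x => F n x * g x) (C := C * D)
      (fun n => (F n).measurable.mul g.measurable)
      (fun n x => by
        rw [norm_mul]
        exact mul_le_mul (hC n x) (hD x) (norm_nonneg _) ((norm_nonneg _).trans (hC n x)))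
      (fun x => (hF x).mul_const _) (hf.mul g.isBoundedBorel) φ ψ
    refine tendsto_nhds_unique h2 (h1.congr fun n => ?_)
    rw [((represents_bcalc_simpleFunc (F n)).mul_simpleFunc
      (represents_bcalc_simpleFunc (E := E) g)).bcalc_eq]
    rfl
  -- the second factor is approximated only now, with the first one moved to the other side
  obtain ⟨G, D, hD, hG⟩ := exists_simpleFunc_tendsto hg
  refine ContinuousLinearMap.ext fun φ => ext_inner_right ℂ fun ψ => ?_
  have h1 := tendsto_inner_bcalc (E := E) (fun n => (G n).measurable) hD hG hg φ (star (E.bcalc f) ψ)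
  obtain ⟨C, hC⟩ := hf.2
  have h2 := tendsto_inner_bcalc (E := E) (F := fun n x => f x * G n x) (C := C * D)
    (fun n => hf.1.mul (G n).measurable)
    (fun n x => by
      rw [norm_mul]
      exact mul_le_mul (hC x) (hD n x) (norm_nonneg _) ((norm_nonneg _).trans (hC x)))
    (fun x => (hG x).const_mul _) (hf.mul hg) φ ψ
  rw [ContinuousLinearMap.inner_star_apply] at h1
  refine tendsto_nhds_unique h2 (h1.congr fun n => ?_)
  rw [step hf, ContinuousLinearMap.inner_star_apply]
  rfl

theorem bcalc_mul_apply (hf : IsBoundedBorel f) (hg : IsBoundedBorel g) (ψ : 𝓗) :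
    E.bcalc f (E.bcalc g ψ) = E.bcalc (fun x => f x * g x) ψ := by
  rw [bcalc_mul hf hg, mul_apply_eq_comp]

theorem norm_sq_bcalc (hf : IsBoundedBorel f) (ψ : 𝓗) :
    ‖E.bcalc f ψ‖ ^ 2 = ∫ x, ‖f x‖ ^ 2 ∂(E.scalarMeasure ψ) := by
  refine norm_sq_of_represents_star_mul ?_ ψ
  rw [← bcalc_conj hf, ← bcalc_mul hf.conj hf]
  exact represents_bcalc (hf.conj.mul hf)

theorem norm_sq_bcalc_sub (hf : IsBoundedBorel f) (hg : IsBoundedBorel g) (ψ : 𝓗) :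
    ‖E.bcalc f ψ - E.bcalc g ψ‖ ^ 2 = ∫ x, ‖f x - g x‖ ^ 2 ∂(E.scalarMeasure ψ) := by
  rw [← norm_sq_bcalc (hf.sub hg), bcalc_sub hf hg, sub_apply]

theorem norm_bcalc_le (hf : Measurable f) {C : ℝ} (h0 : 0 ≤ C) (hC : ∀ x, ‖f x‖ ≤ C) (ψ : 𝓗) :
    ‖E.bcalc f ψ‖ ≤ C * ‖ψ‖ := by
  refine le_of_sq_le_sq ?_ (by positivity)
  rw [norm_sq_bcalc ⟨hf, C, hC⟩]
  calc ∫ x, ‖f x‖ ^ 2 ∂(E.scalarMeasure ψ) ≤ ∫ x, C ^ 2 ∂(E.scalarMeasure ψ) := by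
        refine integral_mono_of_nonneg (.of_forall fun x => sq_nonneg _) (integrable_const _)
          (.of_forall fun x => ?_)
        exact pow_le_pow_left₀ (norm_nonneg _) (hC x) 2
    _ = (C * ‖ψ‖) ^ 2 := by
        rw [integral_const, E.scalarMeasure_real .univ, E.univ_eq_one, smul_eq_mul]
        simp only [one_apply_eq_self]
        ring

/-- Dominated convergence for the calculus, in the strong operator topology. -/
theorem tendsto_bcalc {ι : Type*} {l : Filter ι} [l.IsCountablyGenerated] {F : ι → ℝ → ℂ} {C : ℝ}
    (hF : ∀ i, Measurable (F i)) (hC : ∀ i x, ‖F i x‖ ≤ C) (hf : IsBoundedBorel f) (ψ : 𝓗)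
    (hlim : ∀ᵐ x ∂(E.scalarMeasure ψ), Tendsto (fun i => F i x) l (𝓝 (f x))) :
    Tendsto (fun i => E.bcalc (F i) ψ) l (𝓝 (E.bcalc f ψ)) := by
  obtain ⟨D, hD⟩ := hf.2
  have h1 : Tendsto (fun i => ∫ x, ‖F i x - f x‖ ^ 2 ∂(E.scalarMeasure ψ)) l
      (𝓝 (∫ x, (0 : ℝ) ∂(E.scalarMeasure ψ))) := by
    refine tendsto_integral_filter_of_dominated_convergence (fun _ => (C + D) ^ 2)
      (.of_forall fun i => ?_) (.of_forall fun i => .of_forall fun x => ?_)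
      (integrable_const _) (hlim.mono fun x hx => ?_)
    · have := hF i
      have := hf.1
      exact Measurable.aestronglyMeasurable (by fun_prop)
    · rw [Real.norm_of_nonneg (sq_nonneg _)]
      gcongr
      exact (norm_sub_le _ _).trans (add_le_add (hC _ _) (hD _))
    · simpa using ((hx.sub_const (f x)).norm).pow 2
  have h2 := h1.sqrt
  simp only [integral_zero, Real.sqrt_zero] at h2
  rw [tendsto_iff_norm_sub_tendsto_zero]
  refine h2.congr fun i => ?_
  rw [← norm_sq_bcalc_sub ⟨hF i, C, hC i⟩ hf, Real.sqrt_sq (norm_nonneg _)]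

/-- The scalar measure of `f(H) ψ` has density `|f| ^ 2` with respect to the one of `ψ`. -/
theorem scalarMeasure_bcalc (hf : IsBoundedBorel f) (ψ : 𝓗) :
    E.scalarMeasure (E.bcalc f ψ) =
      (E.scalarMeasure ψ).withDensity fun x => ENNReal.ofReal (‖f x‖ ^ 2) := by
  ext B hB
  have hi := (IsBoundedBorel.const 1).indicator hB
  have h1 : E B (E.bcalc f ψ) = E.bcalc (B.indicator f) ψ := by
    have := bcalc_indicator (E := E) hB 1
    rw [one_smul] at this
    rw [← this, bcalc_mul_apply hi hf]
    congr 2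
    funext x
    by_cases hx : x ∈ B <;> simp [hx]
  have hf2 := hf.integrable_norm_sq (E.scalarMeasure ψ)
  rw [E.scalarMeasure_apply hB, h1, norm_sq_bcalc (hf.indicator hB), withDensity_apply _ hB,
    ← ofReal_integral_eq_lintegral_ofReal hf2.integrableOn (.of_forall fun x => sq_nonneg _),
    ← integral_indicator hB]
  congr 2
  funext x
  by_cases hx : x ∈ B <;> simp [hx]

end ProjectionValuedMeasure

end

/-! ### Resolvents of self-adjoint operators -/

section SelfAdjoint

variable {𝓗 : Type*} [NormedAddCommGroup 𝓗] [InnerProductSpace ℂ 𝓗] [CompleteSpace 𝓗]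
  {H : 𝓗 →ₗ.[ℂ] 𝓗} {z : ℂ} {R S : 𝓗 →L[ℂ] 𝓗}

namespace IsSelfAdjoint

theorem pmap_inner_left (hH : IsSelfAdjoint H) (x y : H.domain) :
    ⟪H x, (y : 𝓗)⟫_ℂ = ⟪(x : 𝓗), H y⟫_ℂ := by
  have h := LinearPMap.adjoint_isFormalAdjoint hH.dense_domain
  rw [LinearPMap.isSelfAdjoint_def.1 hH] at h
  exact h x y

theorem exists_apply_eq (hH : IsSelfAdjoint H) {y w : 𝓗}
    (h : ∀ x : H.domain, ⟪w, x⟫_ℂ = ⟪y, H x⟫_ℂ) : ∃ hy : y ∈ H.domain, H ⟨y, hy⟩ = w := by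
  have hy : y ∈ H.domain := by
    rw [← LinearPMap.isSelfAdjoint_def.1 hH]
    exact LinearPMap.mem_adjoint_domain_of_exists y ⟨w, h⟩
  refine ⟨hy, hH.dense_domain.eq_of_inner_left ℂ fun v hv => ?_⟩
  rw [h ⟨v, hv⟩]
  exact hH.pmap_inner_left ⟨y, hy⟩ ⟨v, hv⟩

theorem inner_self_im (hH : IsSelfAdjoint H) (x : H.domain) : (⟪(x : 𝓗), H x⟫_ℂ).im = 0 := by
  rw [← Complex.conj_eq_iff_im, inner_conj_symm, hH.pmap_inner_left]

theorem norm_le_norm_sub_smul (hH : IsSelfAdjoint H) (z : ℂ) (x : H.domain) :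
    |z.im| * ‖x‖ ≤ ‖H x - z • (x : 𝓗)‖ := by
  by_cases hx : ‖x‖ = 0
  · rw [hx, mul_zero]
    exact norm_nonneg _
  have h1 : (⟪(x : 𝓗), H x - z • (x : 𝓗)⟫_ℂ).im = -(z.im * ‖x‖ ^ 2) := by
    rw [inner_sub_right, inner_smul_right, inner_self_eq_norm_sq_to_K, Complex.sub_im,
      hH.inner_self_im]
    simp [← Complex.ofReal_pow]
  have h2 : |z.im| * ‖x‖ ^ 2 ≤ ‖x‖ * ‖H x - z • (x : 𝓗)‖ := by
    calc |z.im| * ‖x‖ ^ 2 = |(⟪(x : 𝓗), H x - z • (x : 𝓗)⟫_ℂ).im| := by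
          rw [h1, abs_neg, abs_mul, abs_of_nonneg (sq_nonneg ‖x‖)]
      _ ≤ _ := (Complex.abs_im_le_norm _).trans (norm_inner_le_norm _ _)
  have hx' : 0 < ‖x‖ := lt_of_le_of_ne (norm_nonneg _) (Ne.symm hx)
  refine le_of_mul_le_mul_left ?_ hx'
  calc ‖x‖ * (|z.im| * ‖x‖) = |z.im| * ‖x‖ ^ 2 := by ring
    _ ≤ _ := h2

theorem sub_smul_injective (hH : IsSelfAdjoint H) (hz : z.im ≠ 0) {x y : H.domain}
    (h : H x - z • (x : 𝓗) = H y - z • (y : 𝓗)) : x = y := by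
  have h1 := hH.norm_le_norm_sub_smul z (x - y)
  have h2 : H (x - y) - z • ((x - y : H.domain) : 𝓗) = 0 := by
    rw [H.map_sub, Submodule.coe_sub, smul_sub, ← sub_eq_zero.2 h]
    abel
  rw [h2, norm_zero] at h1
  have h3 : ‖x - y‖ = 0 := by
    by_contra hne
    exact absurd h1 (not_le.2 (mul_pos (abs_pos.2 hz)
      (lt_of_le_of_ne (norm_nonneg _) (Ne.symm hne))))
  exact sub_eq_zero.1 (norm_eq_zero.1 h3)

/-- The range of `H - z` is closed because `H` is closed and `H - z` is bounded below, and it is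
dense because a vector orthogonal to it would be an eigenvector of `H` for `conj z`. -/
theorem exists_sub_smul_eq (hH : IsSelfAdjoint H) (hz : z.im ≠ 0) (w : 𝓗) :
    ∃ x : H.domain, H x - z • (x : 𝓗) = w := by
  let L : H.domain →ₗ[ℂ] 𝓗 := H.toFun - z • H.domain.subtype
  have hL : ∀ x, L x = H x - z • (x : 𝓗) := fun x => rfl
  have hclosed : IsClosed (L.range : Set 𝓗) := by
    refine isClosed_of_closure_subset fun w hw => ?_
    obtain ⟨u, hu, hlim⟩ := mem_closure_iff_seq_limit.1 hw
    choose x hx using hu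
    have hc : CauchySeq fun n => (x n : 𝓗) := by
      refine Metric.cauchySeq_iff'.2 fun ε hε => ?_
      obtain ⟨N, hN⟩ := Metric.cauchySeq_iff'.1 hlim.cauchySeq (|z.im| * ε)
        (mul_pos (abs_pos.2 hz) hε)
      refine ⟨N, fun n hn => ?_⟩
      have h1 := hH.norm_le_norm_sub_smul z (x n - x N)
      rw [← hL, map_sub, hx, hx] at h1
      have h2 := h1.trans_lt ((dist_eq_norm _ _).symm.trans_lt (hN n hn))
      have h3 := lt_of_mul_lt_mul_left h2 (abs_nonneg _)
      rwa [dist_eq_norm]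
    obtain ⟨y, hy⟩ := cauchySeq_tendsto_of_complete hc
    have h1 : Tendsto (fun n => ((x n : 𝓗), H (x n))) atTop (𝓝 (y, w + z • y)) := by
      refine hy.prodMk_nhds ((hlim.add (hy.const_smul z)).congr fun n => ?_)
      rw [← hx, hL, sub_add_cancel]
    have h2 : (y, w + z • y) ∈ H.graph :=
      hH.isClosed.mem_of_tendsto h1 (.of_forall fun n => H.mem_graph (x n))
    obtain ⟨y', hy', hw'⟩ := (LinearPMap.mem_graph_iff _).1 h2
    refine ⟨y', ?_⟩
    rw [hL, hw', hy']
    simp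
  have hdense : L.rangeᗮ = ⊥ := by
    refine (Submodule.eq_bot_iff _).2 fun y hy => ?_
    have h1 : ∀ x : H.domain, ⟪starRingEnd ℂ z • y, x⟫_ℂ = ⟪y, H x⟫_ℂ := fun x => by
      have := (Submodule.mem_orthogonal' _ _).1 hy (L x) ⟨x, rfl⟩
      rw [hL, inner_sub_right, inner_smul_right, sub_eq_zero] at this
      rw [inner_smul_left, Complex.conj_conj, this]
    obtain ⟨hyd, hHy⟩ := hH.exists_apply_eq h1
    have h2 : (⟨y, hyd⟩ : H.domain) = 0 := hH.sub_smul_injective (z := starRingEnd ℂ z)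
      (by simpa using hz) (by rw [hHy]; simp)
    simpa using congrArg Subtype.val h2
  have htop : L.range = ⊤ := by
    rw [← hclosed.submodule_topologicalClosure_eq, Submodule.topologicalClosure_eq_top_iff]
    exact hdense
  obtain ⟨x, hx⟩ : w ∈ L.range := htop ▸ Submodule.mem_top
  exact ⟨x, hx⟩

theorem exists_isResolventAt (hH : IsSelfAdjoint H) (hz : z.im ≠ 0) :
    ∃ R : 𝓗 →L[ℂ] 𝓗, IsResolventAt H z R := by
  choose r hr using hH.exists_sub_smul_eq hz
  let R₀ : 𝓗 →ₗ[ℂ] 𝓗 :=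
    { toFun := fun w => (r w : 𝓗)
      map_add' := fun v w => by
        rw [← Submodule.coe_add]
        refine congrArg Subtype.val (hH.sub_smul_injective hz ?_)
        rw [hr, H.map_add, Submodule.coe_add, smul_add, add_sub_add_comm, hr, hr]
      map_smul' := fun c w => by
        rw [RingHom.id_apply, ← Submodule.coe_smul]
        refine congrArg Subtype.val (hH.sub_smul_injective hz ?_)
        rw [hr, H.map_smul, Submodule.coe_smul, smul_comm z c, ← smul_sub, hr] }
  refine ⟨R₀.mkContinuous |z.im|⁻¹ fun w => ?_, fun w => ⟨(r w).2, hr w⟩, fun x => ?_⟩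
  · rw [← div_eq_inv_mul, le_div_iff₀ (abs_pos.2 hz), mul_comm]
    have := hH.norm_le_norm_sub_smul z (r w)
    rwa [hr] at this
  · exact congrArg Subtype.val (hH.sub_smul_injective hz (hr _))

end IsSelfAdjoint

namespace IsResolventAt

/-- For a self-adjoint `H`, a right inverse of `H - z` is automatically a left inverse. -/
theorem of_right_inv (hH : IsSelfAdjoint H) (hz : z.im ≠ 0)
    (h : ∀ ψ : 𝓗, ∃ h : R ψ ∈ H.domain, H ⟨R ψ, h⟩ - z • R ψ = ψ) : IsResolventAt H z R := by
  refine ⟨h, fun x => ?_⟩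
  obtain ⟨h1, h2⟩ := h (H x - z • (x : 𝓗))
  exact congrArg Subtype.val (hH.sub_smul_injective hz (x := ⟨_, h1⟩) h2)

omit [CompleteSpace 𝓗] in
theorem unique (hR : IsResolventAt H z R) (hS : IsResolventAt H z S) : R = S := by
  ext ψ
  obtain ⟨h, hψ⟩ := hR.right_inv ψ
  have h1 := hS.left_inv ⟨R ψ, h⟩
  rw [hψ] at h1
  exact h1.symm

omit [CompleteSpace 𝓗] in
theorem mem_domain_iff (hR : IsResolventAt H z R) {ψ : 𝓗} :
    ψ ∈ H.domain ↔ ∃ χ, R χ = ψ :=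
  ⟨fun h => ⟨_, hR.left_inv ⟨ψ, h⟩⟩, fun ⟨χ, h⟩ => h ▸ (hR.right_inv χ).1⟩

omit [CompleteSpace 𝓗] in
theorem apply_eq (hR : IsResolventAt H z R) {χ : 𝓗} (h : R χ ∈ H.domain) :
    H ⟨R χ, h⟩ = χ + z • R χ := by
  obtain ⟨h', hχ⟩ := hR.right_inv χ
  exact sub_eq_iff_eq_add.1 hχ

omit [CompleteSpace 𝓗] in
theorem injective (hR : IsResolventAt H z R) {χ : 𝓗} (h : R χ = 0) : χ = 0 := by
  obtain ⟨h', hχ⟩ := hR.right_inv χ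
  have h1 : (⟨R χ, h'⟩ : H.domain) = 0 := Subtype.ext h
  rw [h1, h, H.map_zero, smul_zero, sub_zero] at hχ
  exact hχ.symm

theorem star_eq (hH : IsSelfAdjoint H) (hR : IsResolventAt H z R)
    (hS : IsResolventAt H (starRingEnd ℂ z) S) : star R = S := by
  refine ContinuousLinearMap.ext fun ψ => ext_inner_left ℂ fun φ => ?_
  obtain ⟨h1, hφ⟩ := hR.right_inv φ
  obtain ⟨h2, hψ⟩ := hS.right_inv ψ
  rw [ContinuousLinearMap.inner_star_apply]
  conv_lhs => rw [← hψ]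
  conv_rhs => rw [← hφ]
  rw [inner_sub_right, inner_sub_left, inner_smul_left, inner_smul_right,
    ← hH.pmap_inner_left ⟨R φ, h1⟩ ⟨S ψ, h2⟩]

omit [CompleteSpace 𝓗] in
theorem sub_eq {w : ℂ} (hR : IsResolventAt H z R) (hS : IsResolventAt H w S) :
    R - S = (z - w) • (S * R) := by
  ext ψ
  obtain ⟨h1, hψ⟩ := hR.right_inv ψ
  have h2 := hS.left_inv ⟨R ψ, h1⟩
  have h3 : H ⟨R ψ, h1⟩ - w • R ψ = ψ + (z - w) • R ψ := by
    rw [hR.apply_eq h1, sub_smul]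
    abel
  simp only [h3, map_add, map_smul] at h2
  simp only [sub_apply, smul_apply, mul_apply_eq_comp]
  nth_rw 1 [← h2]
  abel

end IsResolventAt

end SelfAdjoint

noncomputable section

/-! ### From a continuous to a projection-valued functional calculus -/

section ContinuousCalculus

variable {𝓗 : Type*} [NormedAddCommGroup 𝓗] [InnerProductSpace ℂ 𝓗] [CompleteSpace 𝓗]
  {X : Type*} [TopologicalSpace X] [CompactSpace X] [MeasurableSpace X] [BorelSpace X]
  (Φ : C(X, ℂ) →⋆ₐ[ℂ] (𝓗 →L[ℂ] 𝓗))

/-- A real continuous function, as a complex one. -/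
def ContinuousMap.realToComplex (f : C(X, ℝ)) : C(X, ℂ) := ⟨fun x => (f x : ℂ), by fun_prop⟩

omit [CompactSpace X] [MeasurableSpace X] [BorelSpace X] in
theorem inner_starAlgHom_star_mul (f : C(X, ℂ)) (ψ : 𝓗) :
    ⟪ψ, Φ (star f * f) ψ⟫_ℂ = ((‖Φ f ψ‖ ^ 2 : ℝ) : ℂ) := by
  rw [map_mul, map_star, mul_apply_eq_comp, ContinuousLinearMap.inner_star_apply,
    inner_self_eq_norm_sq_to_K]
  simp

/-- The positive functional `f ↦ ⟪ψ, Φ(f) ψ⟫` on real continuous functions. -/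
def vectorFunctional (ψ : 𝓗) : CompactlySupportedContinuousMap X ℝ →ₚ[ℝ] ℝ :=
  PositiveLinearMap.mk₀
    { toFun := fun f => (⟪ψ, Φ (f : C(X, ℝ)).realToComplex ψ⟫_ℂ).re
      map_add' := fun f g => by
        have : ((f + g : CompactlySupportedContinuousMap X ℝ) : C(X, ℝ)).realToComplex =
            (f : C(X, ℝ)).realToComplex + (g : C(X, ℝ)).realToComplex := by
          ext x; simp [ContinuousMap.realToComplex]
        rw [this, map_add, add_apply, inner_add_right, Complex.add_re]
      map_smul' := fun c f => by
        have : ((c • f : CompactlySupportedContinuousMap X ℝ) : C(X, ℝ)).realToComplex =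
            (c : ℂ) • (f : C(X, ℝ)).realToComplex := by
          ext x; simp [ContinuousMap.realToComplex]
        rw [this, map_smul, smul_apply, inner_smul_right, Complex.re_ofReal_mul]
        rfl }
    fun f hf => by
      have h1 : (f : C(X, ℝ)).realToComplex =
          star (ContinuousMap.realToComplex ⟨fun x => Real.sqrt (f x), by fun_prop⟩) *
            ContinuousMap.realToComplex ⟨fun x => Real.sqrt (f x), by fun_prop⟩ := by
        ext x
        have h2 : Real.sqrt (f x) * Real.sqrt (f x) = f x := Real.mul_self_sqrt (hf x)
        simp only [ContinuousMap.realToComplex, ContinuousMap.mul_apply, ContinuousMap.star_apply,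
          ContinuousMap.coe_mk, RCLike.star_def, Complex.conj_ofReal, ← Complex.ofReal_mul, h2]
      change 0 ≤ (⟪ψ, Φ (f : C(X, ℝ)).realToComplex ψ⟫_ℂ).re
      rw [h1, inner_starAlgHom_star_mul, Complex.ofReal_re]
      exact sq_nonneg _

variable [T2Space X]

/-- The measure on `X` that represents the functional `f ↦ ⟪ψ, Φ(f) ψ⟫`. -/
def vectorMeasure (ψ : 𝓗) : Measure X := RealRMK.rieszMeasure (vectorFunctional Φ ψ)

instance (ψ : 𝓗) : (vectorMeasure Φ ψ).Regular := by
  unfold vectorMeasure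
  infer_instance

instance (ψ : 𝓗) : IsFiniteMeasure (vectorMeasure Φ ψ) := inferInstance

omit [T2Space X] in
theorem ContinuousMap.integrable_of_compactSpace {F : Type*} [NormedAddCommGroup F]
    (f : C(X, F)) [SecondCountableTopologyEither X F] (μ : Measure X) [IsFiniteMeasure μ] :
    Integrable f μ :=
  .of_bound f.continuous.aestronglyMeasurable ‖f‖ (.of_forall f.norm_coe_le_norm)

theorem inner_starAlgHom_realToComplex (f : C(X, ℝ)) (ψ : 𝓗) :
    ⟪ψ, Φ f.realToComplex ψ⟫_ℂ = ((∫ x, f x ∂(vectorMeasure Φ ψ) : ℝ) : ℂ) := by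
  have h1 : ∫ x, f x ∂(vectorMeasure Φ ψ) = (⟪ψ, Φ f.realToComplex ψ⟫_ℂ).re :=
    RealRMK.integral_rieszMeasure (vectorFunctional Φ ψ)
      (CompactlySupportedContinuousMap.continuousMapEquiv f)
  have h2 : star f.realToComplex = f.realToComplex := by
    ext x; simp [ContinuousMap.realToComplex]
  rw [h1]
  refine (Complex.conj_eq_iff_re.1 ?_).symm
  rw [inner_conj_symm, ← ContinuousLinearMap.inner_star_apply, ← map_star, h2]

theorem inner_starAlgHom (f : C(X, ℂ)) (ψ : 𝓗) :
    ⟪ψ, Φ f ψ⟫_ℂ = ∫ x, f x ∂(vectorMeasure Φ ψ) := by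
  let u : C(X, ℝ) := ⟨fun x => (f x).re, by fun_prop⟩
  let v : C(X, ℝ) := ⟨fun x => (f x).im, by fun_prop⟩
  have hf : f = u.realToComplex + Complex.I • v.realToComplex := by
    ext x
    simp [ContinuousMap.realToComplex, u, v, mul_comm Complex.I, Complex.re_add_im]
  have h1 := integral_re_add_im (f.integrable_of_compactSpace (vectorMeasure Φ ψ))
  rw [← h1]
  conv_lhs => rw [hf]
  rw [map_add, map_smul, add_apply, smul_apply, inner_add_right, inner_smul_right,
    inner_starAlgHom_realToComplex, inner_starAlgHom_realToComplex, mul_comm]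
  rfl

theorem norm_sq_starAlgHom (f : C(X, ℂ)) (ψ : 𝓗) :
    ‖Φ f ψ‖ ^ 2 = ∫ x, ‖f x‖ ^ 2 ∂(vectorMeasure Φ ψ) := by
  have h1 := inner_starAlgHom_star_mul Φ f ψ
  rw [inner_starAlgHom] at h1
  have h2 : ∀ x, (star f * f) x = ((‖f x‖ ^ 2 : ℝ) : ℂ) := fun x => by
    rw [ContinuousMap.mul_apply, ContinuousMap.star_apply, RCLike.star_def, mul_comm,
      Complex.mul_conj, Complex.normSq_eq_norm_sq]
  simp only [h2, integral_complex_ofReal] at h1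
  exact (Complex.ofReal_injective h1).symm

theorem vectorMeasure_real_univ (ψ : 𝓗) : (vectorMeasure Φ ψ).real Set.univ = ‖ψ‖ ^ 2 := by
  have h1 := norm_sq_starAlgHom Φ 1 ψ
  simp only [map_one, one_apply_eq_self, ContinuousMap.one_apply, norm_one, one_pow,
    integral_const, smul_eq_mul, mul_one] at h1
  exact h1.symm

/-- The indicator function of a closed set is a bounded pointwise limit of continuous functions, so
the calculus extends to it. -/
theorem exists_projection_of_isClosed [HasOuterApproxClosed X] {F : Set X} (hF : IsClosed F) :
    ∃ (f : ℕ → C(X, ℂ)) (P : 𝓗 →L[ℂ] 𝓗), (∀ n x, ‖f n x‖ ≤ 1) ∧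
      (∀ x, Tendsto (fun n => f n x) atTop (𝓝 (F.indicator (fun _ => 1) x))) ∧
      (∀ ψ, Tendsto (fun n => Φ (f n) ψ) atTop (𝓝 (P ψ))) ∧ IsStarProjection P ∧
      ∀ ψ, ⟪ψ, P ψ⟫_ℂ = ((vectorMeasure Φ ψ).real F : ℂ) := by
  let f : ℕ → C(X, ℂ) := fun n => ⟨fun x => ((hF.apprSeq n x : ℝ) : ℂ), by fun_prop⟩
  have hf1 : ∀ n x, ‖f n x‖ ≤ 1 := fun n x => by
    have := HasOuterApproxClosed.apprSeq_apply_le_one hF n x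
    simpa [f] using this
  have hf2 : ∀ x, Tendsto (fun n => f n x) atTop (𝓝 (F.indicator (fun _ => 1) x)) := fun x => by
    have h1 := tendsto_pi_nhds.1 (HasOuterApproxClosed.tendsto_apprSeq hF) x
    have h2 : Continuous fun r : NNReal => ((r : ℝ) : ℂ) := by fun_prop
    have h3 := (h2.tendsto _).comp h1
    have h4 : (((F.indicator (fun _ => (1 : NNReal)) x : NNReal) : ℝ) : ℂ) =
        F.indicator (fun _ => 1) x := by by_cases hx : x ∈ F <;> simp [hx]
    exact h4 ▸ h3
  obtain ⟨P, hP, hform⟩ := exists_strong_limit (vectorMeasure Φ)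
    (fun n => (f n).continuous.measurable) hf1 hf2 (fun n ψ => inner_starAlgHom Φ (f n) ψ)
    fun n m ψ => by
      have := norm_sq_starAlgHom Φ (f n - f m) ψ
      rw [map_sub, sub_apply] at this
      exact this
  have hform' : ∀ ψ, ⟪ψ, P ψ⟫_ℂ = ((vectorMeasure Φ ψ).real F : ℂ) := fun ψ => by
    rw [hform, integral_indicator_const _ hF.measurableSet, Complex.real_smul, mul_one]
  refine ⟨f, P, hf1, hf2, hP, isStarProjection_of_inner_self fun ψ => ?_, hform'⟩
  rw [hform']
  congr 1
  have h1 : Tendsto (fun n => ‖Φ (f n) ψ‖ ^ 2) atTop (𝓝 (‖P ψ‖ ^ 2)) := (hP ψ).norm.pow 2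
  refine tendsto_nhds_unique ?_ h1
  simp only [norm_sq_starAlgHom]
  have h2 : (vectorMeasure Φ ψ).real F =
      ∫ x, ‖F.indicator (fun _ => (1 : ℂ)) x‖ ^ 2 ∂(vectorMeasure Φ ψ) := by
    have : ∀ x, ‖F.indicator (fun _ => (1 : ℂ)) x‖ ^ 2 = F.indicator (fun _ => (1 : ℝ)) x :=
      fun x => by by_cases hx : x ∈ F <;> simp [hx]
    simp only [this]
    rw [integral_indicator_const _ hF.measurableSet, smul_eq_mul, mul_one]
  rw [h2]
  refine tendsto_integral_of_dominated_convergence (fun _ => 1)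
    (fun n => (by fun_prop : Continuous fun x => ‖f n x‖ ^ 2).aestronglyMeasurable)
    (integrable_const _) (fun n => .of_forall fun x => ?_)
    (.of_forall fun x => (hf2 x).norm.pow 2)
  rw [Real.norm_of_nonneg (sq_nonneg _)]
  exact pow_le_one₀ (norm_nonneg _) (hf1 n x)

end ContinuousCalculus

/-! ### Projection-valued measures from families of scalar measures -/

section Construction

variable {𝓗 : Type*} [NormedAddCommGroup 𝓗] [InnerProductSpace ℂ 𝓗] [CompleteSpace 𝓗]
  {X : Type*} [MeasurableSpace X]

variable {ν : 𝓗 → Measure X} [∀ ψ, IsFiniteMeasure (ν ψ)]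

theorem mul_eq_zero_of_disjoint_of_represented (huniv : ∀ ψ, (ν ψ).real Set.univ = ‖ψ‖ ^ 2)
    {B C : Set X} (hC : MeasurableSet C) (hd : Disjoint B C) {P Q : 𝓗 →L[ℂ] 𝓗}
    (hP : IsStarProjection P) (hPν : ∀ ψ, ⟪ψ, P ψ⟫_ℂ = ((ν ψ).real B : ℂ))
    (hQ : IsStarProjection Q) (hQν : ∀ ψ, ⟪ψ, Q ψ⟫_ℂ = ((ν ψ).real C : ℂ)) : P * Q = 0 := by
  refine hQ.mul_eq_zero_of_norm_sq_add_le fun ψ => ?_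
  have h1 := hPν ψ
  have h2 := hQν ψ
  rw [hP.inner_self_apply, Complex.ofReal_inj] at h1
  rw [hQ.inner_self_apply, Complex.ofReal_inj] at h2
  rw [h1, h2, add_comm, ← measureReal_union hd hC, ← huniv]
  exact measureReal_mono (Set.subset_univ _)

/-- Projections that are represented by disjoint sets add up, in the strong operator topology, to a
projection that is represented by the union. -/
theorem exists_hasSum_projection (huniv : ∀ ψ, (ν ψ).real Set.univ = ‖ψ‖ ^ 2)
    {B : ℕ → Set X} (hB : ∀ i, MeasurableSet (B i))
    (hd : Pairwise fun i j => Disjoint (B i) (B j)) {P : ℕ → 𝓗 →L[ℂ] 𝓗}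
    (hP : ∀ i, IsStarProjection (P i))
    (hPν : ∀ i ψ, ⟪ψ, P i ψ⟫_ℂ = ((ν ψ).real (B i) : ℂ)) :
    ∃ Q : 𝓗 →L[ℂ] 𝓗, IsStarProjection Q ∧ (∀ ψ, HasSum (fun i => P i ψ) (Q ψ)) ∧
      ∀ ψ, ⟪ψ, Q ψ⟫_ℂ = ((ν ψ).real (⋃ i, B i) : ℂ) := by
  have horth : ∀ i j, i ≠ j → P i * P j = 0 := fun i j hij =>
    mul_eq_zero_of_disjoint_of_represented huniv (hB j) (hd hij) (hP i) (hPν i) (hP j) (hPν j)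
  have hnorm : ∀ i ψ, ‖P i ψ‖ ^ 2 = (ν ψ).real (B i) := fun i ψ => by
    have := hPν i ψ
    rwa [(hP i).inner_self_apply, Complex.ofReal_inj] at this
  have hmeas : ∀ ψ, HasSum (fun i => (ν ψ).real (B i)) ((ν ψ).real (⋃ i, B i)) := fun ψ => by
    have h1 := measure_iUnion (μ := ν ψ) hd hB
    have h2 := ENNReal.hasSum_toReal (h1 ▸ measure_ne_top (ν ψ) _)
    rwa [← ENNReal.tsum_toReal_eq fun i => measure_ne_top _ _, ← h1] at h2
  have hfam : OrthogonalFamily ℂ (fun i => (P i).range) fun i => (P i).range.subtypeₗᵢ := by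
    rintro i j hij ⟨_, a, rfl⟩ ⟨_, b, rfl⟩
    change ⟪P i a, P j b⟫_ℂ = 0
    rw [(hP i).inner_apply_left, ← mul_apply_eq_comp, horth i j hij]
    simp
  have hsum : ∀ ψ, Summable fun i => P i ψ := fun ψ => by
    have := (hfam.summable_iff_norm_sq_summable fun i => ⟨P i ψ, ψ, rfl⟩).2 (by
      simpa only [Submodule.coe_norm, hnorm] using (hmeas ψ).summable)
    exact this
  have hpart : ∀ s : Finset ℕ, IsStarProjection (∑ i ∈ s, P i) := by
    intro s
    induction s using Finset.induction_on with
    | empty => simp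
    | insert i s hi ih =>
      rw [Finset.sum_insert hi]
      refine (hP i).add ih ?_
      rw [Finset.mul_sum]
      exact Finset.sum_eq_zero fun j hj => horth i j fun h => hi (h ▸ hj)
  choose Q hQ using hsum
  have hT : Tendsto (fun s : Finset ℕ => fun ψ => (∑ i ∈ s, P i) ψ) atTop (𝓝 Q) := by
    refine tendsto_pi_nhds.2 fun ψ => (hQ ψ).congr fun s => ?_
    simp
  have hform : ∀ ψ, ⟪ψ, Q ψ⟫_ℂ = ((ν ψ).real (⋃ i, B i) : ℂ) := fun ψ => by
    have h1 := (hQ ψ).mapL (innerSL ℂ ψ)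
    simp only [innerSL_apply_apply, hPν] at h1
    exact h1.unique ((Complex.hasSum_ofReal).2 (hmeas ψ))
  refine ⟨continuousLinearMapOfTendsto _ hT, isStarProjection_of_inner_self fun ψ => ?_, hQ, hform⟩
  have h1 : Tendsto (fun s : Finset ℕ => ‖(∑ i ∈ s, P i) ψ‖ ^ 2) atTop (𝓝 (‖Q ψ‖ ^ 2)) :=
    (tendsto_pi_nhds.1 hT ψ).norm.pow 2
  have h2 : ∀ s : Finset ℕ, ‖(∑ i ∈ s, P i) ψ‖ ^ 2 = ∑ i ∈ s, (ν ψ).real (B i) := fun s => by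
    refine Complex.ofReal_injective ?_
    rw [← (hpart s).inner_self_apply, sum_apply, inner_sum, Complex.ofReal_sum]
    exact Finset.sum_congr rfl fun i _ => hPν i ψ
  simp only [h2] at h1
  exact (hform ψ).trans (congrArg _ (tendsto_nhds_unique (hmeas ψ) h1))

/-- If every closed set is represented by a projection, then so is every Borel set. -/
theorem exists_projection_of_measurableSet [TopologicalSpace X] [BorelSpace X]
    (huniv : ∀ ψ, (ν ψ).real Set.univ = ‖ψ‖ ^ 2)
    (hclosed : ∀ F : Set X, IsClosed F → ∃ P : 𝓗 →L[ℂ] 𝓗, IsStarProjection P ∧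
      ∀ ψ, ⟪ψ, P ψ⟫_ℂ = ((ν ψ).real F : ℂ)) {B : Set X} (hB : MeasurableSet B) :
    ∃ P : 𝓗 →L[ℂ] 𝓗, IsStarProjection P ∧ ∀ ψ, ⟪ψ, P ψ⟫_ℂ = ((ν ψ).real B : ℂ) := by
  induction B, hB using MeasurableSpace.induction_on_inter
    (s := {s : Set X | IsClosed s}) (BorelSpace.measurable_eq.trans borel_eq_generateFrom_isClosed)
    isPiSystem_isClosed with
  | empty => exact hclosed ∅ isClosed_empty
  | basic F hF => exact hclosed F hF
  | compl B hB ih =>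
    obtain ⟨P, hP, hPν⟩ := ih
    refine ⟨1 - P, hP.one_sub, fun ψ => ?_⟩
    rw [sub_apply, inner_sub_right, hPν, measureReal_compl hB, huniv, one_apply_eq_self,
      inner_self_eq_norm_sq_to_K]
    simp
  | iUnion B hd hB ih =>
    choose P hP hPν using ih
    obtain ⟨Q, hQ, -, hQν⟩ := exists_hasSum_projection huniv hB hd hP hPν
    exact ⟨Q, hQ, hQν⟩

/-- A family of finite measures all of whose Borel sets are represented by projections is the family
of scalar measures of a projection-valued measure. -/
theorem exists_projectionValuedMeasure {ν : 𝓗 → Measure ℝ} [∀ ψ, IsFiniteMeasure (ν ψ)]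
    (huniv : ∀ ψ, (ν ψ).real Set.univ = ‖ψ‖ ^ 2)
    (h : ∀ B : Set ℝ, MeasurableSet B → ∃ P : 𝓗 →L[ℂ] 𝓗, IsStarProjection P ∧
      ∀ ψ, ⟪ψ, P ψ⟫_ℂ = ((ν ψ).real B : ℂ)) :
    ∃ E : ProjectionValuedMeasure 𝓗, ∀ ψ, E.scalarMeasure ψ = ν ψ := by
  classical
  choose P hP hPν using h
  refine ⟨{ toFun := fun B => if hB : MeasurableSet B then P B hB else 0
            isStarProjection := fun B hB => by rw [dif_pos hB]; exact hP B hB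
            univ_eq_one := ?_
            hasSum_iUnion := fun B hB hd ψ => ?_
            not_measurable := fun B hB => by rw [dif_neg hB] }, fun ψ => ?_⟩
  · rw [dif_pos .univ]
    refine ContinuousLinearMap.ext_of_inner_self fun ψ => ?_
    rw [hPν, huniv, one_apply_eq_self, inner_self_eq_norm_sq_to_K]
    simp
  · simp only [hB, MeasurableSet.iUnion hB, dif_pos]
    obtain ⟨Q, hQ, hsum, hQν⟩ := exists_hasSum_projection huniv hB hd (fun i => hP (B i) (hB i))
      fun i => hPν (B i) (hB i)
    have : P (⋃ i, B i) (.iUnion hB) = Q :=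
      ContinuousLinearMap.ext_of_inner_self fun ψ => by rw [hPν, hQν]
    rw [this]
    exact hsum ψ
  · ext B hB
    rw [ProjectionValuedMeasure.scalarMeasure_apply _ hB]
    simp only [hB, dif_pos]
    have := hPν B hB ψ
    rw [(hP B hB).inner_self_apply, Complex.ofReal_inj] at this
    rw [this, ofReal_measureReal]

end Construction

/-! ### The projection-valued measure of a resolvent -/

section ResolventMeasure

variable {𝓗 : Type*} [NormedAddCommGroup 𝓗] [InnerProductSpace ℂ 𝓗] [CompleteSpace 𝓗]
  {H : 𝓗 →ₗ.[ℂ] 𝓗}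

/-- The Cauchy kernel `x ↦ (x - z)⁻¹`. -/
def cauchyKernel (z : ℂ) (x : ℝ) : ℂ := ((x : ℂ) - z)⁻¹

theorem sub_ne_zero_of_im_ne_zero {z : ℂ} (hz : z.im ≠ 0) (x : ℝ) : (x : ℂ) - z ≠ 0 := fun h => by
  have := congrArg Complex.im h
  simp at this
  exact hz this

theorem norm_cauchyKernel_le {z : ℂ} (hz : z.im ≠ 0) (x : ℝ) : ‖cauchyKernel z x‖ ≤ |z.im|⁻¹ := by
  rw [cauchyKernel, norm_inv]
  refine inv_anti₀ (abs_pos.2 hz) ?_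
  have := Complex.abs_im_le_norm ((x : ℂ) - z)
  simpa using this

theorem isBoundedBorel_cauchyKernel {z : ℂ} (hz : z.im ≠ 0) : IsBoundedBorel (cauchyKernel z) :=
  ⟨by unfold cauchyKernel; fun_prop, _, norm_cauchyKernel_le hz⟩

/-- The resolvent `A = (H + i)⁻¹` is a normal operator with `A - A⋆ = -2 i A⋆ A`, hence its spectrum
consists of points `(x + i)⁻¹` with `x` real and possibly of `0`; the point `0` carries no mass
because `A` is injective. Transporting the spectral measures of `A` along `w ↦ re (w⁻¹)` gives a
projection-valued measure on the line. -/
theorem exists_projectionValuedMeasure_of_isResolventAt (hH : IsSelfAdjoint H) {A : 𝓗 →L[ℂ] 𝓗}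
    (hA : IsResolventAt H (-Complex.I) A) :
    ∃ E : ProjectionValuedMeasure 𝓗, E.bcalc (cauchyKernel (-Complex.I)) = A := by
  obtain ⟨B, hB⟩ := hH.exists_isResolventAt (z := Complex.I) (by simp)
  have hstar : star A = B := IsResolventAt.star_eq hH hA (by simpa using hB)
  have hsub : A - star A = (-Complex.I - Complex.I) • (star A * A) := by
    rw [hstar]
    exact hA.sub_eq hB
  have hsub' : star A - A = (Complex.I - -Complex.I) • (A * star A) := by
    rw [hstar]
    exact hB.sub_eq hA
  have hn : IsStarNormal A := by
    refine ⟨?_⟩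
    have h1 : (Complex.I - -Complex.I) • (star A * A) = (Complex.I - -Complex.I) • (A * star A) := by
      rw [← hsub', ← neg_sub A, hsub, ← neg_smul]
      congr 1
      ring
    exact smul_right_injective _ (by simp [← two_mul]) h1
  let Φ : C(spectrum ℂ A, ℂ) →⋆ₐ[ℂ] (𝓗 →L[ℂ] 𝓗) := cfcHom hn
  let ι : C(spectrum ℂ A, ℂ) := (ContinuousMap.id ℂ).restrict (spectrum ℂ A)
  have hι : Φ ι = A := cfcHom_id hn
  have hiota : ∀ w, ι w = (w : ℂ) := fun w => rfl
  let ν : 𝓗 → Measure (spectrum ℂ A) := vectorMeasure Φ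
  -- the relation between `A - A⋆` and `A⋆ A`, read as an equation on the spectrum
  have hline : ∀ ψ, ∀ᵐ w : spectrum ℂ A ∂(ν ψ), (w : ℂ) - starRingEnd ℂ (w : ℂ) +
      2 * Complex.I * (starRingEnd ℂ (w : ℂ) * w) = 0 := by
    intro ψ
    let f : C(spectrum ℂ A, ℂ) := ι - star ι + (2 * Complex.I) • (star ι * ι)
    have hf : Φ f = 0 := by
      simp only [f, map_add, map_sub, map_smul, map_mul, map_star, hι]
      rw [hsub, ← add_smul]
      ring_nf
      exact zero_smul _ _
    have h1 := norm_sq_starAlgHom Φ f ψ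
    rw [hf, zero_apply, norm_zero, zero_pow two_ne_zero, eq_comm,
      integral_eq_zero_iff_of_nonneg (fun _ => sq_nonneg _)
        (ContinuousMap.integrable_of_compactSpace ⟨fun x => ‖f x‖ ^ 2, by fun_prop⟩ _)] at h1
    filter_upwards [h1] with w hw
    have hw' : f w = 0 := by simpa using hw
    exact hw'
  -- the projection that belongs to `{0}` is annihilated by the injective operator `A`
  have hzero : ∀ ψ, ∀ᵐ w : spectrum ℂ A ∂(ν ψ), (w : ℂ) ≠ 0 := by
    intro ψ
    have hF : IsClosed {w : spectrum ℂ A | (w : ℂ) = 0} :=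
      isClosed_eq continuous_subtype_val continuous_const
    obtain ⟨f, P, hf1, hf2, hP, -, hPν⟩ := exists_projection_of_isClosed Φ hF
    have h1 : Tendsto (fun n => ‖A (Φ (f n) ψ)‖ ^ 2) atTop (𝓝 (‖A (P ψ)‖ ^ 2)) :=
      (((A.continuous.tendsto _).comp (hP ψ)).norm).pow 2
    have h2 : ∀ n, ‖A (Φ (f n) ψ)‖ ^ 2 = ∫ w, ‖(ι * f n) w‖ ^ 2 ∂(ν ψ) := fun n => by
      rw [← norm_sq_starAlgHom, map_mul, hι, mul_apply_eq_comp]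
    have h3 : Tendsto (fun n => ∫ w, ‖(ι * f n) w‖ ^ 2 ∂(ν ψ)) atTop
        (𝓝 (∫ w, (0 : ℝ) ∂(ν ψ))) := by
      refine tendsto_integral_of_dominated_convergence (fun _ => (‖ι‖ * 1) ^ 2)
        (fun n => (by fun_prop : Continuous fun w => ‖(ι * f n) w‖ ^ 2).aestronglyMeasurable)
        (integrable_const _) (fun n => .of_forall fun w => ?_) (.of_forall fun w => ?_)
      · rw [Real.norm_of_nonneg (sq_nonneg _), ContinuousMap.mul_apply, norm_mul]
        gcongr
        exacts [ι.norm_coe_le_norm w, hf1 n w]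
      · have h4 := (((hf2 w).const_mul (ι w)).norm).pow 2
        have h5 : ι w * {w : spectrum ℂ A | (w : ℂ) = 0}.indicator (fun _ => (1 : ℂ)) w = 0 := by
          by_cases hw : (w : ℂ) = 0
          · rw [hiota, hw, zero_mul]
          · rw [Set.indicator_of_notMem (by exact hw), mul_zero]
        rw [h5, norm_zero, zero_pow two_ne_zero] at h4
        exact h4
    simp only [h2] at h1
    have h6 := tendsto_nhds_unique h1 h3
    rw [integral_zero] at h6
    have h7 : P ψ = 0 := hA.injective (by simpa using h6)
    have h8 := hPν ψ
    rw [h7, inner_zero_right, eq_comm, Complex.ofReal_eq_zero,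
      measureReal_eq_zero_iff (measure_ne_top _ _)] at h8
    rw [ae_iff]
    simpa only [ne_eq, not_not] using h8
  let k : spectrum ℂ A → ℝ := fun w => ((w : ℂ)⁻¹).re
  have hk : Measurable k := by fun_prop
  have hker : ∀ ψ, ∀ᵐ w : spectrum ℂ A ∂(ν ψ), cauchyKernel (-Complex.I) (k w) = (w : ℂ) := by
    intro ψ
    filter_upwards [hline ψ, hzero ψ] with w h1 h0
    have h2 : starRingEnd ℂ (w : ℂ) ≠ 0 := by simpa using h0
    have h3 : (w : ℂ)⁻¹ - starRingEnd ℂ ((w : ℂ)⁻¹) = 2 * Complex.I := by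
      rw [map_inv₀]
      field_simp
      linear_combination -h1
    have h4 : ((k w : ℝ) : ℂ) + Complex.I = (w : ℂ)⁻¹ := by
      have h5 := congrArg Complex.im h3
      refine Complex.ext (by simp [k]) ?_
      simp only [Complex.sub_im, Complex.conj_im, Complex.mul_im, Complex.re_ofNat, Complex.I_im,
        Complex.im_ofNat, Complex.I_re] at h5
      simp only [Complex.add_im, Complex.ofReal_im, Complex.I_im]
      linarith
    rw [cauchyKernel, sub_neg_eq_add, h4, inv_inv]
  obtain ⟨E, hE⟩ := exists_projectionValuedMeasure (ν := fun ψ => (ν ψ).map k)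
    (fun ψ => by
      rw [map_measureReal_apply hk .univ]
      exact vectorMeasure_real_univ Φ ψ)
    fun B hB => by
      obtain ⟨P, hP, hPν⟩ := exists_projection_of_measurableSet (vectorMeasure_real_univ Φ)
        (fun F hF => by
          obtain ⟨_, P, -, -, -, hP, hPν⟩ := exists_projection_of_isClosed Φ hF
          exact ⟨P, hP, hPν⟩) (hk hB)
      refine ⟨P, hP, fun ψ => ?_⟩
      rw [map_measureReal_apply hk hB]
      exact hPν ψ
  refine ⟨E, ProjectionValuedMeasure.Represents.bcalc_eq fun ψ => ?_⟩
  have hm := (isBoundedBorel_cauchyKernel (z := -Complex.I) (by simp)).measurable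
  rw [hE, integral_map hk.aemeasurable hm.aestronglyMeasurable, integral_congr_ae (hker ψ)]
  exact (congrArg (fun T : 𝓗 →L[ℂ] 𝓗 => ⟪ψ, T ψ⟫_ℂ) hι.symm).trans (inner_starAlgHom Φ ι ψ)

end ResolventMeasure

end

/-! ### The spectral measure of a self-adjoint operator -/

namespace ProjectionValuedMeasure

variable {𝓗 : Type*} [NormedAddCommGroup 𝓗] [InnerProductSpace ℂ 𝓗] [CompleteSpace 𝓗]
  {H : 𝓗 →ₗ.[ℂ] 𝓗} {E : ProjectionValuedMeasure 𝓗} {z : ℂ}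

theorem sq_mul_norm_cauchyKernel_sq_le {z : ℂ} (hz : z.im ≠ 0) (x : ℝ) :
    x ^ 2 * ‖cauchyKernel z x‖ ^ 2 ≤ (1 + ‖z‖ * |z.im|⁻¹) ^ 2 := by
  have h1 : (x : ℂ) * cauchyKernel z x = 1 + z * cauchyKernel z x := by
    have := sub_ne_zero_of_im_ne_zero hz x
    unfold cauchyKernel
    field_simp
    ring
  have h2 : x ^ 2 * ‖cauchyKernel z x‖ ^ 2 = ‖(x : ℂ) * cauchyKernel z x‖ ^ 2 := by
    rw [norm_mul, mul_pow, Complex.norm_real, Real.norm_eq_abs, sq_abs]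
  rw [h2, h1]
  gcongr
  refine (norm_add_le _ _).trans ?_
  rw [norm_one, norm_mul]
  gcongr
  exact norm_cauchyKernel_le hz x

theorem integrable_sq_bcalc_cauchyKernel (hz : z.im ≠ 0) (χ : 𝓗) :
    Integrable (fun x : ℝ => x ^ 2) (E.scalarMeasure (E.bcalc (cauchyKernel z) χ)) := by
  have hb := isBoundedBorel_cauchyKernel hz
  have hm : Measurable fun x => ENNReal.ofReal (‖cauchyKernel z x‖ ^ 2) := by
    have := hb.measurable
    fun_prop
  rw [scalarMeasure_bcalc hb, integrable_withDensity_iff hm (.of_forall fun x => by simp)]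
  refine .of_bound (C := (1 + ‖z‖ * |z.im|⁻¹) ^ 2) ?_ (.of_forall fun x => ?_)
  · have := hb.measurable
    exact Measurable.aestronglyMeasurable (by fun_prop)
  · rw [ENNReal.toReal_ofReal (sq_nonneg _), Real.norm_of_nonneg (by positivity)]
    exact sq_mul_norm_cauchyKernel_sq_le hz x

theorem integrable_id_of_integrable_sq {μ : Measure ℝ} [IsFiniteMeasure μ]
    (h : Integrable (fun x : ℝ => x ^ 2) μ) : Integrable (fun x : ℝ => x) μ := by
  refine ((integrable_const (1 : ℝ)).add h).mono' measurable_id.aestronglyMeasurable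
    (.of_forall fun x => ?_)
  rw [Real.norm_eq_abs]
  simp only [Pi.add_apply]
  nlinarith [sq_nonneg (|x| - 1), sq_abs x, abs_nonneg x]

/-- The truncation of a function to the interval `[-n, n]`. -/
noncomputable def truncate (f : ℝ → ℂ) (n : ℕ) : ℝ → ℂ := (Set.Icc (-(n : ℝ)) n).indicator f

theorem norm_truncate_le (f : ℝ → ℂ) (n : ℕ) (x : ℝ) : ‖truncate f n x‖ ≤ ‖f x‖ :=
  norm_indicator_le_norm_self f x

theorem tendsto_truncate (f : ℝ → ℂ) (x : ℝ) :
    Tendsto (fun n => truncate f n x) atTop (𝓝 (f x)) := by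
  refine tendsto_const_nhds.congr' ?_
  filter_upwards [tendsto_natCast_atTop_atTop.eventually_ge_atTop |x|] with n hn
  exact (Set.indicator_of_mem (Set.mem_Icc.2 (abs_le.1 hn)) f).symm

theorem isBoundedBorel_truncate {f : ℝ → ℂ} (hf : Continuous f) (n : ℕ) :
    IsBoundedBorel (truncate f n) := by
  obtain ⟨C, hC⟩ := (isCompact_Icc (a := -(n : ℝ)) (b := n)).exists_bound_of_continuousOn
    hf.continuousOn
  refine ⟨hf.measurable.indicator measurableSet_Icc, max C 0, fun x => ?_⟩
  by_cases hx : x ∈ Set.Icc (-(n : ℝ)) n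
  · rw [truncate, Set.indicator_of_mem hx]
    exact (hC x hx).trans (le_max_left _ _)
  · rw [truncate, Set.indicator_of_notMem hx, norm_zero]
    exact le_max_right _ _

/-- The truncations define `∫ f dE` on the vectors `ψ` with `∫ |f| ^ 2 dμ_ψ < ∞`. -/
theorem cauchySeq_bcalc_truncate {f : ℝ → ℂ} (hf : Continuous f) {ψ : 𝓗}
    (h : Integrable (fun x => ‖f x‖ ^ 2) (E.scalarMeasure ψ)) :
    CauchySeq fun n => E.bcalc (truncate f n) ψ := by
  have hb := isBoundedBorel_truncate hf
  have hle : ∀ (p : ℕ × ℕ) (x : ℝ),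
      ‖‖truncate f p.1 x - truncate f p.2 x‖ ^ 2‖ ≤ 4 * ‖f x‖ ^ 2 := fun p x => by
    rw [Real.norm_of_nonneg (sq_nonneg _)]
    have h1 := norm_truncate_le f p.1 x
    have h2 := norm_truncate_le f p.2 x
    have h3 : ‖truncate f p.1 x - truncate f p.2 x‖ ≤ 2 * ‖f x‖ := by
      linarith [norm_sub_le (truncate f p.1 x) (truncate f p.2 x)]
    calc _ ≤ (2 * ‖f x‖) ^ 2 := by gcongr
      _ = _ := by ring
  have hlim : ∀ x, Tendsto (fun p : ℕ × ℕ => ‖truncate f p.1 x - truncate f p.2 x‖ ^ 2) atTop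
      (𝓝 0) := fun x => by
    rw [← prod_atTop_atTop_eq]
    have h2 := ((tendsto_truncate f x).comp
      (tendsto_fst (f := atTop) (g := (atTop : Filter ℕ)))).sub
      ((tendsto_truncate f x).comp (tendsto_snd (f := (atTop : Filter ℕ)) (g := atTop)))
    simpa using h2.norm.pow 2
  have h1 : Tendsto (fun p : ℕ × ℕ =>
      ∫ x, ‖truncate f p.1 x - truncate f p.2 x‖ ^ 2 ∂(E.scalarMeasure ψ)) atTop
      (𝓝 (∫ x, (0 : ℝ) ∂(E.scalarMeasure ψ))) := by
    refine tendsto_integral_filter_of_dominated_convergence _ (.of_forall fun p => ?_)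
      (.of_forall fun p => .of_forall (hle p)) (h.const_mul 4) (.of_forall hlim)
    exact (((hb p.1).measurable.sub (hb p.2).measurable).norm.pow_const 2).aestronglyMeasurable
  rw [integral_zero] at h1
  have h2 := h1.sqrt
  rw [Real.sqrt_zero] at h2
  rw [cauchySeq_iff_tendsto_dist_atTop_0]
  refine h2.congr fun p => ?_
  rw [dist_eq_norm, ← norm_sq_bcalc_sub (hb _) (hb _), Real.sqrt_sq (norm_nonneg _)]

/-- A vector with `∫ x ^ 2 dμ_ψ < ∞` is in the range of the resolvent: it is the image of the limit
of the vectors `∫ (x - z) 1_{[-n, n]} dE ψ`. -/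
theorem exists_bcalc_cauchyKernel_eq (hz : z.im ≠ 0) {ψ : 𝓗}
    (h : Integrable (fun x : ℝ => x ^ 2) (E.scalarMeasure ψ)) :
    ∃ χ, E.bcalc (cauchyKernel z) χ = ψ := by
  have hb := isBoundedBorel_cauchyKernel hz
  let f : ℝ → ℂ := fun x => (x : ℂ) - z
  have hf : Continuous f := by fun_prop
  have hint : Integrable (fun x => ‖f x‖ ^ 2) (E.scalarMeasure ψ) := by
    refine ((h.add (integrable_const (‖z‖ ^ 2))).const_mul 2).mono'
      (by fun_prop : Continuous fun x => ‖f x‖ ^ 2).aestronglyMeasurable (.of_forall fun x => ?_)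
    have h1 : ‖f x‖ ≤ |x| + ‖z‖ := by simpa [f] using norm_sub_le (x : ℂ) z
    rw [Real.norm_of_nonneg (sq_nonneg _), Pi.add_apply]
    nlinarith [sq_nonneg (|x| - ‖z‖), sq_abs x, norm_nonneg (f x)]
  have hcauchy := cauchySeq_bcalc_truncate hf hint
  obtain ⟨χ, hχ⟩ := cauchySeq_tendsto_of_complete hcauchy
  refine ⟨χ, ?_⟩
  have h1 : Tendsto (fun n => E.bcalc (cauchyKernel z) (E.bcalc (truncate f n) ψ)) atTop
      (𝓝 (E.bcalc (cauchyKernel z) χ)) :=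
    ((E.bcalc (cauchyKernel z)).continuous.tendsto _).comp hχ
  refine tendsto_nhds_unique h1 ?_
  have h2 : ∀ n, E.bcalc (cauchyKernel z) (E.bcalc (truncate f n) ψ) =
      E.bcalc (truncate (fun _ => 1) n) ψ := fun n => by
    rw [bcalc_mul_apply hb (isBoundedBorel_truncate hf n)]
    congr 2
    funext x
    by_cases hx : x ∈ Set.Icc (-(n : ℝ)) n
    · simp only [truncate, Set.indicator_of_mem hx, cauchyKernel, f]
      exact inv_mul_cancel₀ (sub_ne_zero_of_im_ne_zero hz x)
    · simp only [truncate, Set.indicator_of_notMem hx, mul_zero]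
  simp only [h2]
  -- `(x - z)⁻¹ (x - z)` cancels on `[-n, n]`, and the projections onto `[-n, n]` tend to `1`
  have h3 := tendsto_bcalc (E := E) (l := atTop) (F := truncate fun _ => 1) (C := 1)
    (fun n => (isBoundedBorel_truncate continuous_const n).measurable)
    (fun n x => (norm_truncate_le _ n x).trans_eq norm_one) (IsBoundedBorel.const 1) ψ
    (.of_forall (tendsto_truncate _))
  rwa [bcalc_const, one_smul, one_apply_eq_self] at h3

/-- If `∫ (x - z)⁻¹ dE` is the resolvent of `H` at one point, then `H = ∫ x dE`. -/
theorem isSpectralMeasureOf_of_isResolventAt (hz : z.im ≠ 0)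
    (h : IsResolventAt H z (E.bcalc (cauchyKernel z))) : E.IsSpectralMeasureOf H := by
  have hb := isBoundedBorel_cauchyKernel hz
  refine ⟨fun ψ => ⟨fun hψ => ?_, fun hψ => ?_⟩, fun ψ => ?_⟩
  · obtain ⟨χ, rfl⟩ := h.mem_domain_iff.1 hψ
    exact integrable_sq_bcalc_cauchyKernel hz χ
  · exact h.mem_domain_iff.2 (exists_bcalc_cauchyKernel_eq hz hψ)
  · obtain ⟨ψ, hψ⟩ := ψ
    obtain ⟨χ, rfl⟩ := h.mem_domain_iff.1 hψ
    have hm : Measurable fun x => ENNReal.ofReal (‖cauchyKernel z x‖ ^ 2) := by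
      have := hb.measurable
      fun_prop
    have h1 : ((∫ x : ℝ, x ∂(E.scalarMeasure (E.bcalc (cauchyKernel z) χ)) : ℝ) : ℂ) =
        ∫ x : ℝ, starRingEnd ℂ (cauchyKernel z x) * (1 + z * cauchyKernel z x)
          ∂(E.scalarMeasure χ) := by
      rw [scalarMeasure_bcalc hb, integral_withDensity_eq_integral_toReal_smul hm
        (.of_forall fun x => by simp), ← integral_complex_ofReal]
      refine integral_congr_ae (.of_forall fun x => ?_)
      have h2 : (1 + z * cauchyKernel z x) = cauchyKernel z x * x := by
        have := sub_ne_zero_of_im_ne_zero hz x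
        unfold cauchyKernel
        field_simp
        ring
      simp only [ENNReal.toReal_ofReal (sq_nonneg _)]
      rw [h2, ← mul_assoc, mul_comm (starRingEnd ℂ _), Complex.mul_conj, Complex.normSq_eq_norm_sq]
      simp
    have h3 : ∫ x : ℝ, starRingEnd ℂ (cauchyKernel z x) * (1 + z * cauchyKernel z x)
          ∂(E.scalarMeasure χ) =
        ⟪χ, star (E.bcalc (cauchyKernel z)) ((1 + z • E.bcalc (cauchyKernel z)) χ)⟫_ℂ := by
      rw [← mul_apply_eq_comp, ← bcalc_conj hb, ← bcalc_const_mul z hb]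
      have h4 : (1 : 𝓗 →L[ℂ] 𝓗) = E.bcalc fun _ => 1 := by rw [bcalc_const, one_smul]
      rw [h4, ← bcalc_add (IsBoundedBorel.const 1) (hb.const_mul z),
        ← bcalc_mul hb.conj ((IsBoundedBorel.const 1).add (hb.const_mul z)), inner_bcalc]
      exact hb.conj.mul ((IsBoundedBorel.const 1).add (hb.const_mul z))
    rw [h1, h3, ContinuousLinearMap.inner_star_apply, h.apply_eq]
    rfl

omit [CompleteSpace 𝓗] in
/-- Polarization for a partially defined operator. -/
theorem inner_pmap_polarization (M : H.domain →ₗ[ℂ] 𝓗) (x y : H.domain) :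
    ⟪(x : 𝓗), M y⟫_ℂ = (⟪((x + y : H.domain) : 𝓗), M (x + y)⟫_ℂ
      - ⟪((x - y : H.domain) : 𝓗), M (x - y)⟫_ℂ
      - Complex.I * ⟪((x + Complex.I • y : H.domain) : 𝓗), M (x + Complex.I • y)⟫_ℂ
      + Complex.I * ⟪((x - Complex.I • y : H.domain) : 𝓗), M (x - Complex.I • y)⟫_ℂ) / 4 := by
  simp only [Submodule.coe_add, Submodule.coe_sub, Submodule.coe_smul, map_add, map_sub, map_smul,
    inner_add_left, inner_add_right, inner_sub_left, inner_sub_right, inner_smul_left,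
    inner_smul_right, Complex.conj_I]
  linear_combination ((1 / 2) * ⟪(x : 𝓗), M y⟫_ℂ - (1 / 2) * ⟪(y : 𝓗), M x⟫_ℂ) * Complex.I_sq

/-- On its domain, `H` is the weak limit of the bounded operators `∫ x 1_{[-n, n]} dE`. -/
theorem IsSpectralMeasureOf.tendsto_inner (hE : E.IsSpectralMeasureOf H) (x y : H.domain) :
    Tendsto (fun n => ⟪(x : 𝓗), E.bcalc (truncate (fun x => (x : ℂ)) n) y⟫_ℂ) atTop
      (𝓝 ⟪(x : 𝓗), H y⟫_ℂ) := by
  have key : ∀ w : H.domain, Tendsto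
      (fun n => ⟪(w : 𝓗), E.bcalc (truncate (fun x => (x : ℂ)) n) w⟫_ℂ) atTop
      (𝓝 ⟪(w : 𝓗), H w⟫_ℂ) := by
    intro w
    rw [hE.inner_apply, ← integral_complex_ofReal]
    simp only [fun n => inner_bcalc (E := E) (isBoundedBorel_truncate
      (by fun_prop : Continuous fun x : ℝ => (x : ℂ)) n) (w : 𝓗)]
    have hint := integrable_id_of_integrable_sq ((hE.mem_domain_iff w).1 w.2)
    refine tendsto_integral_of_dominated_convergence (fun x => ‖x‖) (fun n => ?_) hint.norm
      (fun n => .of_forall fun x => ?_) (.of_forall fun x => tendsto_truncate _ x)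
    · exact (isBoundedBorel_truncate (by fun_prop) n).measurable.aestronglyMeasurable
    · exact (norm_truncate_le _ n x).trans_eq (by simp)
  have h1 := inner_pmap_polarization H.toFun x y
  have h2 := fun n => inner_pmap_polarization (H := H)
    ((E.bcalc (truncate (fun x => (x : ℂ)) n) : 𝓗 →ₗ[ℂ] 𝓗) ∘ₗ H.domain.subtype) x y
  change Tendsto (fun n => ⟪(x : 𝓗), ((E.bcalc (truncate (fun x => (x : ℂ)) n) : 𝓗 →ₗ[ℂ] 𝓗) ∘ₗ
    H.domain.subtype) y⟫_ℂ) atTop (𝓝 ⟪(x : 𝓗), H.toFun y⟫_ℂ)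
  simp only [h1, h2]
  exact ((((key _).sub (key _)).sub ((key _).const_mul _)).add ((key _).const_mul _)).div_const _

/-- If `H = ∫ x dE`, then `(H - z)⁻¹ = ∫ (x - z)⁻¹ dE`. -/
theorem IsSpectralMeasureOf.isResolventAt (hE : E.IsSpectralMeasureOf H) (hH : IsSelfAdjoint H)
    (hz : z.im ≠ 0) : IsResolventAt H z (E.bcalc (cauchyKernel z)) := by
  have hb := isBoundedBorel_cauchyKernel hz
  refine IsResolventAt.of_right_inv hH hz fun χ => ?_
  have hd : E.bcalc (cauchyKernel z) χ ∈ H.domain :=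
    (hE.mem_domain_iff _).2 (integrable_sq_bcalc_cauchyKernel hz χ)
  refine ⟨hd, hH.dense_domain.eq_of_inner_right ℂ fun φ hφ => ?_⟩
  have h1 := hE.tendsto_inner ⟨φ, hφ⟩ ⟨_, hd⟩
  have hid : Continuous fun x : ℝ => (x : ℂ) := by fun_prop
  -- `x (x - z)⁻¹` is bounded, so that `H ∫ (x - z)⁻¹ dE` is given by the bounded calculus
  have hprod : ∀ x : ℝ, (x : ℂ) * cauchyKernel z x = 1 + z * cauchyKernel z x := fun x => by
    have := sub_ne_zero_of_im_ne_zero hz x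
    unfold cauchyKernel
    field_simp
    ring
  have hb' := (IsBoundedBorel.const 1).add (hb.const_mul z)
  have h2 : Tendsto (fun n => E.bcalc (fun x => truncate (fun x => (x : ℂ)) n x *
      cauchyKernel z x) χ) atTop (𝓝 (E.bcalc (fun x => 1 + z * cauchyKernel z x) χ)) := by
    obtain ⟨C, hC⟩ := hb'.2
    refine tendsto_bcalc (C := C)
      (fun n => ((isBoundedBorel_truncate hid n).mul hb).measurable) (fun n x => ?_) hb' χ
      (.of_forall fun x => ?_)
    · refine le_trans ?_ (hC x)
      beta_reduce
      rw [← hprod, norm_mul, norm_mul]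
      gcongr
      exact norm_truncate_le _ n x
    · rw [← hprod]
      exact (tendsto_truncate _ x).mul_const _
  have h3 : Tendsto (fun n => ⟪φ, E.bcalc (truncate (fun x => (x : ℂ)) n)
      (E.bcalc (cauchyKernel z) χ)⟫_ℂ) atTop
      (𝓝 ⟪φ, E.bcalc (fun x => 1 + z * cauchyKernel z x) χ⟫_ℂ) := by
    simp only [fun n => bcalc_mul_apply (E := E) (isBoundedBorel_truncate hid n) hb χ]
    exact tendsto_const_nhds.inner h2
  have h4 := tendsto_nhds_unique h1 h3
  rw [inner_sub_right, h4, bcalc_add (IsBoundedBorel.const 1) (hb.const_mul z), bcalc_const,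
    bcalc_const_mul z hb]
  simp [inner_smul_right]

/-- The **spectral theorem**, existence part. -/
theorem exists_isSpectralMeasureOf (hH : IsSelfAdjoint H) :
    ∃ E : ProjectionValuedMeasure 𝓗, E.IsSpectralMeasureOf H := by
  obtain ⟨A, hA⟩ := hH.exists_isResolventAt (z := -Complex.I) (by simp)
  obtain ⟨E, rfl⟩ := exists_projectionValuedMeasure_of_isResolventAt hH hA
  exact ⟨E, isSpectralMeasureOf_of_isResolventAt (by simp) hA⟩

end ProjectionValuedMeasure

noncomputable section

/-! ### The unitary group of a self-adjoint operator -/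

/-- The function `x ↦ exp (-i t x)`. -/
def expKernel (t x : ℝ) : ℂ := Complex.exp (-(Complex.I * t * x))

theorem norm_expKernel (t x : ℝ) : ‖expKernel t x‖ = 1 := by
  rw [expKernel, Complex.norm_exp]
  simp

theorem isBoundedBorel_expKernel (t : ℝ) : IsBoundedBorel (expKernel t) :=
  ⟨by unfold expKernel; fun_prop, 1, fun x => (norm_expKernel t x).le⟩

theorem expKernel_add (s t x : ℝ) : expKernel (s + t) x = expKernel s x * expKernel t x := by
  rw [expKernel, expKernel, expKernel, ← Complex.exp_add]
  push_cast
  ring_nf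

theorem expKernel_zero (x : ℝ) : expKernel 0 x = 1 := by simp [expKernel]

theorem hasDerivAt_expKernel (x : ℝ) :
    HasDerivAt (fun t => expKernel t x) (-(Complex.I * x)) 0 := by
  have h1 : HasDerivAt (fun t : ℝ => -(Complex.I * (t : ℂ) * x)) (-(Complex.I * 1 * x)) 0 :=
    (((Complex.ofRealCLM.hasDerivAt (x := (0 : ℝ))).const_mul Complex.I).mul_const (x : ℂ)).neg
  simpa [expKernel] using h1.cexp

theorem norm_expKernel_sub_one_le (t x : ℝ) : ‖expKernel t x - 1‖ ≤ |t| * |x| := by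
  have h1 := Real.norm_exp_I_mul_ofReal_sub_one_le (x := -(t * x))
  rw [Real.norm_eq_abs, abs_neg, abs_mul] at h1
  convert h1 using 3
  rw [expKernel]
  push_cast
  ring_nf

namespace UnitaryGroup

variable {𝓗 : Type*} [NormedAddCommGroup 𝓗] [InnerProductSpace ℂ 𝓗] [CompleteSpace 𝓗]
  {H : 𝓗 →ₗ.[ℂ] 𝓗} {U V : UnitaryGroup 𝓗}

theorem ext_toFun (h : ∀ t, U t = V t) : U = V := by
  have : U.toFun = V.toFun := funext h
  cases U
  cases V
  congr

theorem norm_apply (U : UnitaryGroup 𝓗) (t : ℝ) (ψ : 𝓗) : ‖U t ψ‖ = ‖ψ‖ := by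
  have h := Unitary.star_mul_self_of_mem (U.mem_unitary t)
  have h1 : ⟪U t ψ, U t ψ⟫_ℂ = ⟪ψ, ψ⟫_ℂ := by
    rw [← ContinuousLinearMap.inner_star_apply, ← mul_apply_eq_comp, h, one_apply_eq_self]
  rw [@norm_eq_sqrt_re_inner ℂ, h1, ← @norm_eq_sqrt_re_inner ℂ]

/-- The orbit of a vector of the domain stays in the domain and solves the Schrödinger equation. -/
theorem IsGeneratedBy.hasDerivAt (hU : U.IsGeneratedBy H) {ψ : 𝓗} (hψ : ψ ∈ H.domain) (t : ℝ) :
    ∃ h : U t ψ ∈ H.domain,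
      HasDerivAt (fun s : ℝ => U s ψ) (-(Complex.I • H ⟨U t ψ, h⟩)) t := by
  have h0 := (hU ψ _).2 ⟨hψ, rfl⟩
  have h1 := ((U t).restrictScalars ℝ).hasFDerivAt.comp_hasDerivAt (0 : ℝ) h0
  have h2 : HasDerivAt (fun s : ℝ => U s (U t ψ)) (U t (-(Complex.I • H ⟨ψ, hψ⟩))) 0 := by
    refine h1.congr_of_eventuallyEq (.of_forall fun s => ?_)
    change U s (U t ψ) = U t (U s ψ)
    rw [← mul_apply_eq_comp, ← mul_apply_eq_comp, ← U.map_add, ← U.map_add, add_comm]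
  obtain ⟨h3, h4⟩ := (hU _ _).1 h2
  refine ⟨h3, ?_⟩
  rw [← h4]
  have h5 : HasDerivAt (fun s : ℝ => U (s - t) (U t ψ)) (U t (-(Complex.I • H ⟨ψ, hψ⟩))) t := by
    have := HasDerivAt.comp_sub_const (f := fun s : ℝ => U s (U t ψ)) t t (by rwa [sub_self])
    exact this
  refine h5.congr_of_eventuallyEq (.of_forall fun s => ?_)
  change U s ψ = U (s - t) (U t ψ)
  rw [← mul_apply_eq_comp, ← U.map_add, sub_add_cancel]

/-- The generator determines the group: the difference of two solutions of the Schrödinger equation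
with the same initial value has constant norm. -/
theorem IsGeneratedBy.unique (hH : IsSelfAdjoint H) (hU : U.IsGeneratedBy H)
    (hV : V.IsGeneratedBy H) : U = V := by
  refine ext_toFun fun t => ?_
  have key : ∀ ψ ∈ H.domain, U t ψ = V t ψ := by
    intro ψ hψ
    have hd : ∀ s, HasDerivAt (fun s : ℝ => ‖U s ψ - V s ψ‖ ^ 2) 0 s := by
      intro s
      obtain ⟨h1, hu⟩ := hU.hasDerivAt hψ s
      obtain ⟨h2, hv⟩ := hV.hasDerivAt hψ s
      have h3 := (hu.sub hv).inner ℂ (hu.sub hv)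
      have h4 : -(Complex.I • H ⟨U s ψ, h1⟩) - -(Complex.I • H ⟨V s ψ, h2⟩) =
          -(Complex.I • H (⟨U s ψ, h1⟩ - ⟨V s ψ, h2⟩)) := by
        rw [H.map_sub, smul_sub]
        abel
      have h5 := hH.pmap_inner_left (⟨U s ψ, h1⟩ - ⟨V s ψ, h2⟩) (⟨U s ψ, h1⟩ - ⟨V s ψ, h2⟩)
      rw [h4] at h3
      have h6 : ⟪U s ψ - V s ψ, -(Complex.I • H (⟨U s ψ, h1⟩ - ⟨V s ψ, h2⟩))⟫_ℂ +
          ⟪-(Complex.I • H (⟨U s ψ, h1⟩ - ⟨V s ψ, h2⟩)), U s ψ - V s ψ⟫_ℂ = 0 := by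
        rw [inner_neg_left, inner_neg_right, inner_smul_left, inner_smul_right, Complex.conj_I]
        have h7 : ⟪H (⟨U s ψ, h1⟩ - ⟨V s ψ, h2⟩), U s ψ - V s ψ⟫_ℂ =
          ⟪U s ψ - V s ψ, H (⟨U s ψ, h1⟩ - ⟨V s ψ, h2⟩)⟫_ℂ := h5
        rw [h7]
        ring
      have h8 := Complex.reCLM.hasFDerivAt.comp_hasDerivAt s h3
      refine (h8.congr_of_eventuallyEq (.of_forall fun r => ?_)).congr_deriv ?_
      · change ‖U r ψ - V r ψ‖ ^ 2 = (⟪U r ψ - V r ψ, U r ψ - V r ψ⟫_ℂ).re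
        exact (inner_self_eq_norm_sq (𝕜 := ℂ) _).symm
      · rw [Complex.reCLM_apply]
        exact congrArg Complex.re h6
    have h1 := is_const_of_deriv_eq_zero (fun s => (hd s).differentiableAt)
      (fun s => (hd s).deriv) t 0
    simp only [U.map_zero, V.map_zero, sub_self, norm_zero] at h1
    have h2 : ‖U t ψ - V t ψ‖ = 0 := by simpa using h1
    exact sub_eq_zero.1 (norm_eq_zero.1 h2)
  refine ContinuousLinearMap.ext fun ψ => ?_
  exact congrFun (Continuous.ext_on hH.dense_domain (U t).continuous (V t).continuous key) ψ

end UnitaryGroup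

namespace ProjectionValuedMeasure

variable {𝓗 : Type*} [NormedAddCommGroup 𝓗] [InnerProductSpace ℂ 𝓗] [CompleteSpace 𝓗]
  {H : 𝓗 →ₗ.[ℂ] 𝓗} (E : ProjectionValuedMeasure 𝓗)

/-- The unitary group `t ↦ ∫ exp (-i t x) dE(x)`. -/
def unitaryGroup : UnitaryGroup 𝓗 where
  toFun t := E.bcalc (expKernel t)
  mem_unitary t := by
    have h := isBoundedBorel_expKernel t
    have h1 : ∀ x, starRingEnd ℂ (expKernel t x) * expKernel t x = 1 := fun x => by
      rw [mul_comm, Complex.mul_conj, Complex.normSq_eq_norm_sq, norm_expKernel]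
      simp
    rw [Unitary.mem_iff, ← bcalc_conj h, ← bcalc_mul h.conj h, ← bcalc_mul h h.conj]
    simp only [fun x => mul_comm (expKernel t x), h1, bcalc_const, one_smul, and_self]
  map_zero := by
    have h : expKernel 0 = fun _ => 1 := funext expKernel_zero
    rw [h, bcalc_const, one_smul]
  map_add s t := by
    rw [← bcalc_mul (isBoundedBorel_expKernel s) (isBoundedBorel_expKernel t)]
    exact congrArg _ (funext (expKernel_add s t))
  continuous_apply ψ := by
    refine continuous_iff_continuousAt.2 fun t => ?_
    refine tendsto_bcalc (fun s => (isBoundedBorel_expKernel s).measurable)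
      (fun s x => (norm_expKernel s x).le) (isBoundedBorel_expKernel t) ψ (.of_forall fun x => ?_)
    have : Continuous fun s => expKernel s x := by unfold expKernel; fun_prop
    exact this.tendsto t

theorem unitaryGroup_apply (t : ℝ) : E.unitaryGroup t = E.bcalc (expKernel t) := rfl

variable {E}

/-- On `ψ = (H - i)⁻¹ χ`, the difference quotients are given by functions of `x` that are bounded
uniformly in `t`, so that dominated convergence for the calculus applies. -/
theorem IsSpectralMeasureOf.hasDerivAt_unitaryGroup (hE : E.IsSpectralMeasureOf H)
    (hH : IsSelfAdjoint H) {ψ : 𝓗} (hψ : ψ ∈ H.domain) :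
    HasDerivAt (fun t => E.unitaryGroup t ψ) (-(Complex.I • H ⟨ψ, hψ⟩)) 0 := by
  have hz : (Complex.I).im ≠ 0 := by simp
  have hR := hE.isResolventAt hH hz
  have hb := isBoundedBorel_cauchyKernel hz
  obtain ⟨χ, rfl⟩ := hR.mem_domain_iff.1 hψ
  have hb' := (((IsBoundedBorel.const 1).add (hb.const_mul Complex.I)).const_mul (-Complex.I))
  have hprod : ∀ x : ℝ, (x : ℂ) * cauchyKernel Complex.I x =
      1 + Complex.I * cauchyKernel Complex.I x := fun x => by
    have := sub_ne_zero_of_im_ne_zero hz x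
    unfold cauchyKernel
    field_simp
    ring
  have h1 : -(Complex.I • H ⟨E.bcalc (cauchyKernel Complex.I) χ, hψ⟩) =
      E.bcalc (fun x => -Complex.I * (1 + Complex.I * cauchyKernel Complex.I x)) χ := by
    rw [hR.apply_eq, bcalc_const_mul _ ((IsBoundedBorel.const 1).add (hb.const_mul _)),
      bcalc_add (IsBoundedBorel.const 1) (hb.const_mul _), bcalc_const, bcalc_const_mul _ hb]
    simp [add_comm]
  have hF : ∀ t : ℝ, IsBoundedBorel fun x => (t : ℂ)⁻¹ * ((expKernel t x - 1) *
      cauchyKernel Complex.I x) := fun t =>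
    (((isBoundedBorel_expKernel t).sub (.const 1)).mul hb).const_mul _
  rw [h1, hasDerivAt_iff_tendsto_slope]
  obtain ⟨C, hC⟩ := ((IsBoundedBorel.const 1).add (hb.const_mul Complex.I)).2
  have h2 := tendsto_bcalc (E := E) (l := 𝓝[≠] (0 : ℝ)) (C := C) (fun t => (hF t).measurable)
    (fun t x => by
      refine le_trans ?_ (hC x)
      beta_reduce
      rw [← hprod, norm_mul, norm_mul, norm_mul, norm_inv, Complex.norm_real, Complex.norm_real,
        Real.norm_eq_abs, Real.norm_eq_abs, ← mul_assoc]
      gcongr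
      rcases eq_or_ne t 0 with rfl | ht
      · simp
      · rw [inv_mul_le_iff₀ (abs_pos.2 ht)]
        exact norm_expKernel_sub_one_le t x) hb' χ
    (.of_forall fun x => by
      have h3 := (hasDerivAt_iff_tendsto_slope.1 (hasDerivAt_expKernel x)).mul_const
        (cauchyKernel Complex.I x)
      have h4 : -(Complex.I * (x : ℂ)) * cauchyKernel Complex.I x =
          -Complex.I * (1 + Complex.I * cauchyKernel Complex.I x) := by
        rw [← hprod]
        ring
      rw [h4] at h3
      refine h3.congr fun t => ?_
      rw [slope_def_module, expKernel_zero, sub_zero, Complex.real_smul]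
      push_cast
      ring)
  refine h2.congr fun t => ?_
  rw [slope_def_module, sub_zero, bcalc_const_mul _
    (((isBoundedBorel_expKernel t).sub (.const 1)).mul hb),
    bcalc_mul ((isBoundedBorel_expKernel t).sub (.const 1)) hb,
    bcalc_sub (isBoundedBorel_expKernel t) (.const 1), bcalc_const, one_smul]
  rw [smul_apply, mul_apply_eq_comp, sub_apply, E.unitaryGroup.map_zero, ← Complex.ofReal_inv,
    Complex.coe_smul]
  rfl

/-- **Stone's theorem** for the unitary group built from the spectral measure. -/
theorem IsSpectralMeasureOf.isGeneratedBy (hE : E.IsSpectralMeasureOf H) (hH : IsSelfAdjoint H) :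
    E.unitaryGroup.IsGeneratedBy H := by
  refine fun ψ χ => ⟨fun h => ?_, ?_⟩
  -- by unitarity, `i χ` satisfies the defining relation of `H⋆ ψ`, and `H⋆ = H`
  · have hinner : ∀ x : H.domain, ⟪Complex.I • χ, x⟫_ℂ = ⟪ψ, H x⟫_ℂ := by
      intro x
      have h1 := hE.hasDerivAt_unitaryGroup hH x.2
      have h2 := h.inner ℂ h1
      have hconst : ∀ t : ℝ, ⟪E.unitaryGroup t ψ, E.unitaryGroup t (x : 𝓗)⟫_ℂ =
          ⟪ψ, (x : 𝓗)⟫_ℂ := fun t => by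
        rw [← ContinuousLinearMap.inner_star_apply, ← mul_apply_eq_comp,
          Unitary.star_mul_self_of_mem (E.unitaryGroup.mem_unitary t), one_apply_eq_self]
      have h3 := h2.unique ((hasDerivAt_const (0 : ℝ) ⟪ψ, (x : 𝓗)⟫_ℂ).congr_of_eventuallyEq
        (.of_forall hconst))
      simp only [E.unitaryGroup.map_zero, one_apply_eq_self] at h3
      rw [inner_neg_right, inner_smul_right] at h3
      rw [inner_smul_left, Complex.conj_I]
      linear_combination (-Complex.I) * h3 - ⟪ψ, H x⟫_ℂ * Complex.I_sq
    obtain ⟨hψ, hHψ⟩ := hH.exists_apply_eq hinner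
    refine ⟨hψ, ?_⟩
    rw [hHψ, smul_smul, Complex.I_mul_I]
    simp
  · rintro ⟨hψ, rfl⟩
    exact hE.hasDerivAt_unitaryGroup hH hψ

/-- The spectral measure is unique: its scalar measures have the matrix elements of the unitary group
as characteristic functions, and the group is determined by `H`. -/
theorem IsSpectralMeasureOf.unique {F : ProjectionValuedMeasure 𝓗} (hE : E.IsSpectralMeasureOf H)
    (hF : F.IsSpectralMeasureOf H) (hH : IsSelfAdjoint H) : E = F := by
  refine ext_of_scalarMeasure fun ψ => Measure.ext_of_charFun (funext fun t => ?_)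
  have h1 : E.unitaryGroup (-t) = F.unitaryGroup (-t) := by
    rw [(hE.isGeneratedBy hH).unique hH (hF.isGeneratedBy hH)]
  have h2 : ∀ G : ProjectionValuedMeasure 𝓗,
      charFun (G.scalarMeasure ψ) t = ⟪ψ, G.unitaryGroup (-t) ψ⟫_ℂ := fun G => by
    rw [charFun_apply_real, unitaryGroup_apply, inner_bcalc (isBoundedBorel_expKernel _)]
    refine integral_congr_ae (.of_forall fun x => ?_)
    simp only [expKernel]
    push_cast
    ring_nf
  rw [h2, h2, h1]

/-- Superpositions of the operators `U t` are functions of `H`. -/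
theorem integral_smul_unitaryGroup {c : ℝ → ℂ} (hc : Integrable c) (ψ : 𝓗) :
    Integrable (fun t => c t • E.unitaryGroup t ψ) ∧
    ∫ t, c t • E.unitaryGroup t ψ = E.bcalc (fun x => ∫ t, c t * expKernel t x) ψ := by
  have hint : ∀ ψ, Integrable (fun t => c t • E.unitaryGroup t ψ) := fun ψ => by
    refine hc.norm.mul_const ‖ψ‖ |>.mono'
      (hc.aestronglyMeasurable.smul (E.unitaryGroup.continuous_apply ψ).aestronglyMeasurable)
      (.of_forall fun t => ?_)
    rw [norm_smul, E.unitaryGroup.norm_apply]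
  refine ⟨hint ψ, ?_⟩
  have hcont : Continuous fun p : ℝ × ℝ => expKernel p.2 p.1 := by
    unfold expKernel
    fun_prop
  have hb : IsBoundedBorel fun x => ∫ t, c t * expKernel t x := by
    refine ⟨?_, ∫ t, ‖c t‖, fun x => ?_⟩
    · obtain ⟨d, hd, hcd⟩ := hc.aestronglyMeasurable
      have h1 : (fun x => ∫ t, c t * expKernel t x) = fun x => ∫ t, d t * expKernel t x :=
        funext fun x => integral_congr_ae (hcd.mono fun t ht => by simp only [ht])
      rw [h1]
      refine (StronglyMeasurable.integral_prod_right'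
        (f := fun p : ℝ × ℝ => d p.2 * expKernel p.2 p.1) ?_).measurable
      exact (hd.comp_measurable measurable_snd).mul hcont.stronglyMeasurable
    · refine (norm_integral_le_integral_norm _).trans_eq (integral_congr_ae (.of_forall fun t => ?_))
      simp only [norm_mul, norm_expKernel, mul_one]
  let J : 𝓗 →ₗ[ℂ] 𝓗 :=
    { toFun := fun ψ => ∫ t, c t • E.unitaryGroup t ψ
      map_add' := fun φ ψ => by
        simp only [map_add, smul_add]
        exact integral_add (hint φ) (hint ψ)
      map_smul' := fun a ψ => by
        simp only [map_smul, RingHom.id_apply, smul_comm _ a]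
        exact integral_smul _ _ }
  have hJ : J = (E.bcalc (fun x => ∫ t, c t * expKernel t x) : 𝓗 →ₗ[ℂ] 𝓗) := by
    refine (ext_inner_map _ _).1 fun φ => ?_
    rw [← inner_conj_symm, ← inner_conj_symm (_ : 𝓗) φ]
    congr 1
    change ⟪φ, ∫ t, c t • E.unitaryGroup t φ⟫_ℂ = ⟪φ, E.bcalc _ φ⟫_ℂ
    rw [inner_bcalc hb, ← integral_inner (hint φ) φ]
    have h1 : ∀ t, ⟪φ, c t • E.unitaryGroup t φ⟫_ℂ =
        ∫ x, c t * expKernel t x ∂(E.scalarMeasure φ) := fun t => by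
      rw [inner_smul_right, unitaryGroup_apply, inner_bcalc (isBoundedBorel_expKernel t),
        integral_const_mul]
    simp only [h1]
    refine integral_integral_swap ?_
    have h2 : Integrable (fun p : ℝ × ℝ => c p.1 * (1 : ℂ)) (volume.prod (E.scalarMeasure φ)) :=
      hc.mul_prod (integrable_const 1)
    refine h2.mono ?_ (.of_forall fun p => ?_)
    · exact hc.aestronglyMeasurable.comp_fst.mul
        (hcont.comp continuous_swap).aestronglyMeasurable
    · simp [Function.uncurry, norm_expKernel]
  exact LinearMap.congr_fun hJ ψ

end ProjectionValuedMeasure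

end

namespace ProjectionValuedMeasure

variable {𝓗 : Type*} [NormedAddCommGroup 𝓗] [InnerProductSpace ℂ 𝓗] [CompleteSpace 𝓗]
  {H : 𝓗 →ₗ.[ℂ] 𝓗} {E : ProjectionValuedMeasure 𝓗}

/-! ### Eigenvectors and the point spectrum -/

theorem mem_range_iff {B : Set ℝ} (hB : MeasurableSet B) {ψ : 𝓗} :
    ψ ∈ (E B).range ↔ E B ψ = ψ :=
  ⟨fun ⟨χ, h⟩ => by rw [← h]; exact (E.isStarProjection B hB).apply_apply χ, fun h => ⟨ψ, h⟩⟩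

theorem bcalc_apply_of_singleton {f : ℝ → ℂ} (hf : IsBoundedBorel f) (l : ℝ) (ψ : 𝓗) :
    E.bcalc f (E {l} ψ) = f l • E {l} ψ := by
  have h1 := bcalc_indicator (E := E) (measurableSet_singleton l) 1
  have h2 := bcalc_indicator (E := E) (measurableSet_singleton l) (f l)
  rw [one_smul] at h1
  rw [← smul_apply, ← h2, ← h1, bcalc_mul_apply hf ((IsBoundedBorel.const 1).indicator
    (measurableSet_singleton l))]
  congr 2
  funext x
  by_cases hx : x = l
  · simp [hx]
  · simp [Set.indicator_of_notMem (show x ∉ ({l} : Set ℝ) from hx)]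

theorem apply_eq_self_of_compl {B : Set ℝ} (hB : MeasurableSet B) {ψ : 𝓗}
    (h : E.scalarMeasure ψ Bᶜ = 0) : E B ψ = ψ := by
  rw [E.scalarMeasure_apply hB.compl, ENNReal.ofReal_eq_zero] at h
  have h1 : E Bᶜ ψ = 0 := by
    have := le_antisymm h (sq_nonneg _)
    simpa using this
  have h2 := E.union_of_disjoint hB hB.compl disjoint_compl_right
  rw [Set.union_compl_self, E.univ_eq_one] at h2
  have h3 := congrArg (fun T : 𝓗 →L[ℂ] 𝓗 => T ψ) h2
  simp only [one_apply_eq_self, add_apply, h1, add_zero] at h3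
  exact h3.symm

/-- The range of `E {l}` is the eigenspace of `H` for `l`. Both are described by the resolvent at
`i`: `ψ` belongs to either of them if and only if `(H - i)⁻¹ ψ = (l - i)⁻¹ ψ`. -/
theorem IsSpectralMeasureOf.mem_range_singleton_iff (hE : E.IsSpectralMeasureOf H)
    (hH : IsSelfAdjoint H) (l : ℝ) (ψ : 𝓗) :
    ψ ∈ (E {l}).range ↔ ∃ h : ψ ∈ H.domain, H ⟨ψ, h⟩ = (l : ℂ) • ψ := by
  have hz : (Complex.I).im ≠ 0 := by simp
  have hR := hE.isResolventAt hH hz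
  have hb := isBoundedBorel_cauchyKernel hz
  have hl := sub_ne_zero_of_im_ne_zero hz l
  rw [mem_range_iff (measurableSet_singleton l)]
  constructor
  · intro h
    have h1 : E.bcalc (cauchyKernel Complex.I) ψ = cauchyKernel Complex.I l • ψ := by
      have := bcalc_apply_of_singleton (E := E) hb l ψ
      rwa [h] at this
    have h2 : ψ = E.bcalc (cauchyKernel Complex.I) (((l : ℂ) - Complex.I) • ψ) := by
      rw [map_smul, h1, smul_smul, cauchyKernel, mul_inv_cancel₀ hl, one_smul]
    have hd : ψ ∈ H.domain := hR.mem_domain_iff.2 ⟨_, h2.symm⟩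
    refine ⟨hd, ?_⟩
    have h3 := hR.apply_eq (χ := ((l : ℂ) - Complex.I) • ψ) (h2 ▸ hd)
    simp only [← h2] at h3
    rw [h3, sub_smul, sub_add_cancel]
  · rintro ⟨hd, h⟩
    have h1 := hR.left_inv ⟨ψ, hd⟩
    rw [h, ← sub_smul, map_smul] at h1
    have h2 : E.bcalc (cauchyKernel Complex.I) ψ = E.bcalc (fun _ => cauchyKernel Complex.I l) ψ := by
      rw [bcalc_const, smul_apply, one_apply_eq_self, cauchyKernel, eq_inv_smul_iff₀ hl, h1]
    have h3 := norm_sq_bcalc_sub (E := E) hb (.const (cauchyKernel Complex.I l)) ψ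
    rw [h2, sub_self, norm_zero, zero_pow two_ne_zero, eq_comm,
      integral_eq_zero_iff_of_nonneg (fun _ => sq_nonneg _)] at h3
    · refine apply_eq_self_of_compl (measurableSet_singleton l) ?_
      refine ae_iff.1 (h3.mono fun x hx => ?_)
      have h4 : cauchyKernel Complex.I x = cauchyKernel Complex.I l := by
        have : ‖cauchyKernel Complex.I x - cauchyKernel Complex.I l‖ ^ 2 = 0 := hx
        simpa [sub_eq_zero] using this
      have h5 := inv_injective h4
      simpa using h5
    · exact (hb.sub (.const _)).integrable_norm_sq _

theorem mul_singleton_of_ne {k l : ℝ} (h : k ≠ l) (ψ : 𝓗) : E {k} (E {l} ψ) = 0 := by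
  rw [← mul_apply_eq_comp, E.mul_of_disjoint (measurableSet_singleton k)
    (measurableSet_singleton l) (by simpa using h)]
  simp

/-- The finite partial sums of `∑ exp (-i t l) E {l}` are contractions. -/
theorem norm_sum_expKernel_smul_le (t : ℝ) (s : Finset ℝ) (ψ : 𝓗) :
    ‖∑ l ∈ s, expKernel t l • E {l} ψ‖ ≤ ‖ψ‖ := by
  have h1 : ∀ s : Finset ℝ, ∑ l ∈ s, expKernel t l • E {l} ψ =
      E.bcalc ((s : Set ℝ).indicator (expKernel t)) ψ := by
    intro s
    induction s using Finset.induction_on with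
    | empty =>
      have : (fun _ : ℝ => (0 : ℂ)) = ((∅ : Finset ℝ) : Set ℝ).indicator (expKernel t) := by
        simp
      rw [← this, bcalc_const]
      simp
    | insert a s ha ih =>
      rw [Finset.sum_insert ha, ih, ← smul_apply, ← bcalc_indicator (measurableSet_singleton a),
        ← add_apply, ← bcalc_add ((IsBoundedBorel.const _).indicator (measurableSet_singleton a))
          ((isBoundedBorel_expKernel t).indicator s.measurableSet)]
      congr 2
      funext x
      by_cases hx : x = a
      · subst hx
        simp [Set.indicator, ha]
      · by_cases hs : x ∈ s <;> simp [Set.indicator, hx, hs]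
  rw [h1]
  have h2 := norm_bcalc_le (E := E) ((isBoundedBorel_expKernel t).indicator s.measurableSet).1
    zero_le_one (fun x => (norm_indicator_le_norm_self _ x).trans (norm_expKernel t x).le) ψ
  rwa [one_mul] at h2

/-- The expansion holds trivially on finite combinations of eigenvectors and extends to their closed
hull because the partial sums are contractions. -/
theorem hasSum_unitaryGroup {ψ : 𝓗} (hψ : ψ ∈ E.pointSubspace) (t : ℝ) :
    HasSum (fun l : ℝ => expKernel t l • E {l} ψ) (E.unitaryGroup t ψ) := by
  have hspan : ∀ φ ∈ (⨆ l : ℝ, (E {l}).range),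
      HasSum (fun l : ℝ => expKernel t l • E {l} φ) (E.unitaryGroup t φ) := by
    intro φ hφ
    induction hφ using Submodule.iSup_induction' with
    | mem l φ hφ =>
      rw [mem_range_iff (measurableSet_singleton l)] at hφ
      rw [← hφ, unitaryGroup_apply, bcalc_apply_of_singleton (isBoundedBorel_expKernel t)]
      convert hasSum_single (f := fun k : ℝ => expKernel t k • E {k} (E {l} φ)) l
        (fun k hk => ?_) using 1
      · rw [(E.isStarProjection _ (measurableSet_singleton l)).apply_apply]
      · rw [mul_singleton_of_ne hk, smul_zero]
    | zero => simp
    | add φ χ _ _ h1 h2 =>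
      simp only [map_add, smul_add]
      exact h1.add h2
  refine Metric.tendsto_nhds.2 fun ε hε => ?_
  obtain ⟨φ, hφ, hd⟩ := Metric.mem_closure_iff.1 hψ (ε / 3) (by positivity)
  filter_upwards [Metric.tendsto_nhds.1 (hspan φ hφ) (ε / 3) (by positivity)] with s hs
  have h1 : dist (∑ l ∈ s, expKernel t l • E {l} ψ) (∑ l ∈ s, expKernel t l • E {l} φ) < ε / 3 := by
    refine lt_of_le_of_lt ?_ hd
    rw [dist_eq_norm, dist_eq_norm, ← Finset.sum_sub_distrib]
    simp only [← smul_sub, ← map_sub]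
    exact norm_sum_expKernel_smul_le t s _
  have h2 : dist (E.unitaryGroup t φ) (E.unitaryGroup t ψ) < ε / 3 := by
    rw [dist_eq_norm, ← map_sub, UnitaryGroup.norm_apply, ← dist_eq_norm, dist_comm]
    exact hd
  calc _ ≤ _ := dist_triangle4 _ _ _ _
    _ < ε / 3 + ε / 3 + ε / 3 := add_lt_add (add_lt_add h1 hs) h2
    _ = ε := by ring

/-! ### Mean ergodic limits and the Laplace transform of the unitary group -/

/-- The scalar version of the mean ergodic theorem. -/
theorem tendsto_inv_mul_integral_exp_sub (l x : ℝ) :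
    Tendsto (fun p : ℝ × ℝ => ((p.2 - p.1 : ℝ) : ℂ)⁻¹ *
      ∫ t in p.1..p.2, Complex.exp (Complex.I * (x - l) * t))
      (comap (fun p : ℝ × ℝ => p.2 - p.1) atTop) (𝓝 (({l} : Set ℝ).indicator (fun _ => 1) x)) := by
  have hpos : ∀ᶠ p : ℝ × ℝ in comap (fun p : ℝ × ℝ => p.2 - p.1) atTop, 0 < p.2 - p.1 :=
    tendsto_comap.eventually (eventually_gt_atTop 0)
  by_cases hx : x = l
  · subst hx
    simp only [Set.indicator_of_mem (Set.mem_singleton x)]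
    refine tendsto_const_nhds.congr' ?_
    filter_upwards [hpos] with p hp
    have : ((p.2 - p.1 : ℝ) : ℂ) ≠ 0 := by exact_mod_cast hp.ne'
    simp only [sub_self, mul_zero, zero_mul, Complex.exp_zero, intervalIntegral.integral_const]
    rw [Complex.real_smul, mul_one, inv_mul_cancel₀ this]
  · rw [Set.indicator_of_notMem (by simpa using hx)]
    have hc : Complex.I * ((x : ℂ) - l) ≠ 0 :=
      mul_ne_zero Complex.I_ne_zero (sub_ne_zero.2 (by exact_mod_cast hx))
    have hlim : Tendsto (fun p : ℝ × ℝ => (p.2 - p.1)⁻¹ * (2 / ‖Complex.I * ((x : ℂ) - l)‖))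
        (comap (fun p : ℝ × ℝ => p.2 - p.1) atTop) (𝓝 0) := by
      have := (tendsto_inv_atTop_zero.comp (tendsto_comap (f := fun p : ℝ × ℝ => p.2 - p.1)
        (x := atTop))).mul_const (2 / ‖Complex.I * ((x : ℂ) - l)‖)
      rwa [zero_mul] at this
    refine squeeze_zero_norm' ?_ hlim
    filter_upwards [hpos] with p hp
    rw [norm_mul, norm_inv, Complex.norm_real, Real.norm_of_nonneg hp.le,
      integral_exp_mul_complex hc, norm_div]
    gcongr
    refine (norm_sub_le _ _).trans_eq ?_
    have : ∀ r : ℝ, ‖Complex.exp (Complex.I * ((x : ℂ) - l) * r)‖ = 1 := fun r => by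
      rw [Complex.norm_exp]
      simp
    rw [this, this]
    norm_num

theorem integral_indicator_smul_eq_intervalIntegral_neg {F : Type*} [NormedAddCommGroup F]
    [NormedSpace ℂ F] {a b : ℝ} (hab : a ≤ b) {l : ℝ} (v : ℝ → F) :
    ∫ t, (Set.Ioc (-b) (-a)).indicator (fun t : ℝ => Complex.exp (Complex.I * t * l)) t • v t =
      ∫ t in a..b, Complex.exp (-(Complex.I * t * l)) • v (-t) := by
  have h2 : ∀ t, (Set.Ioc (-b) (-a)).indicator (fun t : ℝ => Complex.exp (Complex.I * t * l)) t •
      v t = (Set.Ioc (-b) (-a)).indicator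
        (fun t => Complex.exp (Complex.I * t * l) • v t) t := fun t => by
    by_cases ht : t ∈ Set.Ioc (-b) (-a)
    · simp only [Set.indicator_of_mem ht]
    · simp only [Set.indicator_of_notMem ht, zero_smul]
  simp only [h2]
  rw [integral_indicator measurableSet_Ioc, ← intervalIntegral.integral_of_le (by linarith),
    ← intervalIntegral.integral_comp_neg]
  simp

/-- **The mean ergodic theorem**: time averages of `exp (i t (H - l))` converge to `E {l}`. -/
theorem tendsto_average_unitaryGroup (l : ℝ) (ψ : 𝓗) :
    Tendsto (fun p : ℝ × ℝ => (p.2 - p.1)⁻¹ •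
        ∫ t in p.1..p.2, Complex.exp (-(Complex.I * t * l)) • E.unitaryGroup (-t) ψ)
      (comap (fun p : ℝ × ℝ => p.2 - p.1) atTop) (𝓝 (E {l} ψ)) := by
  let m : ℝ × ℝ → ℝ → ℂ := fun p x => ((p.2 - p.1 : ℝ) : ℂ)⁻¹ *
      ∫ t in p.1..p.2, Complex.exp (Complex.I * (x - l) * t)
  have hm : ∀ p, Measurable (m p) := fun p => by
    refine (measurable_const).mul ?_
    refine (intervalIntegral.continuous_parametric_intervalIntegral_of_continuous'
      (by fun_prop) _ _).measurable
  have hbound : ∀ p x, ‖m p x‖ ≤ 1 := fun p x => by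
    have h1 : ‖∫ t in p.1..p.2, Complex.exp (Complex.I * ((x : ℂ) - l) * t)‖ ≤ 1 * |p.2 - p.1| := by
      refine intervalIntegral.norm_integral_le_of_norm_le_const fun t _ => ?_
      rw [Complex.norm_exp]
      simp
    rw [norm_mul, norm_inv, Complex.norm_real, Real.norm_eq_abs]
    rw [one_mul] at h1
    exact inv_mul_le_one_of_le₀ h1 (abs_nonneg _)
  have h1 := tendsto_bcalc (E := E) hm hbound
    ((IsBoundedBorel.const 1).indicator (measurableSet_singleton l)) ψ
    (.of_forall fun x => tendsto_inv_mul_integral_exp_sub l x)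
  rw [bcalc_indicator (measurableSet_singleton l), one_smul] at h1
  refine h1.congr' ?_
  filter_upwards [tendsto_comap.eventually (eventually_gt_atTop 0)] with p hp
  have hp' : p.1 ≤ p.2 := by linarith
  -- the average is the superposition with weight `exp (i t l)` on `(-p.2, -p.1)`, as `t` is reversed
  let c : ℝ → ℂ := (Set.Ioc (-p.2) (-p.1)).indicator fun t => Complex.exp (Complex.I * t * l)
  have hc : Integrable c := by
    rw [integrable_indicator_iff measurableSet_Ioc]
    exact ((by fun_prop : Continuous fun t : ℝ => Complex.exp (Complex.I * t * l)).integrableOn_Icc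
      ).mono_set Set.Ioc_subset_Icc_self
  obtain ⟨-, h3⟩ := integral_smul_unitaryGroup (E := E) hc ψ
  rw [integral_indicator_smul_eq_intervalIntegral_neg hp'] at h3
  rw [h3]
  have h4 : E.bcalc (m p) = ((p.2 - p.1 : ℝ) : ℂ)⁻¹ • E.bcalc fun x => ∫ t, c t * expKernel t x := by
    have h5 : ∀ x, ∫ t, c t * expKernel t x =
        ∫ t in p.1..p.2, Complex.exp (Complex.I * (x - l) * t) := fun x => by
      have := integral_indicator_smul_eq_intervalIntegral_neg hp' (l := l) fun t => expKernel t x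
      simp only [smul_eq_mul] at this
      rw [this]
      refine intervalIntegral.integral_congr fun t _ => ?_
      simp only [expKernel]
      rw [← Complex.exp_add]
      push_cast
      ring_nf
    simp only [h5]
    rw [← bcalc_const_mul]
    refine ⟨(intervalIntegral.continuous_parametric_intervalIntegral_of_continuous'
      (by fun_prop) _ _).measurable, 1 * |p.2 - p.1|, fun x => ?_⟩
    refine intervalIntegral.norm_integral_le_of_norm_le_const fun t _ => ?_
    rw [Complex.norm_exp]
    simp
  rw [h4, smul_apply, ← Complex.ofReal_inv, Complex.coe_smul]

/-- A Laplace transform of the scalar exponentials yields the one of the unitary group. -/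
theorem bcalc_cauchyKernel_eq_integral {a z : ℂ} {s : Set ℝ} (hs : MeasurableSet s)
    (hint : IntegrableOn (fun t : ℝ => Complex.exp (Complex.I * t * z)) s)
    (h : ∀ x, a * ∫ t in s, Complex.exp (Complex.I * t * z) * expKernel t x = cauchyKernel z x)
    (hb : IsBoundedBorel fun x => ∫ t in s, Complex.exp (Complex.I * t * z) * expKernel t x)
    (ψ : 𝓗) :
    IntegrableOn (fun t : ℝ => Complex.exp (Complex.I * t * z) • E.unitaryGroup t ψ) s ∧
      E.bcalc (cauchyKernel z) ψ = a •
        ∫ t in s, Complex.exp (Complex.I * t * z) • E.unitaryGroup t ψ := by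
  obtain ⟨h1, h2⟩ := integral_smul_unitaryGroup (E := E) ((integrable_indicator_iff hs).2 hint) ψ
  have h3 : ∀ t, s.indicator (fun t : ℝ => Complex.exp (Complex.I * t * z)) t •
      E.unitaryGroup t ψ =
      s.indicator (fun t : ℝ => Complex.exp (Complex.I * t * z) • E.unitaryGroup t ψ) t := fun t => by
    by_cases ht : t ∈ s <;> simp [ht]
  have h4 : ∀ t x, s.indicator (fun t : ℝ => Complex.exp (Complex.I * t * z)) t * expKernel t x =
      s.indicator (fun t : ℝ => Complex.exp (Complex.I * t * z) * expKernel t x) t := fun t x => by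
    by_cases ht : t ∈ s <;> simp [ht]
  simp only [h3, h4] at h1 h2
  rw [integral_indicator hs] at h2
  simp only [integral_indicator hs] at h2
  refine ⟨(integrable_indicator_iff hs).1 h1, ?_⟩
  rw [h2, ← smul_apply, ← bcalc_const_mul a hb]
  simp only [h]

theorem exp_mul_expKernel (z : ℂ) (t x : ℝ) :
    Complex.exp (Complex.I * t * z) * expKernel t x = Complex.exp (Complex.I * (z - x) * t) := by
  rw [expKernel, ← Complex.exp_add]
  ring_nf

/-- The resolvent in the upper half-plane is the Laplace transform of the unitary group. -/
theorem bcalc_cauchyKernel_eq_integral_Ioi {z : ℂ} (hz : 0 < z.im) (ψ : 𝓗) :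
    IntegrableOn (fun t : ℝ => Complex.exp (Complex.I * t * z) • E.unitaryGroup t ψ) (Set.Ioi 0) ∧
      E.bcalc (cauchyKernel z) ψ = Complex.I •
        ∫ t in Set.Ioi (0 : ℝ), Complex.exp (Complex.I * t * z) • E.unitaryGroup t ψ := by
  have hint := (integrableOn_exp_mul_complex_Ioi (a := Complex.I * z) (by simpa using hz) 0).congr_fun
    (g := fun t : ℝ => Complex.exp (Complex.I * t * z)) (fun t _ => by ring_nf) measurableSet_Ioi
  have hval : ∀ x : ℝ, ∫ t in Set.Ioi (0 : ℝ), Complex.exp (Complex.I * t * z) * expKernel t x =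
      -Complex.I * cauchyKernel z x := fun x => by
    have hne := sub_ne_zero_of_im_ne_zero hz.ne' x
    have hne' : z - x ≠ 0 := by
      rw [← neg_sub]
      exact neg_ne_zero.2 hne
    simp only [exp_mul_expKernel]
    rw [integral_exp_mul_complex_Ioi (by simpa using hz)]
    simp only [Complex.ofReal_zero, mul_zero, Complex.exp_zero, cauchyKernel]
    field_simp
    linear_combination (z - (x : ℂ)) * Complex.I_sq
  refine bcalc_cauchyKernel_eq_integral measurableSet_Ioi hint (fun x => ?_) ?_ ψ
  · rw [hval, ← mul_assoc]
    simp
  · simp only [hval]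
    exact (isBoundedBorel_cauchyKernel hz.ne').const_mul _

/-- The resolvent in the lower half-plane is the Laplace transform of the unitary group. -/
theorem bcalc_cauchyKernel_eq_integral_Iio {z : ℂ} (hz : z.im < 0) (ψ : 𝓗) :
    IntegrableOn (fun t : ℝ => Complex.exp (Complex.I * t * z) • E.unitaryGroup t ψ) (Set.Iio 0) ∧
      E.bcalc (cauchyKernel z) ψ = -(Complex.I •
        ∫ t in Set.Iio (0 : ℝ), Complex.exp (Complex.I * t * z) • E.unitaryGroup t ψ) := by
  have hint := ((integrableOn_exp_mul_complex_Iic (a := Complex.I * z) (by simpa using hz)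
    0).mono_set Set.Iio_subset_Iic_self).congr_fun
    (g := fun t : ℝ => Complex.exp (Complex.I * t * z)) (fun t _ => by ring_nf) measurableSet_Iio
  have hval : ∀ x : ℝ, ∫ t in Set.Iio (0 : ℝ), Complex.exp (Complex.I * t * z) * expKernel t x =
      Complex.I * cauchyKernel z x := fun x => by
    have hne := sub_ne_zero_of_im_ne_zero hz.ne x
    have hne' : z - x ≠ 0 := by
      rw [← neg_sub]
      exact neg_ne_zero.2 hne
    simp only [exp_mul_expKernel]
    rw [← integral_Iic_eq_integral_Iio, integral_exp_mul_complex_Iic (by simpa using hz)]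
    simp only [Complex.ofReal_zero, mul_zero, Complex.exp_zero, cauchyKernel]
    field_simp
    linear_combination ((x : ℂ) - z) * Complex.I_sq
  rw [← neg_smul]
  refine bcalc_cauchyKernel_eq_integral measurableSet_Iio hint (fun x => ?_) ?_ ψ
  · rw [hval, ← mul_assoc]
    simp
  · simp only [hval]
    exact (isBoundedBorel_cauchyKernel hz.ne).const_mul _

/-! ### The continuous subspace -/

/-- The jump of `l ↦ E (Iic l) ψ` at `a` is `E {a} ψ`. -/
theorem mem_continuousSubspace {ψ : 𝓗} (h : ∀ l : ℝ, E {l} ψ = 0) : ψ ∈ E.continuousSubspace := by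
  have hI : ∀ a : ℝ, E.bcalc ((Set.Iic a).indicator fun _ => 1) = E (Set.Iic a) := fun a => by
    rw [bcalc_indicator measurableSet_Iic, one_smul]
  refine continuous_iff_continuousAt.2 fun a => ?_
  have hb : ∀ a : ℝ, IsBoundedBorel ((Set.Iic a).indicator fun _ => (1 : ℂ)) := fun a =>
    (IsBoundedBorel.const 1).indicator measurableSet_Iic
  have h1 := tendsto_bcalc (E := E) (l := 𝓝 a) (C := 1) (fun b => (hb b).measurable)
    (fun b x => (norm_indicator_le_norm_self _ x).trans_eq norm_one) (hb a) ψ ?_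
  · simp only [hI] at h1
    exact h1
  · have h2 : E.scalarMeasure ψ {a} = 0 := by
      rw [E.scalarMeasure_apply (measurableSet_singleton a), h]
      simp
    have h3 : ∀ᵐ x ∂(E.scalarMeasure ψ), x ≠ a := by
      rw [ae_iff]
      simpa using h2
    filter_upwards [h3] with x hx
    refine tendsto_const_nhds.congr' ?_
    rcases lt_or_gt_of_ne hx with hx | hx
    · filter_upwards [lt_mem_nhds hx] with b hb
      rw [Set.indicator_of_mem (Set.mem_Iic.2 hx.le), Set.indicator_of_mem (Set.mem_Iic.2 hb.le)]
    · filter_upwards [gt_mem_nhds hx] with b hb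
      rw [Set.indicator_of_notMem (by simpa using hx), Set.indicator_of_notMem (by simpa using hb)]

theorem exists_add_mem_continuousSubspace (ψ : 𝓗) :
    ∃ ψp ∈ E.pointSubspace, ∃ ψc ∈ E.continuousSubspace, ψ = ψp + ψc ∧ ⟪ψp, ψc⟫_ℂ = 0 := by
  have : CompleteSpace E.pointSubspace :=
    (Submodule.isClosed_topologicalClosure _).completeSpace_coe
  obtain ⟨ψp, hp, ψc, hc, h⟩ := E.pointSubspace.exists_add_mem_mem_orthogonal ψ
  refine ⟨ψp, hp, ψc, mem_continuousSubspace fun l => ?_, h,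
    (Submodule.mem_orthogonal _ _).1 hc ψp hp⟩
  have h1 : E {l} ψc ∈ E.pointSubspace :=
    Submodule.le_topologicalClosure _ (Submodule.mem_iSup_of_mem l ⟨ψc, rfl⟩)
  have h2 := (Submodule.mem_orthogonal' _ _).1 hc _ h1
  rw [(E.isStarProjection _ (measurableSet_singleton l)).inner_self_apply] at h2
  simpa using h2

end ProjectionValuedMeasure

noncomputable section

/-! ### The Poisson kernel of the half-plane -/

/-- The Poisson kernel of the upper half-plane. -/
def upperPoisson (ε s : ℝ) : ℝ := Real.pi⁻¹ * (ε / (s ^ 2 + ε ^ 2))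

theorem upperPoisson_nonneg {ε : ℝ} (hε : 0 < ε) (s : ℝ) : 0 ≤ upperPoisson ε s := by
  have := Real.pi_pos
  unfold upperPoisson
  positivity

theorem continuous_upperPoisson {ε : ℝ} (hε : 0 < ε) : Continuous (upperPoisson ε) := by
  unfold upperPoisson
  exact continuous_const.mul (continuous_const.div (by fun_prop) fun s => by positivity)

theorem upperPoisson_eq {ε : ℝ} (hε : 0 < ε) (s : ℝ) :
    upperPoisson ε s = (Real.pi⁻¹ * ε⁻¹) * (1 + (s / ε) ^ 2)⁻¹ := by
  have := Real.pi_pos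
  unfold upperPoisson
  field_simp
  ring

theorem integrable_upperPoisson {ε : ℝ} (hε : 0 < ε) (x : ℝ) :
    Integrable fun t => upperPoisson ε (x - t) := by
  have h : Integrable (upperPoisson ε) := by
    simp only [funext (upperPoisson_eq hε)]
    exact (integrable_inv_one_add_sq.comp_div hε.ne').const_mul _
  exact h.comp_sub_left x

theorem integral_upperPoisson {ε : ℝ} (hε : 0 < ε) (x : ℝ) :
    ∫ t, upperPoisson ε (x - t) = 1 := by
  rw [integral_sub_left_eq_self (upperPoisson ε) volume x]
  simp only [upperPoisson_eq hε]
  rw [integral_const_mul, Measure.integral_comp_div (fun s => (1 + s ^ 2)⁻¹) ε,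
    integral_univ_inv_one_add_sq, abs_of_pos hε, smul_eq_mul]
  have := Real.pi_pos
  field_simp

theorem lintegral_upperPoisson {ε : ℝ} (hε : 0 < ε) (x : ℝ) :
    ∫⁻ t, ENNReal.ofReal (upperPoisson ε (x - t)) = 1 := by
  rw [← ofReal_integral_eq_lintegral_ofReal (integrable_upperPoisson hε x)
    (.of_forall fun t => upperPoisson_nonneg hε _), integral_upperPoisson hε, ENNReal.ofReal_one]

/-- The superlevel sets of the Poisson kernel are centred intervals. -/
theorem superlevel_upperPoisson {ε : ℝ} (hε : 0 < ε) (x : ℝ) {s : ℝ} (hs : 0 < s) :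
    {t | s ≤ upperPoisson ε (x - t)} = ∅ ∨
      ∃ r, 0 ≤ r ∧ {t | s ≤ upperPoisson ε (x - t)} = Metric.closedBall x r := by
  have hpi := Real.pi_pos
  have hiff : ∀ t, s ≤ upperPoisson ε (x - t) ↔
      (t - x) ^ 2 ≤ Real.pi⁻¹ * ε / s - ε ^ 2 := fun t => by
    rw [upperPoisson, ← mul_div_assoc, le_div_iff₀ (by positivity), le_sub_iff_add_le,
      le_div_iff₀ hs]
    constructor <;> intro h <;> nlinarith
  rcases lt_or_ge (Real.pi⁻¹ * ε / s - ε ^ 2) 0 with hq | hq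
  · left
    ext t
    simp only [Set.mem_ofPred_eq, hiff, Set.mem_empty_iff_false, iff_false, not_le]
    exact hq.trans_le (sq_nonneg _)
  · right
    refine ⟨√(Real.pi⁻¹ * ε / s - ε ^ 2), Real.sqrt_nonneg _, ?_⟩
    ext t
    rw [Set.mem_ofPred_eq, hiff, Metric.mem_closedBall, Real.dist_eq, Real.le_sqrt (abs_nonneg _) hq,
      sq_abs]

/-- A measure that is at most `η` times Lebesgue measure on centred intervals gives the Poisson
kernel at most the integral `η`, by the layer cake formula. -/
theorem lintegral_upperPoisson_le {ε : ℝ} (hε : 0 < ε) (x : ℝ) (τ : Measure ℝ) (η : ENNReal)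
    (h : ∀ r, 0 ≤ r → τ (Metric.closedBall x r) ≤ η * volume (Metric.closedBall x r)) :
    ∫⁻ t, ENNReal.ofReal (upperPoisson ε (x - t)) ∂τ ≤ η := by
  have hm : Measurable fun t => upperPoisson ε (x - t) :=
    ((continuous_upperPoisson hε).comp (continuous_const.sub continuous_id)).measurable
  have hanti : Antitone fun s => volume {t | s ≤ upperPoisson ε (x - t)} := fun s s' hs =>
    measure_mono fun t ht => hs.trans ht
  calc ∫⁻ t, ENNReal.ofReal (upperPoisson ε (x - t)) ∂τ
      = ∫⁻ s in Set.Ioi 0, τ {t | s ≤ upperPoisson ε (x - t)} :=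
        lintegral_eq_lintegral_meas_le τ (.of_forall fun t => upperPoisson_nonneg hε _)
          hm.aemeasurable
    _ ≤ ∫⁻ s in Set.Ioi 0, η * volume {t | s ≤ upperPoisson ε (x - t)} := by
        refine setLIntegral_mono' measurableSet_Ioi fun s hs => ?_
        rcases superlevel_upperPoisson hε x hs with h' | ⟨r, hr, h'⟩
        · simp [h']
        · rw [h']
          exact h r hr
    _ = η * ∫⁻ t, ENNReal.ofReal (upperPoisson ε (x - t)) := by
        rw [lintegral_const_mul _ hanti.measurable, lintegral_eq_lintegral_meas_le volume
          (.of_forall fun t => upperPoisson_nonneg hε _) hm.aemeasurable]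
    _ = η := by rw [lintegral_upperPoisson hε, mul_one]

/-- Away from its centre, the Poisson kernel is `O(ε)`, with the decay of `(1 + t ^ 2)⁻¹`. -/
theorem upperPoisson_le_of_le {δ x : ℝ} (hδ : 0 < δ) {ε : ℝ} (hε : 0 < ε) {t : ℝ}
    (ht : δ ≤ |x - t|) :
    upperPoisson ε (x - t) ≤ ε * ((1 + 2 * x ^ 2) / δ ^ 2 + 2) * (1 + t ^ 2)⁻¹ := by
  have hpi : Real.pi⁻¹ ≤ 1 := inv_le_one_of_one_le₀ (by linarith [Real.pi_gt_three])
  have hpi0 := Real.pi_pos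
  have h1 : δ ^ 2 ≤ (x - t) ^ 2 := by
    rw [← sq_abs (x - t)]
    gcongr
  have h2 : 1 + t ^ 2 ≤ ((1 + 2 * x ^ 2) / δ ^ 2 + 2) * (x - t) ^ 2 := by
    have h3 : (1 + 2 * x ^ 2) ≤ (1 + 2 * x ^ 2) / δ ^ 2 * (x - t) ^ 2 := by
      rw [div_mul_eq_mul_div, le_div_iff₀ (by positivity)]
      gcongr
    nlinarith [sq_nonneg (2 * x - t)]
  have hpos : 0 < (x - t) ^ 2 := lt_of_lt_of_le (by positivity) h1
  calc upperPoisson ε (x - t) ≤ 1 * (ε / (x - t) ^ 2) := by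
        unfold upperPoisson
        gcongr
        nlinarith
    _ ≤ _ := by
        rw [one_mul, ← div_eq_mul_inv, div_le_div_iff₀ hpos (by positivity), mul_assoc]
        gcongr

/-- Functions `u` with `u / (1 + t ^ 2)` integrable can be integrated against kernels that decay like
`(1 + t ^ 2)⁻¹`. -/
theorem integrable_of_integrable_div {u : ℝ → ℂ} (hu : Integrable fun t => ((1 + t ^ 2)⁻¹ : ℝ) • u t)
    {w : ℝ → ℝ} (hw : Measurable w) {C : ℝ} (hC : ∀ t, |w t| ≤ C * (1 + t ^ 2)⁻¹) :
    Integrable fun t => (w t : ℂ) * u t := by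
  have h1 : (fun t => (w t : ℂ) * u t) =
      fun t => ((w t * (1 + t ^ 2) : ℝ) : ℂ) * (((1 + t ^ 2)⁻¹ : ℝ) • u t) := by
    funext t
    have : (1 + (t : ℂ) ^ 2) ≠ 0 := by
      have : (1 + t ^ 2 : ℝ) ≠ 0 := by positivity
      exact_mod_cast this
    rw [Complex.real_smul]
    push_cast
    field_simp
  rw [h1]
  refine hu.bdd_mul (c := C) ?_ (.of_forall fun t => ?_)
  · exact (Complex.measurable_ofReal.comp (hw.mul (by fun_prop))).aestronglyMeasurable
  · have : (0 : ℝ) < 1 + t ^ 2 := by positivity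
    rw [Complex.norm_real, Real.norm_eq_abs, abs_mul, abs_of_pos this, ← le_div_iff₀ this]
    exact hC t

theorem exists_upperPoisson_le {ε : ℝ} (hε : 0 < ε) (x : ℝ) :
    ∃ C, ∀ t, |upperPoisson ε (x - t)| ≤ C * (1 + t ^ 2)⁻¹ := by
  have hpi := Real.pi_pos
  refine ⟨Real.pi⁻¹ * ε * ((1 + 2 * x ^ 2) / ε ^ 2 + 2), fun t => ?_⟩
  rw [abs_of_nonneg (upperPoisson_nonneg hε _), upperPoisson, mul_assoc, mul_assoc]
  gcongr
  rw [div_eq_mul_inv]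
  gcongr
  rw [← div_eq_mul_inv, inv_eq_one_div, div_le_div_iff₀ (by positivity) (by positivity), one_mul]
  have h3 : (1 + 2 * x ^ 2) ≤ (1 + 2 * x ^ 2) / ε ^ 2 * ε ^ 2 := by
    rw [div_mul_cancel₀ _ (by positivity)]
  have h4 : 0 ≤ (1 + 2 * x ^ 2) / ε ^ 2 * (x - t) ^ 2 := by positivity
  nlinarith [sq_nonneg (2 * x - t), sq_nonneg ε]

theorem locallyIntegrable_of_integrable_div {u : ℝ → ℂ}
    (hu : Integrable fun t => ((1 + t ^ 2)⁻¹ : ℝ) • u t) : LocallyIntegrable u := by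
  have h : u = fun t => (1 + t ^ 2 : ℝ) • (((1 + t ^ 2)⁻¹ : ℝ) • u t) := by
    funext t
    rw [smul_smul, mul_inv_cancel₀ (by positivity), one_smul]
  have hc : Continuous fun t : ℝ => (1 + t ^ 2 : ℝ) := by fun_prop
  rw [h]
  exact hu.locallyIntegrable.continuous_smul hc

/-- If `v` has mean value zero at `x` in the sense of Lebesgue points, then its Poisson integrals at
`x` tend to zero: the part near `x` is small by comparison with Lebesgue measure on centred
intervals, and the rest is `O(ε)`. -/
theorem tendsto_lintegral_upperPoisson {v : ℝ → ℂ}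
    (hv : Integrable fun t => ((1 + t ^ 2)⁻¹ : ℝ) • v t) {x : ℝ}
    (hx : Tendsto (fun r => (∫⁻ y in Metric.closedBall x r, ‖v y‖ₑ) /
      volume (Metric.closedBall x r)) (𝓝[>] 0) (𝓝 0)) :
    Tendsto (fun ε => ∫⁻ t, ENNReal.ofReal (upperPoisson ε (x - t)) * ‖v t‖ₑ) (𝓝[>] 0) (𝓝 0) := by
  have hvm : AEMeasurable (fun t => ‖v t‖ₑ) :=
    (locallyIntegrable_of_integrable_div hv).aestronglyMeasurable.enorm
  have hK : ∫⁻ t, ENNReal.ofReal (1 + t ^ 2)⁻¹ * ‖v t‖ₑ ≠ ⊤ := by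
    have := hv.2
    rw [hasFiniteIntegral_iff_enorm] at this
    convert this.ne using 3 with t
    rw [enorm_smul, Real.enorm_of_nonneg (by positivity)]
  rw [ENNReal.tendsto_nhds_zero]
  intro η hη
  have hη2 : 0 < η / 2 := ENNReal.half_pos hη.ne'
  obtain ⟨δ, hδ, hball⟩ := mem_nhdsGT_iff_exists_Ioc_subset.1
    ((ENNReal.tendsto_nhds_zero.1 hx) (η / 2) hη2)
  replace hδ : 0 < δ := hδ
  have hout : Tendsto (fun ε : ℝ => ENNReal.ofReal (ε * ((1 + 2 * x ^ 2) / δ ^ 2 + 2)) *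
      ∫⁻ t, ENNReal.ofReal (1 + t ^ 2)⁻¹ * ‖v t‖ₑ) (𝓝[>] 0) (𝓝 0) := by
    have h1 : Tendsto (fun ε : ℝ => ENNReal.ofReal (ε * ((1 + 2 * x ^ 2) / δ ^ 2 + 2)))
        (𝓝[>] 0) (𝓝 0) := by
      have : Continuous fun ε : ℝ => ENNReal.ofReal (ε * ((1 + 2 * x ^ 2) / δ ^ 2 + 2)) :=
        ENNReal.continuous_ofReal.comp (by fun_prop)
      simpa using this.tendsto' 0 0 (by simp) |>.mono_left nhdsWithin_le_nhds
    simpa using ENNReal.Tendsto.mul_const h1 (.inr hK)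
  filter_upwards [(ENNReal.tendsto_nhds_zero.1 hout) (η / 2) hη2, self_mem_nhdsWithin] with ε h1 hε
  replace hε : 0 < ε := hε
  have hP : Measurable fun t => ENNReal.ofReal (upperPoisson ε (x - t)) :=
    ((continuous_upperPoisson hε).comp
      (continuous_const.sub continuous_id)).measurable.ennreal_ofReal
  rw [← lintegral_add_compl _ (Metric.isClosed_closedBall (x := x) (ε := δ)).measurableSet,
    ← ENNReal.add_halves η]
  refine add_le_add ?_ (le_trans ?_ h1)
  · set τ := (volume.restrict (Metric.closedBall x δ)).withDensity fun t => ‖v t‖ₑ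
    have hτ : ∫⁻ t in Metric.closedBall x δ, ENNReal.ofReal (upperPoisson ε (x - t)) * ‖v t‖ₑ =
        ∫⁻ t, ENNReal.ofReal (upperPoisson ε (x - t)) ∂τ := by
      rw [lintegral_withDensity_eq_lintegral_mul₀ hvm.restrict hP.aemeasurable]
      simp only [Pi.mul_apply, mul_comm]
    rw [hτ]
    refine lintegral_upperPoisson_le hε x τ _ fun r hr => ?_
    have h2 : τ (Metric.closedBall x r) = ∫⁻ t in Metric.closedBall x (min r δ), ‖v t‖ₑ := by
      rw [withDensity_apply _ Metric.isClosed_closedBall.measurableSet,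
        Measure.restrict_restrict Metric.isClosed_closedBall.measurableSet]
      congr 2
      ext t
      simp
    rcases hr.eq_or_lt with rfl | hr
    · rw [h2, min_eq_left hδ.le]
      simp
    · have h3 : 0 < min r δ := lt_min hr hδ
      have h4 := hball ⟨h3, min_le_right r δ⟩
      rw [Set.mem_ofPred_eq, ENNReal.div_le_iff (Metric.measure_closedBall_pos _ _ h3).ne'
        measure_closedBall_lt_top.ne] at h4
      rw [h2]
      exact h4.trans (by gcongr; exact min_le_left _ _)
  · rw [← lintegral_const_mul' _ _ ENNReal.ofReal_ne_top]
    refine (setLIntegral_mono_ae' Metric.isClosed_closedBall.measurableSet.compl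
      (.of_forall fun t ht => ?_)).trans (setLIntegral_le_lintegral _ _)
    rw [Set.mem_compl_iff, Metric.mem_closedBall, not_le, dist_comm, Real.dist_eq] at ht
    rw [← mul_assoc, ← ENNReal.ofReal_mul (by positivity)]
    gcongr
    exact upperPoisson_le_of_le hδ hε ht.le

/-- **Poisson integrals converge almost everywhere** to their boundary function, namely at all of
its Lebesgue points. -/
theorem ae_tendsto_integral_upperPoisson {u : ℝ → ℂ}
    (hu : Integrable fun t => ((1 + t ^ 2)⁻¹ : ℝ) • u t) :
    ∀ᵐ x, Tendsto (fun ε => ∫ t, (upperPoisson ε (x - t) : ℂ) * u t) (𝓝[>] 0) (𝓝 (u x)) := by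
  filter_upwards [(IsUnifLocDoublingMeasure.vitaliFamily volume 1).ae_tendsto_lintegral_enorm_sub_div
    (locallyIntegrable_of_integrable_div hu)] with x hx
  have hx' := hx.comp (IsUnifLocDoublingMeasure.tendsto_closedBall_filterAt volume (K := 1) (x := x)
    (l := 𝓝[>] 0) (fun _ => x) id tendsto_id (by
      filter_upwards [self_mem_nhdsWithin] with r hr
      exact Metric.mem_closedBall_self (by simpa using le_of_lt hr)))
  have hv : Integrable fun t => ((1 + t ^ 2)⁻¹ : ℝ) • (u t - u x) := by
    simp only [smul_sub]
    exact hu.sub (integrable_inv_one_add_sq.smul_const _)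
  have h0 := tendsto_lintegral_upperPoisson hv hx'
  rw [tendsto_iff_edist_tendsto_0]
  refine tendsto_of_tendsto_of_tendsto_of_le_of_le' tendsto_const_nhds h0
    (.of_forall fun _ => zero_le) ?_
  filter_upwards [self_mem_nhdsWithin] with ε hε
  replace hε : 0 < ε := hε
  obtain ⟨C, hC⟩ := exists_upperPoisson_le hε x
  have hPm : Measurable fun t => upperPoisson ε (x - t) :=
    ((continuous_upperPoisson hε).comp (continuous_const.sub continuous_id)).measurable
  have hPi : Integrable fun t => (upperPoisson ε (x - t) : ℂ) := (integrable_upperPoisson hε x).ofReal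
  have h1 : ∫ t, (upperPoisson ε (x - t) : ℂ) * u t - (upperPoisson ε (x - t) : ℂ) * u x =
      (∫ t, (upperPoisson ε (x - t) : ℂ) * u t) - u x := by
    rw [integral_sub (integrable_of_integrable_div hu hPm hC)
      (hPi.mul_const _), integral_mul_const,
      integral_complex_ofReal, integral_upperPoisson hε, Complex.ofReal_one, one_mul]
  rw [edist_eq_enorm_sub, ← h1]
  refine (enorm_integral_le_lintegral_enorm _).trans_eq (lintegral_congr fun t => ?_)
  rw [← mul_sub, enorm_mul, ← Real.enorm_of_nonneg (upperPoisson_nonneg hε _)]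
  congr 1
  simp [enorm_eq_nnnorm]

end

noncomputable section

/-! ### Bounded holomorphic functions on the half-plane -/

theorem sq_add_sq_eq_mul (x ε t : ℝ) :
    (((t - x) ^ 2 + ε ^ 2 : ℝ) : ℂ) =
      ((t : ℂ) - (x + ε * Complex.I)) * ((t : ℂ) - (x - ε * Complex.I)) := by
  push_cast
  linear_combination (ε : ℂ) ^ 2 * Complex.I_sq

/-- Far from the points `x ± i ε`, the integrand of Cauchy's theorem below is `O(R⁻²)`. -/
theorem norm_dslope_div_le {k : ℂ → ℂ} {M : ℝ} (hM : ∀ z : ℂ, 0 ≤ z.im → ‖k z‖ ≤ M) {ε x R : ℝ}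
    (hε : 0 < ε) (hR : 0 < R) {z : ℂ} (hz : 0 ≤ z.im)
    (h1 : R / 2 ≤ ‖z - (x + ε * Complex.I)‖) (h2 : R / 2 ≤ ‖z - (x - ε * Complex.I)‖) :
    ‖dslope k (x + ε * Complex.I) z / (z - (x - ε * Complex.I))‖ ≤ 8 * M / R ^ 2 := by
  have hne : z ≠ x + ε * Complex.I := by
    rintro rfl
    rw [sub_self, norm_zero] at h1
    linarith
  rw [dslope_of_ne _ hne, slope_def_field, norm_div, norm_div, div_div]
  have h3 : ‖k z - k (x + ε * Complex.I)‖ ≤ 2 * M := by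
    have := norm_sub_le (k z) (k (x + ε * Complex.I))
    linarith [hM z hz, hM (x + ε * Complex.I) (by simp [hε.le])]
  calc _ ≤ 2 * M / (R / 2 * (R / 2)) := by gcongr; exact (norm_nonneg _).trans h3
    _ = 8 * M / R ^ 2 := by field_simp; ring

/-- Cauchy's theorem for `(k(z) - k(z₀)) / ((z - z₀) (z - conj z₀))` with `z₀ = x + i ε`, on the
rectangles `[x - R, x + R] × [0, R]`: the singularity at `z₀` is removable, `conj z₀` lies outside, and
the sides above the real line contribute `O(R⁻¹)`. -/
theorem integral_div_sq_add_sq_eq_zero {k : ℂ → ℂ} {δ M : ℝ} (hδ : 0 < δ)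
    (hk : DifferentiableOn ℂ k {z | -δ < z.im}) (hM : ∀ z : ℂ, 0 ≤ z.im → ‖k z‖ ≤ M)
    {ε : ℝ} (hε : 0 < ε) (x : ℝ)
    (hint : Integrable fun t : ℝ =>
      (k t - k (x + ε * Complex.I)) / (((t - x) ^ 2 + ε ^ 2 : ℝ) : ℂ)) :
    ∫ t : ℝ, (k t - k (x + ε * Complex.I)) / (((t - x) ^ 2 + ε ^ 2 : ℝ) : ℂ) = 0 := by
  set z₀ : ℂ := x + ε * Complex.I with hz₀
  set q : ℂ → ℂ := fun z => dslope k z₀ z / (z - (x - ε * Complex.I)) with hq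
  have hz₀im : z₀.im = ε := by simp [hz₀]
  have hopen : IsOpen {z : ℂ | -δ < z.im} := isOpen_lt continuous_const Complex.continuous_im
  have hqd : DifferentiableOn ℂ q {z | 0 ≤ z.im} := by
    refine DifferentiableOn.div ?_ (by fun_prop) fun z hz h => ?_
    · refine ((Complex.differentiableOn_dslope (hopen.mem_nhds ?_)).2 hk).mono fun z hz => ?_
      · change -δ < z₀.im
        linarith
      · exact (neg_lt_zero.2 hδ).trans_le hz
    · have h1 := congrArg Complex.im h
      simp at h1
      have h2 : 0 ≤ z.im := hz
      linarith
  have hlim := intervalIntegral_tendsto_integral hint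
    (tendsto_atBot_add_const_left atTop x tendsto_neg_atTop_atBot)
    (tendsto_atTop_add_const_left atTop x tendsto_id)
  refine tendsto_nhds_unique hlim (squeeze_zero_norm' ?_
    (tendsto_const_nhds.div_atTop tendsto_id : Tendsto (fun R : ℝ => 32 * M / R) atTop (𝓝 0)))
  filter_upwards [eventually_gt_atTop (2 * ε)] with R hR
  have hR0 : 0 < R := by linarith
  have hrect := Complex.integral_boundary_rect_eq_zero_of_differentiableOn q
    ((x - R : ℝ) : ℂ) ((x + R : ℝ) + R * Complex.I) (hqd.mono fun z hz => by
      have := hz.2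
      simp only [Set.mem_preimage, Complex.ofReal_im, Complex.add_im, Complex.mul_im,
        Complex.ofReal_re, Complex.I_im, Complex.I_re, mul_one, mul_zero, add_zero, zero_add,
        Set.uIcc_of_le hR0.le] at this
      exact this.1)
  simp only [Complex.ofReal_im, Complex.add_im, Complex.mul_im, Complex.add_re, Complex.mul_re,
    Complex.ofReal_re, Complex.I_im, Complex.I_re, mul_one, mul_zero, add_zero, zero_add,
    sub_self, Complex.ofReal_zero, zero_mul] at hrect
  have hbot : ∫ t in (x - R)..(x + R), q t = ∫ t in (x + -R)..(x + id R),
      (k t - k z₀) / (((t - x) ^ 2 + ε ^ 2 : ℝ) : ℂ) := by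
    rw [← sub_eq_add_neg, id]
    refine intervalIntegral.integral_congr fun t _ => ?_
    have hne : (t : ℂ) ≠ z₀ := fun h => by
      have := congrArg Complex.im h
      rw [hz₀im, Complex.ofReal_im] at this
      exact hε.ne this
    simp only [hq]
    rw [dslope_of_ne _ hne, slope_def_field, div_div, sq_add_sq_eq_mul]
  have hside : ∀ (a y : ℝ), |a - x| = R → y ∈ Set.uIoc 0 R →
      ‖q (a + y * Complex.I)‖ ≤ 8 * M / R ^ 2 := fun a y ha hy => by
    rw [Set.uIoc_of_le hR0.le] at hy
    refine norm_dslope_div_le hM hε hR0 (by simpa using hy.1.le) ?_ ?_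
    · refine le_trans ?_ (Complex.abs_re_le_norm _)
      simp [ha]
      linarith
    · refine le_trans ?_ (Complex.abs_re_le_norm _)
      simp [ha]
      linarith
  have htop : ‖∫ t in (x - R)..(x + R), q (t + R * Complex.I)‖ ≤ 8 * M / R ^ 2 * (2 * R) := by
    refine (intervalIntegral.norm_integral_le_of_norm_le_const fun t _ =>
      norm_dslope_div_le hM hε hR0 (by simpa using hR0.le) ?_ ?_).trans_eq ?_
    · refine le_trans ?_ (Complex.abs_im_le_norm _)
      refine le_trans ?_ (le_abs_self _)
      simp
      linarith
    · refine le_trans ?_ (Complex.abs_im_le_norm _)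
      refine le_trans ?_ (le_abs_self _)
      simp
      linarith
    · rw [add_sub_sub_cancel, ← two_mul, abs_of_pos (by linarith)]
  have hr := intervalIntegral.norm_integral_le_of_norm_le_const (f := fun y : ℝ =>
    q ((x + R : ℝ) + y * Complex.I)) (a := 0) (b := R) fun y hy =>
      hside (x + R) y (by simp [abs_of_pos hR0]) hy
  have hl := intervalIntegral.norm_integral_le_of_norm_le_const (f := fun y : ℝ =>
    q ((x - R : ℝ) + y * Complex.I)) (a := 0) (b := R) fun y hy =>
      hside (x - R) y (by simp [abs_of_pos hR0]) hy
  rw [sub_zero, abs_of_pos hR0] at hr hl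
  rw [← hbot]
  have heq : ∫ t in (x - R)..(x + R), q t = (∫ t in (x - R)..(x + R), q (t + R * Complex.I)) -
      Complex.I • (∫ y in (0 : ℝ)..R, q ((x + R : ℝ) + y * Complex.I)) +
      Complex.I • (∫ y in (0 : ℝ)..R, q ((x - R : ℝ) + y * Complex.I)) := by
    linear_combination hrect
  rw [heq]
  refine (norm_add_le _ _).trans ((add_le_add_left (norm_sub_le _ _) _).trans ?_)
  rw [norm_smul, norm_smul, Complex.norm_I, one_mul, one_mul]
  have : 8 * M / R ^ 2 * (2 * R) + 8 * M / R ^ 2 * R + 8 * M / R ^ 2 * R = 32 * M / R := by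
    field_simp
    ring
  linarith

/-- The **Poisson formula** for bounded holomorphic functions on the half-plane. -/
theorem eq_integral_upperPoisson {k : ℂ → ℂ} {δ M : ℝ} (hδ : 0 < δ)
    (hk : DifferentiableOn ℂ k {z | -δ < z.im}) (hM : ∀ z : ℂ, 0 ≤ z.im → ‖k z‖ ≤ M)
    {ε : ℝ} (hε : 0 < ε) (x : ℝ) :
    ∫ t : ℝ, (upperPoisson ε (x - t) : ℂ) * k t = k (x + ε * Complex.I) := by
  have hkc : Continuous fun t : ℝ => k t := by
    refine (hk.continuousOn).comp_continuous Complex.continuous_ofReal fun t => ?_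
    change -δ < ((t : ℂ)).im
    simpa using hδ
  have hP : Integrable fun t => (upperPoisson ε (x - t) : ℂ) := (integrable_upperPoisson hε x).ofReal
  have hPk : Integrable fun t : ℝ => (upperPoisson ε (x - t) : ℂ) * k t :=
    hP.mul_bdd (c := M) hkc.aestronglyMeasurable (.of_forall fun t => hM t (by simp))
  have hpi : (Real.pi : ℂ) ≠ 0 := by exact_mod_cast Real.pi_ne_zero
  have hε' : (ε : ℂ) ≠ 0 := by exact_mod_cast hε.ne'
  have heq : (fun t : ℝ => (k t - k (x + ε * Complex.I)) / (((t - x) ^ 2 + ε ^ 2 : ℝ) : ℂ)) =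
      fun t : ℝ => (Real.pi / ε : ℂ) * ((upperPoisson ε (x - t) : ℂ) * k t -
        (upperPoisson ε (x - t) : ℂ) * k (x + ε * Complex.I)) := by
    funext t
    have : ((t - x : ℂ) ^ 2 + ε ^ 2) ≠ 0 := by
      have : ((t - x) ^ 2 + ε ^ 2 : ℝ) ≠ 0 := by positivity
      exact_mod_cast this
    rw [upperPoisson, ← neg_sub t x, neg_sq]
    push_cast
    field_simp
  have h0 := integral_div_sq_add_sq_eq_zero hδ hk hM hε x (by
    rw [heq]
    exact (hPk.sub (hP.mul_const _)).const_mul _)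
  rw [heq, integral_const_mul, integral_sub hPk (hP.mul_const _), integral_mul_const,
    integral_complex_ofReal, integral_upperPoisson hε, Complex.ofReal_one, one_mul] at h0
  exact sub_eq_zero.1 ((mul_eq_zero.1 h0).resolve_left (div_ne_zero hpi hε'))

/-- Bounded sequences in a Hilbert space have weak cluster points. -/
theorem exists_inner_eq_of_tendsto {V : Type*} [NormedAddCommGroup V] [InnerProductSpace ℂ V]
    [CompleteSpace V] {v : ℕ → V} {M : ℝ} (hv : ∀ n, ‖v n‖ ≤ M) :
    ∃ u : V, ∀ (w : V) (c : ℂ), Tendsto (fun n => ⟪w, v n⟫_ℂ) atTop (𝓝 c) → ⟪w, u⟫_ℂ = c := by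
  let ξ : ℕ → WeakDual ℂ V := fun n => StrongDual.toWeakDual (InnerProductSpace.toDual ℂ V (v n))
  obtain ⟨ξ₀, -, h⟩ := (WeakDual.isCompact_closedBall (𝕜 := ℂ) (E := V) 0 M).ultrafilter_le_nhds
    ((hyperfilter ℕ).map ξ) (by
      rw [Ultrafilter.coe_map, le_principal_iff]
      refine Filter.mem_map.2 (Filter.univ_mem' fun n => ?_)
      change InnerProductSpace.toDual ℂ V (v n) ∈ Metric.closedBall 0 M
      rw [mem_closedBall_zero_iff, LinearIsometryEquiv.norm_map]
      exact hv n)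
  refine ⟨(InnerProductSpace.toDual ℂ V).symm (WeakDual.toStrongDual ξ₀), fun w c hc => ?_⟩
  have h1 : Tendsto (fun n => ⟪v n, w⟫_ℂ) (hyperfilter ℕ : Filter ℕ) (𝓝 (ξ₀ w)) :=
    ((WeakDual.eval_continuous w).tendsto ξ₀).comp h
  have h2 := (hc.mono_left Nat.hyperfilter_le_atTop)
  have h3 : Tendsto (fun n => ⟪w, v n⟫_ℂ) (hyperfilter ℕ : Filter ℕ)
      (𝓝 ((starRingEnd ℂ) (ξ₀ w))) := by
    simpa only [Function.comp_def, inner_conj_symm] using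
      (Complex.continuous_conj.tendsto _).comp h1
  rw [← inner_conj_symm, InnerProductSpace.toDual_symm_apply]
  exact tendsto_nhds_unique h3 h2

end

noncomputable section

/-! ### Boundary values of bounded holomorphic functions -/

/-- The finite measure `(1 + t ^ 2)⁻¹ dt`. -/
def cauchyMeasure : Measure ℝ := volume.withDensity fun t => ENNReal.ofReal (1 + t ^ 2)⁻¹

theorem measurable_ofReal_inv_one_add_sq :
    Measurable fun t : ℝ => ENNReal.ofReal (1 + t ^ 2)⁻¹ := by fun_prop

instance : IsFiniteMeasure cauchyMeasure :=
  isFiniteMeasure_withDensity_ofReal integrable_inv_one_add_sq.2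

theorem integrable_cauchyMeasure_iff (f : ℝ → ℂ) :
    Integrable f cauchyMeasure ↔ Integrable fun t => ((1 + t ^ 2)⁻¹ : ℝ) • f t := by
  rw [cauchyMeasure, integrable_withDensity_iff_integrable_smul' measurable_ofReal_inv_one_add_sq
    (.of_forall fun _ => ENNReal.ofReal_lt_top)]
  simp only [ENNReal.toReal_ofReal (inv_nonneg.2 (add_nonneg zero_le_one (sq_nonneg _)))]

theorem integral_cauchyMeasure (f : ℝ → ℂ) :
    ∫ t, f t ∂cauchyMeasure = ∫ t, ((1 + t ^ 2)⁻¹ : ℝ) • f t := by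
  rw [cauchyMeasure, integral_withDensity_eq_integral_toReal_smul measurable_ofReal_inv_one_add_sq
    (.of_forall fun _ => ENNReal.ofReal_lt_top)]
  simp only [ENNReal.toReal_ofReal (inv_nonneg.2 (add_nonneg zero_le_one (sq_nonneg _)))]

/-- **Fatou's theorem**: a bounded holomorphic function on the upper half-plane has vertical limits
at almost every boundary point. It is the Poisson integral of a weak limit of its restrictions to
horizontal lines. -/
theorem ae_exists_tendsto_of_bounded {h : ℂ → ℂ} {M : ℝ}
    (hh : DifferentiableOn ℂ h {z | 0 < z.im}) (hM : ∀ z : ℂ, 0 < z.im → ‖h z‖ ≤ M) :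
    ∀ᵐ x : ℝ, ∃ c, Tendsto (fun ε : ℝ => h (x + ε * Complex.I)) (𝓝[>] 0) (𝓝 c) := by
  have hopen : IsOpen {z : ℂ | 0 < z.im} := isOpen_lt continuous_const Complex.continuous_im
  let d : ℕ → ℝ := fun n => 1 / ((n : ℝ) + 1)
  have hd : ∀ n, 0 < d n := fun n => Nat.one_div_pos_of_nat
  have hline : ∀ n, Continuous fun t : ℝ => h (t + d n * Complex.I) := fun n =>
    hh.continuousOn.comp_continuous (by fun_prop) fun t => by
      change 0 < ((t : ℂ) + d n * Complex.I).im
      simpa using hd n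
  have hbound : ∀ n, ∀ᵐ t : ℝ ∂cauchyMeasure, ‖h (t + d n * Complex.I)‖ ≤ M := fun n =>
    .of_forall fun t => hM _ (by simpa using hd n)
  have hmem : ∀ n, MemLp (fun t : ℝ => h (t + d n * Complex.I)) 2 cauchyMeasure := fun n =>
    MemLp.of_bound (hline n).aestronglyMeasurable M (hbound n)
  have hM0 : 0 ≤ M := (norm_nonneg _).trans (hM Complex.I (by simp))
  obtain ⟨u, hu⟩ := exists_inner_eq_of_tendsto (v := fun n => (hmem n).toLp)
    (M := cauchyMeasure.real Set.univ ^ (2 : ENNReal).toReal⁻¹ * M) fun n =>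
      Lp.norm_le_of_ae_bound hM0 (by
        filter_upwards [(hmem n).coeFn_toLp, hbound n] with t h1 h2
        rwa [h1])
  have hu1 : Integrable u cauchyMeasure := (Lp.memLp u).integrable one_le_two
  filter_upwards [ae_tendsto_integral_upperPoisson ((integrable_cauchyMeasure_iff _).1 hu1)]
    with x hx
  refine ⟨u x, hx.congr' ?_⟩
  filter_upwards [self_mem_nhdsWithin] with ε hε
  replace hε : 0 < ε := hε
  obtain ⟨C, hC⟩ := exists_upperPoisson_le hε x
  -- the Poisson kernel as an element of `L²`
  let w : ℝ → ℂ := fun t => ((upperPoisson ε (x - t) * (1 + t ^ 2) : ℝ) : ℂ)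
  have hw : MemLp w 2 cauchyMeasure := by
    refine MemLp.of_bound (Continuous.aestronglyMeasurable ?_) C (.of_forall fun t => ?_)
    · exact Complex.continuous_ofReal.comp (((continuous_upperPoisson hε).comp
        (continuous_const.sub continuous_id)).mul (by fun_prop))
    · have : (0 : ℝ) < 1 + t ^ 2 := by positivity
      rw [Complex.norm_real, Real.norm_eq_abs, abs_mul, abs_of_pos this, ← le_div_iff₀ this]
      exact hC t
  have hinner : ∀ f : Lp ℂ 2 cauchyMeasure,
      ⟪hw.toLp, f⟫_ℂ = ∫ t, (upperPoisson ε (x - t) : ℂ) * f t := fun f => by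
    rw [L2.inner_def]
    trans ∫ t, w t * f t ∂cauchyMeasure
    · refine integral_congr_ae ?_
      filter_upwards [hw.coeFn_toLp] with t ht
      rw [ht, RCLike.inner_apply, Complex.conj_ofReal, mul_comm]
    · rw [integral_cauchyMeasure]
      refine integral_congr_ae (.of_forall fun t => ?_)
      have : (1 + (t : ℂ) ^ 2) ≠ 0 := by
        have : (1 + t ^ 2 : ℝ) ≠ 0 := by positivity
        exact_mod_cast this
      simp only [w, Complex.real_smul]
      push_cast
      field_simp
  rw [← hinner]
  refine hu _ _ ?_
  have hval : ∀ n, ⟪hw.toLp, (hmem n).toLp⟫_ℂ = h (x + ε * Complex.I + d n * Complex.I) :=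
    fun n => by
      have hshift : DifferentiableOn ℂ (fun z => h (z + d n * Complex.I)) {z | -d n < z.im} := by
        refine hh.comp (by fun_prop) fun z hz => ?_
        change 0 < (z + d n * Complex.I).im
        have hz' : -d n < z.im := hz
        simp
        linarith
      rw [← eq_integral_upperPoisson (hd n) hshift (fun z hz => hM _ (by
        have := hd n
        simp
        linarith)) hε x, hinner]
      have hac : volume ≪ cauchyMeasure :=
        withDensity_absolutelyContinuous' measurable_ofReal_inv_one_add_sq.aemeasurable
          (.of_forall fun t => by
            rw [Ne, ENNReal.ofReal_eq_zero, not_le]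
            positivity)
      refine integral_congr_ae ?_
      filter_upwards [hac.ae_le (hmem n).coeFn_toLp] with t ht
      rw [ht]
  simp only [hval]
  have hz : (0 : ℝ) < ((x : ℂ) + ε * Complex.I).im := by simpa using hε
  have hcont : Tendsto h (𝓝 (x + ε * Complex.I)) (𝓝 (h (x + ε * Complex.I))) :=
    (hh.continuousOn.continuousAt (hopen.mem_nhds hz)).tendsto
  refine hcont.comp ?_
  have h0 : Tendsto (fun n => (d n : ℂ)) atTop (𝓝 0) := by
    have := (Complex.continuous_ofReal.tendsto 0).comp tendsto_one_div_add_atTop_nhds_zero_nat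
    simpa [Function.comp_def, d] using this
  simpa using (h0.mul_const Complex.I).const_add ((x : ℂ) + ε * Complex.I)

/-- A continuous path converges if its exponential converges to a nonzero limit, because it differs
from a convergent logarithm of the exponential by a locally constant function. -/
theorem exists_tendsto_of_tendsto_exp {f : ℝ → ℂ} (hf : ContinuousOn f (Set.Ioi 0)) {c : ℂ}
    (hc : c ≠ 0) (h : Tendsto (fun ε => Complex.exp (f ε)) (𝓝[>] 0) (𝓝 c)) :
    ∃ a, Tendsto f (𝓝[>] 0) (𝓝 a) := by
  set b := Complex.log c
  have hb : Complex.exp b = c := Complex.exp_log hc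
  have h1 : Tendsto (fun ε => Complex.exp (f ε - b)) (𝓝[>] 0) (𝓝 1) := by
    simp only [Complex.exp_sub, hb]
    simpa [hc] using h.div_const c
  have hslit : ∀ᶠ ε in 𝓝[>] (0 : ℝ), Complex.exp (f ε - b) ∈ Complex.slitPlane :=
    h1.eventually_mem (Complex.isOpen_slitPlane.mem_nhds Complex.one_mem_slitPlane)
  obtain ⟨δ, hδ, hδ'⟩ := mem_nhdsGT_iff_exists_Ioo_subset.1 hslit
  replace hδ : 0 < δ := hδ
  have hlog : Tendsto (fun ε => Complex.log (Complex.exp (f ε - b))) (𝓝[>] 0) (𝓝 0) := by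
    simpa using h1.clog Complex.one_mem_slitPlane
  -- the difference is continuous with values in a discrete subgroup
  let m : ℝ → ℝ := fun ε =>
    (f ε - b - Complex.log (Complex.exp (f ε - b))).im / (2 * Real.pi)
  have hint : ∀ ε, ∃ n : ℤ, f ε - b - Complex.log (Complex.exp (f ε - b)) =
      n * (2 * Real.pi * Complex.I) := fun ε => by
    obtain ⟨n, hn⟩ := Complex.exp_eq_exp_iff_exists_int.1
      (Complex.exp_log (Complex.exp_ne_zero (f ε - b))).symm
    exact ⟨n, by rw [sub_eq_iff_eq_add']; exact hn⟩
  have hm : ∀ ε, f ε - b - Complex.log (Complex.exp (f ε - b)) =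
      m ε * (2 * Real.pi * Complex.I) ∧ m ε ∈ Set.range ((↑) : ℤ → ℝ) := fun ε => by
    obtain ⟨n, hn⟩ := hint ε
    have : m ε = n := by
      simp only [m, hn]
      simp
    rw [this]
    exact ⟨by rw [hn]; simp, n, rfl⟩
  have hmc : ContinuousOn m (Set.Ioo 0 δ) := by
    have hf' := hf.mono (Set.Ioo_subset_Ioi_self : Set.Ioo 0 δ ⊆ _)
    have he : ContinuousOn (fun ε => Complex.exp (f ε - b)) (Set.Ioo 0 δ) :=
      (hf'.sub continuousOn_const).cexp
    exact (Complex.continuous_im.comp_continuousOn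
      ((hf'.sub continuousOn_const).sub (he.clog fun ε hε => hδ' hε))).div_const _
  obtain ⟨y, -, hy⟩ := isPreconnected_Ioo.eqOn_const_of_mapsTo
    (Int.isClosedEmbedding_coe_real.isEmbedding.isDiscrete_range) hmc
    (fun ε _ => (hm ε).2) ⟨0, 0, by simp⟩
  refine ⟨b + y * (2 * Real.pi * Complex.I), ?_⟩
  have hlim : Tendsto (fun ε => Complex.log (Complex.exp (f ε - b)) +
      (b + y * (2 * Real.pi * Complex.I))) (𝓝[>] 0) (𝓝 (b + y * (2 * Real.pi * Complex.I))) := by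
    simpa using hlog.add_const (b + y * (2 * Real.pi * Complex.I))
  refine hlim.congr' ?_
  filter_upwards [Ioo_mem_nhdsGT hδ] with ε hε
  have h2 := (hm ε).1
  rw [hy hε, Function.const_apply] at h2
  linear_combination -h2

/-! ### Boundary values of Cauchy transforms -/

variable {μ : Measure ℝ} [IsFiniteMeasure μ]

theorem differentiableOn_integral_cauchyKernel :
    DifferentiableOn ℂ (fun z => ∫ t, cauchyKernel z t ∂μ) {z | 0 < z.im} := by
  intro z hz
  have hz' : z ∉ algebraMap ℝ ℂ '' μ.support := by
    rintro ⟨t, -, rfl⟩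
    simp at hz
  have := (hasDerivAt_resolventTransform z hz').differentiableAt.differentiableWithinAt
    (s := {z | 0 < z.im})
  have heq : (fun z => ∫ t, cauchyKernel z t ∂μ) = resolventTransform μ := by
    funext w
    rw [resolventTransform_apply]
    exact integral_congr_ae (.of_forall fun t => by simp [resolvent, cauchyKernel])
  rwa [heq]

/-- The imaginary part of the Cauchy kernel is `π` times the Poisson kernel. -/
theorem im_cauchyKernel {ε : ℝ} (hε : 0 < ε) (x t : ℝ) :
    (cauchyKernel (x + ε * Complex.I) t).im = Real.pi * upperPoisson ε (x - t) := by
  have := Real.pi_pos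
  rw [cauchyKernel, upperPoisson, Complex.inv_im, Complex.normSq_apply]
  simp
  field_simp
  ring

theorem im_integral_cauchyKernel (hμ : μ ≪ volume) {ε : ℝ} (hε : 0 < ε) (x : ℝ) :
    (∫ t, cauchyKernel (x + ε * Complex.I) t ∂μ).im =
      Real.pi * (∫ t, (upperPoisson ε (x - t) : ℂ) * ((μ.rnDeriv volume t).toReal : ℂ)).re := by
  have him : ((x : ℂ) + ε * Complex.I).im ≠ 0 := by simpa using hε.ne'
  have h1 := ((isBoundedBorel_cauchyKernel him).integrable μ)
  rw [← RCLike.im_eq_complex_im, ← integral_im h1]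
  simp only [RCLike.im_eq_complex_im, im_cauchyKernel hε]
  rw [integral_const_mul, ← integral_rnDeriv_smul hμ]
  simp only [← Complex.ofReal_mul]
  rw [integral_complex_ofReal, Complex.ofReal_re]
  simp only [smul_eq_mul, mul_comm]

theorem ae_tendsto_im_integral_cauchyKernel (hμ : μ ≪ volume) :
    ∀ᵐ x : ℝ, Tendsto (fun ε : ℝ => (∫ t, cauchyKernel (x + ε * Complex.I) t ∂μ).im) (𝓝[>] 0)
      (𝓝 (Real.pi * (μ.rnDeriv volume x).toReal)) := by
  have hg : Integrable fun t => ((1 + t ^ 2)⁻¹ : ℝ) • ((μ.rnDeriv volume t).toReal : ℂ) := by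
    have h0 : Integrable fun t => ((μ.rnDeriv volume t).toReal : ℂ) :=
      Measure.integrable_toReal_rnDeriv.ofReal
    refine h0.bdd_smul (φ := fun t : ℝ => (1 + t ^ 2)⁻¹) 1
      (Measurable.aestronglyMeasurable (by fun_prop)) (.of_forall fun t => ?_)
    rw [Real.norm_of_nonneg (by positivity)]
    exact inv_le_one_of_one_le₀ (by nlinarith [sq_nonneg t])
  filter_upwards [ae_tendsto_integral_upperPoisson hg] with x hx
  have h1 := ((Complex.continuous_re.tendsto _).comp hx).const_mul Real.pi
  refine h1.congr' ?_
  filter_upwards [self_mem_nhdsWithin] with ε hε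
  exact (im_integral_cauchyKernel hμ hε x).symm

omit [IsFiniteMeasure μ] in
theorem integral_cauchyKernel_conj (z : ℂ) :
    ∫ t, cauchyKernel ((starRingEnd ℂ) z) t ∂μ = (starRingEnd ℂ) (∫ t, cauchyKernel z t ∂μ) := by
  rw [← integral_conj]
  refine integral_congr_ae (.of_forall fun t => ?_)
  simp [cauchyKernel]

/-- The Cauchy transform `F` of a finite absolutely continuous measure has boundary values, and
their jump is the density: `exp (i F)` is a bounded holomorphic function, whose boundary values do
not vanish because `Im F` stays finite at almost every boundary point. -/
theorem ae_exists_tendsto_integral_cauchyKernel (hμ : μ ≪ volume) :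
    ∀ᵐ x : ℝ, ∃ r : ℂ × ℂ,
      Tendsto (fun ε : ℝ => ∫ t, cauchyKernel (x + Complex.I * ε) t ∂μ) (𝓝[>] 0) (𝓝 r.1) ∧
      Tendsto (fun ε : ℝ => ∫ t, cauchyKernel (x - Complex.I * ε) t ∂μ) (𝓝[>] 0) (𝓝 r.2) ∧
      r.1 - r.2 = 2 * Real.pi * Complex.I * (μ.rnDeriv volume x).toReal := by
  set F : ℂ → ℂ := fun z => ∫ t, cauchyKernel z t ∂μ with hF
  have hFd : DifferentiableOn ℂ F {z | 0 < z.im} := differentiableOn_integral_cauchyKernel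
  have hexp : DifferentiableOn ℂ (fun z => Complex.exp (Complex.I * F z)) {z | 0 < z.im} :=
    (hFd.const_mul _).cexp
  have hbd : ∀ z : ℂ, 0 < z.im → ‖Complex.exp (Complex.I * F z)‖ ≤ 1 := fun z hz => by
    have h1 : 0 ≤ (F z).im := by
      have h2 := (isBoundedBorel_cauchyKernel hz.ne').integrable μ
      rw [hF, ← RCLike.im_eq_complex_im, ← integral_im h2]
      refine integral_nonneg fun t => ?_
      have h3 := im_cauchyKernel hz z.re t
      rw [Complex.re_add_im] at h3
      change 0 ≤ (cauchyKernel z t).im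
      rw [h3]
      exact mul_nonneg Real.pi_pos.le (upperPoisson_nonneg hz _)
    rw [Complex.norm_exp, Real.exp_le_one_iff]
    simpa using h1
  filter_upwards [ae_exists_tendsto_of_bounded hexp hbd, ae_tendsto_im_integral_cauchyKernel hμ]
    with x ⟨c, hc⟩ him
  have hc0 : c ≠ 0 := by
    have h1 : Tendsto (fun ε : ℝ => Real.exp (-(F (x + ε * Complex.I)).im)) (𝓝[>] 0)
        (𝓝 (Real.exp (-(Real.pi * (μ.rnDeriv volume x).toReal)))) :=
      (Real.continuous_exp.tendsto _).comp him.neg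
    have h2 := tendsto_nhds_unique (hc.norm.congr fun ε => by
      rw [Complex.norm_exp]
      simp) h1
    rw [← norm_pos_iff, h2]
    exact Real.exp_pos _
  have hcont : ContinuousOn (fun ε : ℝ => Complex.I * F (x + ε * Complex.I)) (Set.Ioi 0) :=
    continuousOn_const.mul (hFd.continuousOn.comp (by fun_prop) fun ε hε => by
      change 0 < ((x : ℂ) + ε * Complex.I).im
      simpa using hε)
  obtain ⟨a, ha⟩ := exists_tendsto_of_tendsto_exp hcont hc0 hc
  have hlim : Tendsto (fun ε : ℝ => F (x + Complex.I * ε)) (𝓝[>] 0) (𝓝 (-Complex.I * a)) := by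
    refine (ha.const_mul (-Complex.I)).congr fun ε => ?_
    rw [mul_comm Complex.I (ε : ℂ), ← mul_assoc, neg_mul, Complex.I_mul_I, neg_neg, one_mul]
  refine ⟨(-Complex.I * a, (starRingEnd ℂ) (-Complex.I * a)), hlim, ?_, ?_⟩
  · refine ((Complex.continuous_conj.tendsto _).comp hlim).congr fun ε => ?_
    rw [Function.comp_apply, hF, ← integral_cauchyKernel_conj]
    congr 2
    funext t
    congr 1
    simp [sub_eq_add_neg]
  · have h1 : (-Complex.I * a).im = Real.pi * (μ.rnDeriv volume x).toReal :=
      tendsto_nhds_unique ((Complex.continuous_im.tendsto _).comp hlim)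
        (him.congr fun ε => by simp [hF, mul_comm])
    rw [Complex.sub_conj, h1]
    push_cast
    ring

end

noncomputable section

theorem IsBoundedBorel.integrable_mul {f g : ℝ → ℂ} (hf : IsBoundedBorel f) (hg : Integrable g) :
    Integrable fun t => f t * g t := by
  obtain ⟨C, hC⟩ := hf.2
  exact hg.bdd_mul hf.1.aestronglyMeasurable (.of_forall hC)

/-- The Cauchy transform of the integrable function `g` has boundary values almost everywhere from
above (`r.1`) and from below (`r.2`), with jump `2 π i g`. -/
def HasCauchyJump (g : ℝ → ℂ) : Prop :=
  ∀ᵐ x : ℝ, ∃ r : ℂ × ℂ,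
    Tendsto (fun ε : ℝ => ∫ t, cauchyKernel (x + Complex.I * ε) t * g t) (𝓝[>] 0) (𝓝 r.1) ∧
    Tendsto (fun ε : ℝ => ∫ t, cauchyKernel (x - Complex.I * ε) t * g t) (𝓝[>] 0) (𝓝 r.2) ∧
    r.1 - r.2 = 2 * Real.pi * Complex.I * g x

theorem HasCauchyJump.const_mul {g : ℝ → ℂ} (hg : HasCauchyJump g) (c : ℂ) :
    HasCauchyJump fun t => c * g t := by
  filter_upwards [hg] with x ⟨r, h1, h2, h3⟩
  simp only [mul_left_comm _ c, integral_const_mul]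
  exact ⟨(c * r.1, c * r.2), h1.const_mul c, h2.const_mul c, by linear_combination c * h3⟩

theorem HasCauchyJump.add {g g' : ℝ → ℂ} (hg : HasCauchyJump g) (hg' : HasCauchyJump g')
    (hi : Integrable g) (hi' : Integrable g') : HasCauchyJump fun t => g t + g' t := by
  have hadd : ∀ z : ℂ, z.im ≠ 0 → ∫ t, cauchyKernel z t * (g t + g' t) =
      (∫ t, cauchyKernel z t * g t) + ∫ t, cauchyKernel z t * g' t := fun z hz => by
    simp only [mul_add]
    exact integral_add ((isBoundedBorel_cauchyKernel hz).integrable_mul hi)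
      ((isBoundedBorel_cauchyKernel hz).integrable_mul hi')
  filter_upwards [hg, hg'] with x ⟨r, h1, h2, h3⟩ ⟨r', h1', h2', h3'⟩
  refine ⟨(r.1 + r'.1, r.2 + r'.2), (h1.add h1').congr' ?_, (h2.add h2').congr' ?_,
    by linear_combination h3 + h3'⟩
  · filter_upwards [self_mem_nhdsWithin] with ε hε
    exact (hadd _ (by simpa using (ne_of_gt hε : ε ≠ 0))).symm
  · filter_upwards [self_mem_nhdsWithin] with ε hε
    exact (hadd _ (by simpa using (ne_of_gt hε : ε ≠ 0))).symm

/-- A nonnegative integrable function is the density of a finite measure. -/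
theorem hasCauchyJump_of_nonneg {f : ℝ → ℝ} (hf : Integrable f) (h0 : ∀ t, 0 ≤ f t) :
    HasCauchyJump fun t => (f t : ℂ) := by
  have hm : AEMeasurable fun t => ENNReal.ofReal (f t) := hf.aemeasurable.ennreal_ofReal
  have : IsFiniteMeasure (volume.withDensity fun t => ENNReal.ofReal (f t)) :=
    isFiniteMeasure_withDensity_ofReal hf.2
  have hint : ∀ h : ℝ → ℂ, ∫ t, h t ∂(volume.withDensity fun t => ENNReal.ofReal (f t)) =
      ∫ t, h t * (f t : ℂ) := fun h => by
    rw [integral_withDensity_eq_integral_toReal_smul₀ hm (.of_forall fun _ => ENNReal.ofReal_lt_top)]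
    simp only [ENNReal.toReal_ofReal (h0 _), Complex.real_smul, mul_comm]
  filter_upwards [ae_exists_tendsto_integral_cauchyKernel
    (withDensity_absolutelyContinuous volume fun t => ENNReal.ofReal (f t)),
    Measure.rnDeriv_withDensity₀ volume hm] with x ⟨r, h1, h2, h3⟩ hx
  refine ⟨r, ?_, ?_, ?_⟩
  · simpa only [hint] using h1
  · simpa only [hint] using h2
  · rwa [hx, ENNReal.toReal_ofReal (h0 _)] at h3

/-- The **Sokhotski–Plemelj jump formula** for integrable functions. -/
theorem hasCauchyJump_of_integrable {g : ℝ → ℂ} (hg : Integrable g) : HasCauchyJump g := by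
  have hreal : ∀ {f : ℝ → ℝ}, Integrable f → HasCauchyJump fun t => (f t : ℂ) := fun {f} hf => by
    have h1 := (hasCauchyJump_of_nonneg hf.pos_part fun t => le_max_right _ _).add
      ((hasCauchyJump_of_nonneg hf.neg_part fun t => le_max_right _ _).const_mul (-1))
      hf.pos_part.ofReal (hf.neg_part.ofReal.const_mul (-1))
    convert h1 using 2 with t
    have h2 : f t = max (f t) 0 + -1 * max (-(f t)) 0 := by
      rcases le_total (f t) 0 with h | h
      · rw [max_eq_right h, max_eq_left (neg_nonneg.2 h)]
        ring
      · rw [max_eq_left h, max_eq_right (neg_nonpos.2 h)]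
        ring
    exact_mod_cast h2
  have h3 := (hreal hg.re).add ((hreal hg.im).const_mul Complex.I) hg.re.ofReal
    (hg.im.ofReal.const_mul Complex.I)
  convert h3 using 2 with t
  rw [mul_comm Complex.I]
  exact (Complex.re_add_im _).symm

theorem ae_hasDerivAt_setIntegral_Iic {g : ℝ → ℂ} (hg : Integrable g) :
    ∀ᵐ x : ℝ, HasDerivAt (fun y => ∫ t in Set.Iic y, g t) (g x) x := by
  filter_upwards [LocallyIntegrable.ae_hasDerivAt_integral hg.locallyIntegrable] with x hx
  have h1 : (fun y => ∫ t in Set.Iic y, g t) = fun y =>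
      (∫ t in Set.Iic 0, g t) + ∫ t in (0 : ℝ)..y, g t := by
    funext y
    rw [← intervalIntegral.integral_Iic_sub_Iic hg.integrableOn hg.integrableOn]
    ring
  rw [h1]
  exact (hx 0).const_add _

/-! ### The absolutely continuous subspace -/

namespace ProjectionValuedMeasure

variable {𝓗 : Type*} [NormedAddCommGroup 𝓗] [InnerProductSpace ℂ 𝓗] [CompleteSpace 𝓗]
  (E : ProjectionValuedMeasure 𝓗)

/-- The complex measure `B ↦ ⟪φ, E(B) ψ⟫`. -/
def complexMeasure (φ ψ : 𝓗) : ComplexMeasure ℝ where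
  measureOf' B := ⟪φ, E B ψ⟫_ℂ
  empty' := by simp [E.empty_apply]
  not_measurable' B hB := by simp [E.not_measurable B hB]
  m_iUnion' B hB hd := (E.hasSum_iUnion B hB hd ψ).mapL (innerSL ℂ φ)

variable {E}

/-- The Radon–Nikodym theorem for `B ↦ ⟪φ, E(B) ψ⟫`, which vanishes on Lebesgue null sets because
`‖E(B) ψ‖ ^ 2` does. -/
theorem exists_density {ψ : 𝓗} (hψ : ψ ∈ E.acSubspace) (φ : 𝓗) :
    ∃ g : ℝ → ℂ, Integrable g ∧
      ∀ B : Set ℝ, MeasurableSet B → ⟪φ, E B ψ⟫_ℂ = ∫ l in B, g l := by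
  set c := E.complexMeasure φ ψ with hc
  have hac : c ≪ᵥ volume.toENNRealVectorMeasure := by
    refine VectorMeasure.AbsolutelyContinuous.mk fun B hB h0 => ?_
    rw [Measure.toENNRealVectorMeasure_apply_measurable hB] at h0
    have h1 : E.scalarMeasure ψ B = 0 := hψ h0
    rw [scalarMeasure_apply _ hB, ENNReal.ofReal_eq_zero] at h1
    have h2 : E B ψ = 0 := by
      rw [← norm_eq_zero]
      exact pow_eq_zero_iff two_ne_zero |>.1 (le_antisymm h1 (sq_nonneg _))
    change ⟪φ, E B ψ⟫_ℂ = 0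
    rw [h2, inner_zero_right]
  obtain ⟨hre, him⟩ := (ComplexMeasure.absolutelyContinuous_ennreal_iff c _).1 hac
  have hg := ComplexMeasure.integrable_rnDeriv c volume
  refine ⟨c.rnDeriv volume, hg, fun B hB => ?_⟩
  have h1 := SignedMeasure.withDensityᵥ_rnDeriv_eq _ _ hre
  have h2 := SignedMeasure.withDensityᵥ_rnDeriv_eq _ _ him
  apply Complex.ext
  · rw [← RCLike.re_eq_complex_re, ← integral_re hg.integrableOn]
    change c.re B = _
    rw [← h1, withDensityᵥ_apply (SignedMeasure.integrable_rnDeriv _ _) hB]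
    rfl
  · rw [← RCLike.im_eq_complex_im, ← integral_im hg.integrableOn]
    change c.im B = _
    rw [← h2, withDensityᵥ_apply (SignedMeasure.integrable_rnDeriv _ _) hB]
    rfl

/-- A density for the values `⟪φ, E(B) ψ⟫` is a density for the whole calculus. -/
theorem inner_bcalc_eq_integral {φ ψ : 𝓗} {g : ℝ → ℂ} (hg : Integrable g)
    (h : ∀ B : Set ℝ, MeasurableSet B → ⟪φ, E B ψ⟫_ℂ = ∫ l in B, g l) {f : ℝ → ℂ}
    (hf : IsBoundedBorel f) : ⟪φ, E.bcalc f ψ⟫_ℂ = ∫ l, f l * g l := by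
  have hsimple : ∀ s : SimpleFunc ℝ ℂ,
      IsBoundedBorel s ∧ ⟪φ, E.bcalc s ψ⟫_ℂ = ∫ l, s l * g l := fun s => by
    classical
    refine SimpleFunc.induction (motive := fun s => IsBoundedBorel s ∧
      ⟪φ, E.bcalc s ψ⟫_ℂ = ∫ l, s l * g l) (fun c B hB => ?_) (fun s t _ hs ht => ?_) s
    · rw [SimpleFunc.coe_piecewise, SimpleFunc.coe_const, SimpleFunc.coe_const,
        Function.const_zero, Set.piecewise_eq_indicator]
      refine ⟨(IsBoundedBorel.const c).indicator hB, ?_⟩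
      have h1 : (fun l => B.indicator (Function.const ℝ c) l * g l) =
          B.indicator fun l => c * g l := by
        funext l
        by_cases hl : l ∈ B <;> simp [hl]
      rw [h1, integral_indicator hB, integral_const_mul, ← h B hB]
      have h2 := E.bcalc_indicator hB c
      change E.bcalc (B.indicator (Function.const ℝ c)) = _ at h2
      rw [h2, smul_apply, inner_smul_right]
    · rw [SimpleFunc.coe_add]
      refine ⟨hs.1.add ht.1, ?_⟩
      change ⟪φ, E.bcalc (fun x => s x + t x) ψ⟫_ℂ = _
      rw [bcalc_add hs.1 ht.1, add_apply, inner_add_right, hs.2, ht.2,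
        ← integral_add (hs.1.integrable_mul hg) (ht.1.integrable_mul hg)]
      simp only [Pi.add_apply, add_mul]
  obtain ⟨C, hC⟩ := hf.2
  have hC0 : 0 ≤ C := (norm_nonneg _).trans (hC 0)
  have hsm := hf.1.stronglyMeasurable
  have hlim : ∀ x, Tendsto (fun n => hsm.approxBounded C n x) atTop (𝓝 (f x)) := fun x =>
    hsm.tendsto_approxBounded_of_norm_le (hC x)
  have h1 : Tendsto (fun n => ⟪φ, E.bcalc (hsm.approxBounded C n) ψ⟫_ℂ) atTop
      (𝓝 ⟪φ, E.bcalc f ψ⟫_ℂ) :=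
    tendsto_const_nhds.inner (tendsto_bcalc (fun n => (hsimple _).1.measurable)
      (fun n x => hsm.norm_approxBounded_le hC0 n x) hf ψ (.of_forall hlim))
  have h2 : Tendsto (fun n => ∫ l, hsm.approxBounded C n l * g l) atTop (𝓝 (∫ l, f l * g l)) := by
    refine tendsto_integral_of_dominated_convergence (fun l => C * ‖g l‖)
      (fun n => ((hsimple _).1.integrable_mul hg).aestronglyMeasurable) (hg.norm.const_mul C)
      (fun n => .of_forall fun l => ?_) (.of_forall fun l => (hlim l).mul_const _)
    rw [norm_mul]
    gcongr
    exact hsm.norm_approxBounded_le hC0 n l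
  refine tendsto_nhds_unique h1 (h2.congr fun n => ((hsimple _).2).symm)

/-- A vector of the absolutely continuous subspace has a spectral density against any other vector,
and the density is the jump of the matrix element of the resolvent across the real line. -/
theorem exists_density_boundaryValues {ψ : 𝓗} (hψ : ψ ∈ E.acSubspace) (φ : 𝓗) :
    ∃ g rp rm : ℝ → ℂ, Integrable g ∧
      (∀ f : ℝ → ℂ, IsBoundedBorel f → ⟪φ, E.bcalc f ψ⟫_ℂ = ∫ l, f l * g l) ∧
      (∀ B : Set ℝ, MeasurableSet B → ⟪φ, E B ψ⟫_ℂ = ∫ l in B, g l) ∧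
      (∀ᵐ l : ℝ, HasDerivAt (fun x : ℝ => ⟪φ, E (Set.Iic x) ψ⟫_ℂ) (g l) l) ∧
      (∀ᵐ l : ℝ, Tendsto (fun ε : ℝ =>
        ⟪φ, E.bcalc (cauchyKernel (l + Complex.I * ε)) ψ⟫_ℂ) (𝓝[>] 0) (𝓝 (rp l))) ∧
      (∀ᵐ l : ℝ, Tendsto (fun ε : ℝ =>
        ⟪φ, E.bcalc (cauchyKernel (l - Complex.I * ε)) ψ⟫_ℂ) (𝓝[>] 0) (𝓝 (rm l))) ∧
      (∀ᵐ l : ℝ, rp l - rm l = 2 * Real.pi * Complex.I * g l) := by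
  obtain ⟨g, hg, hB⟩ := exists_density hψ φ
  have hcalc : ∀ f : ℝ → ℂ, IsBoundedBorel f → ⟪φ, E.bcalc f ψ⟫_ℂ = ∫ l, f l * g l :=
    fun f hf => inner_bcalc_eq_integral hg hB hf
  obtain ⟨r, hr⟩ := (hasCauchyJump_of_integrable hg).choice
  refine ⟨g, fun l => (r l).1, fun l => (r l).2, hg, hcalc, hB, ?_, ?_, ?_, ?_⟩
  · simpa only [hB _ measurableSet_Iic] using ae_hasDerivAt_setIntegral_Iic hg
  · filter_upwards [hr] with l hl
    refine hl.1.congr' ?_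
    filter_upwards [self_mem_nhdsWithin] with ε hε
    exact (hcalc _ (isBoundedBorel_cauchyKernel (by simpa using (ne_of_gt hε : ε ≠ 0)))).symm
  · filter_upwards [hr] with l hl
    refine hl.2.1.congr' ?_
    filter_upwards [self_mem_nhdsWithin] with ε hε
    exact (hcalc _ (isBoundedBorel_cauchyKernel (by simpa using (ne_of_gt hε : ε ≠ 0)))).symm
  · filter_upwards [hr] with l hl
    exact hl.2.2

end ProjectionValuedMeasure

end

theorem theorem2 {𝓗 : Type*} [NormedAddCommGroup 𝓗] [InnerProductSpace ℂ 𝓗] [CompleteSpace 𝓗]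
    (H : 𝓗 →ₗ.[ℂ] 𝓗) (hH : IsSelfAdjoint H) :
    -- the stationary objects `E` and `R(z)` and the time-dependent object `exp (-i t H)`
    -- belonging to `H` exist and are unique
    (∃! E : ProjectionValuedMeasure 𝓗, E.IsSpectralMeasureOf H) ∧
    (∃! U : UnitaryGroup 𝓗, U.IsGeneratedBy H) ∧
    (∀ z : ℂ, z.im ≠ 0 → ∃! R : 𝓗 →L[ℂ] 𝓗, IsResolventAt H z R) ∧
    ∀ (E : ProjectionValuedMeasure 𝓗) (U : UnitaryGroup 𝓗) (R : ℂ → 𝓗 →L[ℂ] 𝓗),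
      E.IsSpectralMeasureOf H → U.IsGeneratedBy H →
      (∀ z : ℂ, z.im ≠ 0 → IsResolventAt H z (R z)) →
      -- `U t ψ` solves the time-dependent Schrödinger equation
      (∀ ψ ∈ H.domain, ∀ t : ℝ, ∃ h : U t ψ ∈ H.domain,
        HasDerivAt (fun s : ℝ => U s ψ) (-(Complex.I • H ⟨U t ψ, h⟩)) t) ∧
      -- `E {l}` is the projection onto the eigenspace of `H` for `l`
      (∀ (l : ℝ) (ψ : 𝓗), ψ ∈ (E {l}).range ↔
        ∃ h : ψ ∈ H.domain, H ⟨ψ, h⟩ = (l : ℂ) • ψ) ∧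
      -- point spectrum, from stationary to time-dependent
      (∀ ψ ∈ E.pointSubspace, ∀ t : ℝ,
        HasSum (fun l : ℝ => Complex.exp (-(Complex.I * t * l)) • E {l} ψ) (U t ψ)) ∧
      -- point spectrum, from time-dependent to stationary: mean ergodic limits
      (∀ (l : ℝ) (ψ : 𝓗),
        Tendsto
          (fun p : ℝ × ℝ => (p.2 - p.1)⁻¹ •
            ∫ t in p.1..p.2, Complex.exp (-(Complex.I * t * l)) • U (-t) ψ)
          (comap (fun p : ℝ × ℝ => p.2 - p.1) atTop) (𝓝 (E {l} ψ))) ∧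
      -- the unitary group is the Fourier transform of the spectral measure
      (∀ (ψ : 𝓗) (t : ℝ), ⟪ψ, U t ψ⟫_ℂ =
        ∫ l : ℝ, Complex.exp (-(Complex.I * t * l)) ∂(E.scalarMeasure ψ)) ∧
      -- absolutely continuous subspace: `g` is the density `d⟪φ, E(l) ψ⟫/dl`, and `rp`, `rm`
      -- are the boundary values `⟪φ, R(l ± i0) ψ⟫`
      (∀ ψ ∈ E.acSubspace, ∀ φ : 𝓗, ∃ g rp rm : ℝ → ℂ,
        Integrable g ∧
        (∀ B : Set ℝ, MeasurableSet B → ⟪φ, E B ψ⟫_ℂ = ∫ l in B, g l) ∧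
        (∀ᵐ l : ℝ, HasDerivAt (fun x : ℝ => ⟪φ, E (Set.Iic x) ψ⟫_ℂ) (g l) l) ∧
        (∀ᵐ l : ℝ, Tendsto (fun ε : ℝ => ⟪φ, R (l + Complex.I * ε) ψ⟫_ℂ) (𝓝[>] 0) (𝓝 (rp l))) ∧
        (∀ᵐ l : ℝ, Tendsto (fun ε : ℝ => ⟪φ, R (l - Complex.I * ε) ψ⟫_ℂ) (𝓝[>] 0) (𝓝 (rm l))) ∧
        (∀ᵐ l : ℝ, g l = (2 * Real.pi * Complex.I)⁻¹ * (rp l - rm l)) ∧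
        (∀ t : ℝ,
          ⟪φ, U t ψ⟫_ℂ = ∫ l : ℝ, Complex.exp (-(Complex.I * t * l)) * g l) ∧
        (∀ t : ℝ,
          ⟪φ, U t ψ⟫_ℂ = (2 * Real.pi * Complex.I)⁻¹ *
            ∫ l : ℝ, Complex.exp (-(Complex.I * t * l)) * (rp l - rm l))) ∧
      -- the resolvent is the Fourier-Laplace transform of the unitary group
      (∀ (z : ℂ) (ψ : 𝓗), 0 < z.im →
        IntegrableOn (fun t : ℝ => Complex.exp (Complex.I * t * z) • U t ψ) (Set.Ioi 0) ∧
        R z ψ = Complex.I •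
          ∫ t in Set.Ioi (0 : ℝ), Complex.exp (Complex.I * t * z) • U t ψ) ∧
      (∀ (z : ℂ) (ψ : 𝓗), z.im < 0 →
        IntegrableOn (fun t : ℝ => Complex.exp (Complex.I * t * z) • U t ψ) (Set.Iio 0) ∧
        R z ψ = -(Complex.I •
          ∫ t in Set.Iio (0 : ℝ), Complex.exp (Complex.I * t * z) • U t ψ)) ∧
      -- if there is no singular continuous spectrum, the two subspaces exhaust the space
      (E.continuousSubspace = E.acSubspace →
        ∀ ψ : 𝓗, ∃ ψp ∈ E.pointSubspace, ∃ ψac ∈ E.acSubspace,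
          ψ = ψp + ψac ∧ ⟪ψp, ψac⟫_ℂ = 0) := by
  refine ⟨?_, ?_, ?_, ?_⟩
  · obtain ⟨E, hE⟩ := ProjectionValuedMeasure.exists_isSpectralMeasureOf hH
    exact ⟨E, hE, fun F hF => hF.unique hE hH⟩
  · obtain ⟨E, hE⟩ := ProjectionValuedMeasure.exists_isSpectralMeasureOf hH
    exact ⟨E.unitaryGroup, hE.isGeneratedBy hH, fun V hV => hV.unique hH (hE.isGeneratedBy hH)⟩
  · intro z hz
    obtain ⟨R, hR⟩ := hH.exists_isResolventAt hz
    exact ⟨R, hR, fun S hS => hS.unique hR⟩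
  intro E U R hE hU hR
  obtain rfl : U = E.unitaryGroup := hU.unique hH (hE.isGeneratedBy hH)
  have hRE : ∀ z : ℂ, z.im ≠ 0 → R z = E.bcalc (cauchyKernel z) := fun z hz =>
    (hR z hz).unique (hE.isResolventAt hH hz)
  refine ⟨fun ψ hψ t => hU.hasDerivAt hψ t, hE.mem_range_singleton_iff hH,
    fun ψ hψ t => ProjectionValuedMeasure.hasSum_unitaryGroup hψ t,
    ProjectionValuedMeasure.tendsto_average_unitaryGroup,
    fun ψ t => ProjectionValuedMeasure.inner_bcalc (isBoundedBorel_expKernel t) ψ,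
    fun ψ hψ φ => ?_, fun z ψ hz => ?_, fun z ψ hz => ?_, fun hcac ψ => ?_⟩
  · obtain ⟨g, rp, rm, hg, hcalc, hB, hderiv, hp, hm, hjump⟩ :=
      ProjectionValuedMeasure.exists_density_boundaryValues hψ φ
    have hpi : (2 * Real.pi * Complex.I : ℂ) ≠ 0 := Complex.two_pi_I_ne_zero
    have hg' : ∀ᵐ l : ℝ, g l = (2 * Real.pi * Complex.I)⁻¹ * (rp l - rm l) := by
      filter_upwards [hjump] with l hl
      rw [hl, inv_mul_cancel_left₀ hpi]
    refine ⟨g, rp, rm, hg, hB, hderiv, ?_, ?_, hg',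
      fun t => hcalc _ (isBoundedBorel_expKernel t), fun t => ?_⟩
    · filter_upwards [hp] with l hl
      refine hl.congr' ?_
      filter_upwards [self_mem_nhdsWithin] with ε hε
      rw [hRE _ (by simpa using (ne_of_gt hε : ε ≠ 0))]
    · filter_upwards [hm] with l hl
      refine hl.congr' ?_
      filter_upwards [self_mem_nhdsWithin] with ε hε
      rw [hRE _ (by simpa using (ne_of_gt hε : ε ≠ 0))]
    · rw [← integral_const_mul, ProjectionValuedMeasure.unitaryGroup_apply,
        hcalc _ (isBoundedBorel_expKernel t)]
      refine integral_congr_ae ?_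
      filter_upwards [hg'] with l hl
      rw [hl, expKernel, mul_left_comm]
  · rw [hRE z hz.ne']
    exact ProjectionValuedMeasure.bcalc_cauchyKernel_eq_integral_Ioi hz ψ
  · rw [hRE z hz.ne]
    exact ProjectionValuedMeasure.bcalc_cauchyKernel_eq_integral_Iio hz ψ
  · rw [← hcac]
    exact ProjectionValuedMeasure.exists_add_mem_continuousSubspace ψ
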